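/- Let $p$ be a prime, $q=p^a$ with $a\ge 1$, and let $f\in\mathbb F_q[X_1,\dots,X_n]$ have total degree $d$. Rings. Let $R_0$ be the ring of integers of the unramified extension of $\mathbb Q_p$ of degree $a$ (that is, the ring of Witt vectors of $\mathbb F_q$), and let $R=R_0[\pi]$ with $\pi^{p-1}=-p$. Let $\tau$ be the automorphism of $R$ that fixes $\pi$ and lifts the $p$-th power Frobenius of $\mathbb F_q$ on $R_0$; it induces an automorphism of $R/(p^N)$, also denoted $\tau$, and it acts entrywise on matrices. Power series. Let $\theta(z)=\exp(\pi z-\pi z^p)=\sum_{i\ge 0}\frac{\pi^i}{i!}(z-z^p)^i$, which has coefficients in $R$. Write $X_0f=\sum_{j\in J}\bar a_jX^j$, where $J$ is the support of $X_0 f$ and $X=(X_0,\dots,X_n)$. Let $a_j\in R_0$ be the Teichmüller lift of $\bar a_j$, and put $F(X)=\prod_{j\in J}\theta(a_jX^j)=\sum_r F_rX^r\in R[[X]]$, with $F_r=0$ when $r$ has a negative entry. Polytopes. Let $\delta\subset\mathbb R^n$ be a convex polytope with integer vertices that contains the convex hull of the support of $f$ and is contained in the convex hull of $0,de_1,\dots,de_n$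 (where $d$ is read as $0$ if $f=0$). Let $\Delta\subset\mathbb R^{n+1}$ be the convex hull of $0$ and $\{1\}\times\delta$, and let $C(\Delta)=\{cx : c\ge 0,\ x\in\Delta\}$. Put $w(r)=r_0$ if $r\in C(\Delta)$ and $w(r)=\infty$ otherwise. Matrices. Let $M$ be the infinite matrix with rows and columns indexed by $C(\Delta)\cap\mathbb Z_{\ge0}^{n+1}$ and with entries $m_{uv}=\tau^{-1}(F_{pu-v})$. For a positive integer $N$, let $A_N$ be the square matrix over $R/(p^N)$ obtained by reducing modulo $p^N$ the entries of $M$ whose row and column indices $u$ satisfy $w(u)<\left(\frac{p}{p-1}\right)^2N$. Theorem. For every positive integer $N$ the matrix $A_N$ is finite. For every $k\ge1$, with $N_k^*$ the number of solutions of $f=0$ in $(\mathbb F_{q^k}^*)^n$, $$(q^k-1)^{n+1}\,\mathrm{Tr}\Big(\big(A_N\,\tau^{-1}(A_N)\cdots\tau^{-(a-1)}(A_N)\big)^k\Big)=q^kN_k^*-(q^k-1)^n\quad\text{in } R/(p^N).$$ Moreover, the size of $A_N$ is the number of lattice points (points of $\mathbb Z^{n+1}$) in $t\Delta$, where $t=\lceil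 p^2N/(p-1)^2\rceil-1$. -/

import Mathlib

open scoped Pointwise

noncomputable section

namespace DworkTrace

/-! ### The p-adic ring `R = R₀[π]`, `π ^ (p - 1) = -p`

`R₀` is the ring of integers of the unramified extension of `ℚ_p` with residue field `F`; it is
the ring of Witt vectors `𝕎 F` of the finite field `F`. -/

section Ring

variable (p : ℕ) [hp : Fact p.Prime] (F : Type*) [Field F] [CharP F p]

/-- The polynomial `y ^ (p - 1) + p` over `R₀`, with root `π`. -/
def piPoly : Polynomial (WittVector p F) :=
  Polynomial.X ^ (p - 1) + Polynomial.C (p : WittVector p F)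

/-- The ring `R = R₀[π]`. -/
abbrev DRing : Type _ := AdjoinRoot (piPoly p F)

/-- The element `π` of `R`. -/
def piElt : DRing p F := AdjoinRoot.root (piPoly p F)

theorem piElt_pow : piElt p F ^ (p - 1) = -(p : DRing p F) := by
  have h : AdjoinRoot.mk (piPoly p F) (piPoly p F) = 0 := AdjoinRoot.mk_self
  have h' : piElt p F ^ (p - 1) + (p : DRing p F) = 0 := by
    conv at h => lhs; arg 2; unfold piPoly
    rw [map_add, map_pow, AdjoinRoot.mk_X, AdjoinRoot.mk_C, map_natCast] at h
    exact h
  exact eq_neg_of_add_eq_zero_left h'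

/-- The Teichmüller lift of an element of the residue field, as an element of `R`. -/
def teich (x : F) : DRing p F :=
  AdjoinRoot.of (piPoly p F) (WittVector.teichmuller p x)

/-- The automorphism `τ` of `R` that fixes `π` and is the Frobenius automorphism on `R₀`. -/
def tau [Finite F] : DRing p F ≃+* DRing p F :=
  AdjoinRoot.mapRingEquiv (WittVector.frobeniusEquiv p F) (piPoly p F) (piPoly p F) (by
    have h : (piPoly p F).map (WittVector.frobeniusEquiv p F : WittVector p F →+* WittVector p F)
        = piPoly p F := by
      simp [piPoly]
    rw [h])

/-- `R / (p ^ N)`. -/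
abbrev DRingMod (N : ℕ) : Type _ := DRing p F ⧸ Ideal.span {(p : DRing p F) ^ N}

/-- The automorphism of `R / (p ^ N)` induced by `τ`. -/
def tauMod [Finite F] (N : ℕ) : DRingMod p F N ≃+* DRingMod p F N :=
  Ideal.quotientEquiv _ _ (tau p F) (by
    rw [Ideal.map_span, Set.image_singleton]
    simp)

theorem exists_factorial_eq (d : ℕ) :
    ∃ m, d.factorial = p ^ padicValNat p d.factorial * m ∧ ¬ p ∣ m := by
  obtain ⟨m, hm⟩ := pow_padicValNat_dvd (p := p) (n := d.factorial)
  refine ⟨m, hm, fun hd => pow_succ_padicValNat_not_dvd (p := p) (Nat.factorial_ne_zero d) ?_⟩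
  have h := Nat.mul_dvd_mul_left (p ^ padicValNat p d.factorial) hd
  rwa [← hm, ← pow_succ] at h

theorem isUnit_natCast_witt {m : ℕ} (hm : ¬ p ∣ m) : IsUnit (m : WittVector p F) := by
  apply WittVector.isUnit_of_coeff_zero_ne_zero
  have h1 : (m : WittVector p F).coeff 0 = (m : F) :=
    map_natCast (WittVector.constantCoeff (p := p) (R := F)) m
  rw [h1]
  exact fun h => hm ((CharP.cast_eq_zero_iff F p m).mp h)

theorem factorial_dvd_piElt_pow (d : ℕ) : (d.factorial : DRing p F) ∣ piElt p F ^ d := by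
  obtain ⟨m, hm, hm'⟩ := exists_factorial_eq p d
  have hunit : IsUnit (m : DRing p F) := by
    simpa using (isUnit_natCast_witt p F hm').map (AdjoinRoot.of (piPoly p F))
  have hle : (p - 1) * padicValNat p d.factorial ≤ d := by
    rw [sub_one_mul_padicValNat_factorial]
    exact Nat.sub_le _ _
  have h2 : (p : DRing p F) ^ padicValNat p d.factorial ∣
      piElt p F ^ ((p - 1) * padicValNat p d.factorial) := by
    rw [pow_mul, piElt_pow]
    exact pow_dvd_pow_of_dvd (dvd_neg.mpr dvd_rfl) _
  have h3 : (d.factorial : DRing p F) = (p : DRing p F) ^ padicValNat p d.factorial * m := by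
    conv_lhs => rw [hm]
    push_cast
    rfl
  rw [h3, hunit.mul_right_dvd]
  exact h2.trans (pow_dvd_pow _ hle)

/-- The element `π ^ d / d!` of `R`. -/
def piDiv (d : ℕ) : DRing p F := (factorial_dvd_piElt_pow p F d).choose

theorem factorial_mul_piDiv (d : ℕ) : (d.factorial : DRing p F) * piDiv p F d = piElt p F ^ d :=
  (factorial_dvd_piElt_pow p F d).choose_spec.symm

/-- `π ^ d / d!` is determined by its defining equation. -/
theorem eq_piDiv (d : ℕ) (x : DRing p F) (hx : (d.factorial : DRing p F) * x = piElt p F ^ d) :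
    x = piDiv p F d := by
  have hmonic : (piPoly p F).Monic :=
    Polynomial.monic_X_pow_add_C _ (Nat.sub_pos_of_lt hp.out.one_lt).ne'
  have := hmonic.free_adjoinRoot
  have hp0 : ((p : ℕ) : WittVector p F) ≠ 0 := WittVector.p_nonzero p F
  have hfac : (d.factorial : WittVector p F) ≠ 0 := by
    obtain ⟨m, hm, hm'⟩ := exists_factorial_eq p d
    rw [hm, Nat.cast_mul, Nat.cast_pow]
    exact mul_ne_zero (pow_ne_zero _ hp0) (isUnit_natCast_witt p F hm').ne_zero
  have h3 : (d.factorial : WittVector p F) • x = (d.factorial : WittVector p F) • piDiv p F d := by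
    rw [Algebra.smul_def, Algebra.smul_def, map_natCast, hx, factorial_mul_piDiv]
  exact smul_right_injective _ hfac h3

/-- The power series `exp (π z) = ∑ (π ^ d / d!) z ^ d` over `R`. -/
def expPi : PowerSeries (DRing p F) := PowerSeries.mk (piDiv p F)

/-- Dwork's splitting function
`θ(z) = exp (π z - π z ^ p) = ∑ (π ^ d / d!) (z - z ^ p) ^ d`. -/
def theta : PowerSeries (DRing p F) :=
  PowerSeries.subst (PowerSeries.X - PowerSeries.X ^ p : PowerSeries (DRing p F)) (expPi p F)

end Ring

/-! ### The power series `F` attached to the polynomial `f` -/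

section Series

variable (p : ℕ) [Fact p.Prime] {F : Type*} [Field F] [CharP F p] {n : ℕ}

/-- `X₀ f(X₁, …, Xₙ)`. -/
def homog (f : MvPolynomial (Fin n) F) : MvPolynomial (Fin (n + 1)) F :=
  MvPolynomial.X 0 * MvPolynomial.rename Fin.succ f

/-- `F(X) = ∏_{j ∈ J} θ(a_j X ^ j)`, where `J` is the support of `X₀ f` and `a_j` is the
Teichmüller lift of the coefficient of `X ^ j` in `X₀ f`. -/
def dworkF (f : MvPolynomial (Fin n) F) : MvPowerSeries (Fin (n + 1)) (DRing p F) :=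
  ∏ j ∈ (homog f).support,
    PowerSeries.subst (MvPowerSeries.monomial j (teich p F ((homog f).coeff j))) (theta p F)

end Series

/-! ### Polytopes, the cone `C(Δ)` and the weight function -/

section Polytope

variable {n : ℕ}

/-- Convex hulls of finitely many points with integer coordinates. -/
def IsLatticePolytope (δ : Set (Fin n → ℝ)) : Prop :=
  ∃ S : Finset (Fin n → ℤ), δ = convexHull ℝ ((fun v i => (v i : ℝ)) '' (S : Set (Fin n → ℤ)))

/-- The Newton polytope of `f`: the convex hull of the exponents of its non-zero terms. -/
def newtonPolytope {F : Type*} [Field F] (f : MvPolynomial (Fin n) F) : Set (Fin n → ℝ) :=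
  convexHull ℝ ((fun v i => (v i : ℝ)) '' (f.support : Set (Fin n →₀ ℕ)))

/-- The convex hull of the origin and of `d e₁, …, d eₙ`. -/
def bigSimplex (n d : ℕ) : Set (Fin n → ℝ) :=
  convexHull ℝ (insert 0 (Set.range fun i : Fin n => (Pi.single i (d : ℝ) : Fin n → ℝ)))

/-- `Δ`: the convex hull in `ℝ^{n+1}` of the origin and of `{1} × δ`. -/
def bigDelta (δ : Set (Fin n → ℝ)) : Set (Fin (n + 1) → ℝ) :=
  convexHull ℝ (insert 0 ((fun x => (Fin.cons (1 : ℝ) x : Fin (n + 1) → ℝ)) '' δ))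

/-- `C(Δ)`: the union of the rays from the origin through the points of `Δ`. -/
def cone (δ : Set (Fin n → ℝ)) : Set (Fin (n + 1) → ℝ) :=
  {x | ∃ c : ℝ, 0 ≤ c ∧ ∃ y ∈ bigDelta δ, x = c • y}

open Classical in
/-- The weight `w(r) = r₀` for `r ∈ C(Δ)`, and `w(r) = ∞` otherwise. -/
def weight (δ : Set (Fin n → ℝ)) (r : Fin (n + 1) → ℝ) : WithTop ℝ :=
  if r ∈ cone δ then ((r 0 : ℝ) : WithTop ℝ) else ⊤

/-- The set `C(Δ) ∩ ℤ_{≥0}^{n+1}` of exponents. -/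
def ConePt (δ : Set (Fin n → ℝ)) : Type :=
  {u : Fin (n + 1) →₀ ℕ // (fun i => (u i : ℝ)) ∈ cone δ}

/-- The `u ∈ C(Δ) ∩ ℤ_{≥0}^{n+1}` with `w(u) < (p / (p - 1)) ^ 2 * N`. -/
def SmallPt (p N : ℕ) (δ : Set (Fin n → ℝ)) : Type :=
  {u : ConePt δ // weight δ (fun i => (u.1 i : ℝ)) <
    ((((p : ℝ) / ((p : ℝ) - 1)) ^ 2 * (N : ℝ) : ℝ) : WithTop ℝ)}

instance (p N : ℕ) (δ : Set (Fin n → ℝ)) : DecidableEq (SmallPt p N δ) :=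
  fun u v => decidable_of_iff (u.1.1 = v.1.1)
    ⟨fun h => Subtype.ext (Subtype.ext h), fun h => by rw [h]⟩

end Polytope

/-! ### The infinite matrix `M` and its truncations `A_N` -/

section Matrices

variable (p : ℕ) [Fact p.Prime] {F : Type*} [Field F] [CharP F p] [Finite F] {n : ℕ}

/-- The infinite matrix `M` with entries `m_{uv} = τ⁻¹(F_{pu - v})`, where coefficients at
exponents with a negative entry are zero. -/
def dworkM (f : MvPolynomial (Fin n) F) (δ : Set (Fin n → ℝ)) :
    Matrix (ConePt δ) (ConePt δ) (DRing p F) :=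
  fun u v => (tau p F).symm
    (if v.1 ≤ p • u.1 then MvPowerSeries.coeff (p • u.1 - v.1) (dworkF p f) else 0)

/-- `A_N`: the rows and columns of `M` indexed by the `u` with `w(u) < (p / (p - 1)) ^ 2 * N`,
reduced modulo `p ^ N`. -/
def dworkA (f : MvPolynomial (Fin n) F) (δ : Set (Fin n → ℝ)) (N : ℕ) :
    Matrix (SmallPt p N δ) (SmallPt p N δ) (DRingMod p F N) :=
  ((dworkM p f δ).submatrix Subtype.val Subtype.val).map (Ideal.Quotient.mk _)

/-- The ordered product `A_N · τ⁻¹(A_N) ⋯ τ^{-(a-1)}(A_N)`, where `τ` acts entrywise. -/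
def dworkProd (f : MvPolynomial (Fin n) F) (δ : Set (Fin n → ℝ)) (N a : ℕ)
    [Fintype (SmallPt p N δ)] : Matrix (SmallPt p N δ) (SmallPt p N δ) (DRingMod p F N) :=
  ((List.range a).map fun i => (dworkA p f δ N).map ((tauMod p F N).symm)^[i]).prod

end Matrices

/-- The number of zeros of `f` in the torus `(Eˣ)^n`, for an extension field `E` of `F`. -/
def torusCount {F : Type*} [Field F] {n : ℕ} (f : MvPolynomial (Fin n) F)
    (E : Type*) [Field E] [Algebra F E] : ℕ :=
  Nat.card {x : Fin n → Eˣ // MvPolynomial.aeval (fun i => (x i : E)) f = 0}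

/-- The number of lattice points in a subset of `ℝ^m`. -/
def latticeCount {m : ℕ} (P : Set (Fin m → ℝ)) : ℕ :=
  Set.ncard {u : Fin m → ℤ | (fun i => (u i : ℝ)) ∈ P}

end DworkTrace

end

/-! Let `E` be the field with `q^k = p^m` elements, `m = ak`. For `x` in `E` with Teichmüller lift
`t`, Dwork's product `ψ(x) = ∏_{i<m} θ(t^(p^i))` behaves as a nontrivial additive character. Hence
the sum of `ψ(x₀ f(x))` over the torus `(Eˣ)^(n+1)` is `q^k N_k^* - (q^k - 1)^n`: the sum over `x₀`
is `q^k - 1` where `f` vanishes and `-1` elsewhere (`sum_prod_character`). Additivity also splits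
`ψ(x₀ f(x))` over the terms of `X₀ f`, so the same sum is the sum over Teichmüller points of the
product of the series `τ^(-(i+1))F` at `X^(p^(m-1-i))`, `i < m`. Orthogonality of roots of unity
turns it into `(q^k - 1)^(n+1)` times the sum of the coefficients at the exponents `(q^k - 1)u`
(`sum_eval_eq`). That last sum is the trace of a product of matrices, since `(G_{pu-v})(H_{qv-w})`
is the matrix with entries `(G(X^q)H)_{pqu-w}` (`coeffMat_mul`).

No convergence is needed. Modulo a power of `p` only finitely many coefficients of `θ` survive, so
`F` becomes a polynomial and the matrices may be cut to a finite box of exponents. The character is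
likewise handled only modulo powers of `p`: a formal identity gives `ψ(x)^p ≡ 1`, the expansion of
`θ` gives `ψ(x) ≡ 1 + π Tr(t)` modulo `π²`, and a `p`-th root of unity congruent to `1` modulo `π²`
is `1` (`thetaChar_add`, `sum_thetaChar`).

To pass from the box to `A_N`, the estimate `ord_p θ_i ≥ i(p-1)/p²` is used. It comes from writing
`θ(z)` as the Artin-Hasse exponential at `πz`, which is integral, times exponentials of the terms
`-(πz)^(p^j)/p^j` with `j ≥ 2` (`pow_dvd_coeff_theta`). The entry at `(u, v)` then has order at
least `(p u₀ - v₀)(p-1)/p² = (u₀ - v₀)(p-1)/p² + u₀((p-1)/p)²`. Along a closed cycle of indices the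
first summand telescopes, so rows with `u₀ ≥ (p/(p-1))² N` do not affect the trace. Indices outside
the cone drop out because an entry vanishes unless `pu - v` lies in the cone, which makes the
matrices block triangular (`trace_prod_eq_trace_prod_submatrix`).

The point count lives over `R_E/(p^N)` and the trace over `R/(p^N)`; the two are compared through
the injection `extMod`. The size of `A_N` is read off from the description of `tΔ` as the part of
the cone with `x₀ ≤ t`. -/

noncomputable section
set_option linter.unusedSectionVars false
namespace DworkTrace

/-! ### Exponentials of power series -/

section Exponential

open PowerSeries

variable {K : Type*} [Field K] [CharZero K]

/-- `g` is the exponential of `h`: it has constant term `1` and logarithmic derivative `h'`. -/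
def IsExp (h g : K⟦X⟧) : Prop := constantCoeff g = 1 ∧ d⁄dX K g = d⁄dX K h * g

theorem IsExp.add {h g h' g' : K⟦X⟧} (H : IsExp h g) (H' : IsExp h' g') :
    IsExp (h + h') (g * g') := by
  refine ⟨by rw [map_mul, H.1, H'.1, one_mul], ?_⟩
  rw [Derivation.leibniz, H.2, H'.2, map_add, smul_eq_mul, smul_eq_mul]
  ring

theorem isExp_zero : IsExp (0 : K⟦X⟧) 1 := by simp [IsExp]

theorem IsExp.sum {ι : Type*} (s : Finset ι) {h g : ι → K⟦X⟧} (H : ∀ i ∈ s, IsExp (h i) (g i)) :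
    IsExp (∑ i ∈ s, h i) (∏ i ∈ s, g i) := by
  classical
  induction s using Finset.induction_on with
  | empty => simpa using isExp_zero
  | insert i s hi ih =>
    rw [Finset.sum_insert hi, Finset.prod_insert hi]
    exact (H i (Finset.mem_insert_self _ _)).add
      (ih fun j hj => H j (Finset.mem_insert_of_mem hj))

theorem IsExp.nsmul {h g : K⟦X⟧} (H : IsExp h g) (n : ℕ) : IsExp (n • h) (g ^ n) := by
  simpa using IsExp.sum (Finset.range n) (fun _ _ => H)

theorem IsExp.subst {h g : K⟦X⟧} (H : IsExp h g) {a : K⟦X⟧} (ha : constantCoeff a = 0) :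
    IsExp (h.subst a) (g.subst a) := by
  have hs : HasSubst a := HasSubst.of_constantCoeff_zero' ha
  refine ⟨?_, by rw [derivative_subst hs, derivative_subst hs, H.2, subst_mul hs]; ring⟩
  have h1 : g = (g - 1) + C 1 := by simp
  have h2 : constantCoeff ((g - 1).subst a) = 0 :=
    constantCoeff_subst_eq_zero ha _ (by simp [H.1])
  have h3 : (C (1 : K)).subst a = C 1 := subst_C (a := a) 1
  rw [h1, subst_add hs, map_add, h2, h3]
  simp

theorem isExp_subst {h : K⟦X⟧} (hh : constantCoeff h = 0) : IsExp h ((exp K).subst h) := by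
  have h1 : IsExp (X : K⟦X⟧) (exp K) := ⟨by simp, by simp [derivative_exp]⟩
  have h2 := h1.subst hh
  rwa [subst_X (HasSubst.of_constantCoeff_zero' hh)] at h2

/-- Every exponential of `h` is inverse to `exp(-h)`: the product has derivative `0` and constant
term `1`, hence equals `1` in characteristic zero. Identities between exponentials thereby reduce to
identities between their exponents. -/
theorem IsExp.unique {h g g' : K⟦X⟧} (hh : constantCoeff h = 0) (H : IsExp h g)
    (H' : IsExp h g') : g = g' := by
  have hn : IsExp (-h) ((exp K).subst (-h)) := isExp_subst (by simp [hh])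
  have key : ∀ {g : K⟦X⟧}, IsExp h g → g * (exp K).subst (-h) = 1 := fun {g} H => by
    have := H.add hn
    rw [add_neg_cancel] at this
    exact derivative.ext (by simpa using this.2) (by simpa using this.1)
  calc g = g * (g' * (exp K).subst (-h)) := by rw [key H', mul_one]
    _ = g' * (g * (exp K).subst (-h)) := by ring
    _ = g' := by rw [key H, mul_one]

theorem IsExp.subst_X_pow {h g : K⟦X⟧} (H : IsExp h g) {k : ℕ} (hk : k ≠ 0) :
    IsExp (h.subst (X ^ k : K⟦X⟧)) (g.subst (X ^ k : K⟦X⟧)) :=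
  H.subst (by simp [hk])

theorem isExp_rescale_exp (c : K) : IsExp (C c * X) (rescale c (exp K)) := by
  rw [rescale_eq_subst, ← smul_eq_C_mul]
  exact isExp_subst (by simp)

theorem IsExp.coeff_monomial {c : K} {k : ℕ} (hk : k ≠ 0) {g : K⟦X⟧} (H : IsExp (C c * X ^ k) g)
    (i : ℕ) : coeff i g = if k ∣ i then c ^ (i / k) / (i / k).factorial else 0 := by
  have h1 := (isExp_rescale_exp c).subst_X_pow hk
  have hs : HasSubst (X ^ k : K⟦X⟧) := HasSubst.X_pow hk
  have h2 : (C c * X : K⟦X⟧).subst (X ^ k : K⟦X⟧) = C c * X ^ k := by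
    rw [← smul_eq_C_mul, subst_smul hs, subst_X hs, smul_eq_C_mul]
  rw [h2] at h1
  rw [H.unique (by simp [hk]) h1, coeff_subst_X_pow hk]
  simp [coeff_rescale, coeff_exp, div_eq_mul_inv]

/-- The differential equation expresses the coefficient of degree `i > 0` of `g` through
coefficients of `h` of degrees between `1` and `i`. -/
theorem IsExp.coeff_eq_zero {h g : K⟦X⟧} (H : IsExp h g) {M : ℕ}
    (hM : ∀ i < M, coeff i h = 0) {i : ℕ} (hi : 0 < i) (hiM : i < M) : coeff i g = 0 := by
  obtain ⟨j, rfl⟩ : ∃ j, i = j + 1 := ⟨i - 1, by omega⟩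
  have h1 : coeff j (d⁄dX K g) = 0 := by
    rw [H.2, coeff_mul]
    refine Finset.sum_eq_zero fun x hx => ?_
    rw [coeff_derivative, hM, zero_mul, zero_mul]
    have := Finset.HasAntidiagonal.mem_antidiagonal.mp hx
    omega
  rw [coeff_derivative] at h1
  exact (mul_eq_zero.mp h1).resolve_right (by exact_mod_cast Nat.succ_ne_zero j)

theorem IsExp.map {K' : Type*} [Field K'] [CharZero K'] (φ : K →+* K') {h g : K⟦X⟧}
    (H : IsExp h g) : IsExp (PowerSeries.map φ h) (PowerSeries.map φ g) := by
  have hd : ∀ f : K⟦X⟧, d⁄dX K' (PowerSeries.map φ f) = PowerSeries.map φ (d⁄dX K f) :=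
    fun f => by ext; simp [coeff_derivative]
  refine ⟨?_, by rw [hd, hd, H.2, map_mul]⟩
  rw [← coeff_zero_eq_constantCoeff_apply, coeff_map, coeff_zero_eq_constantCoeff_apply, H.1,
    map_one]

theorem IsExp.rescale {h g : K⟦X⟧} (H : IsExp h g) (c : K) :
    IsExp (PowerSeries.rescale c h) (PowerSeries.rescale c g) := by
  have hd : ∀ f : K⟦X⟧, d⁄dX K (PowerSeries.rescale c f) =
      C c * PowerSeries.rescale c (d⁄dX K f) := fun f => by
    ext; simp [coeff_derivative, coeff_rescale, pow_succ]; ring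
  refine ⟨?_, by rw [hd, hd, H.2, map_mul, mul_assoc]⟩
  rw [← coeff_zero_eq_constantCoeff_apply, coeff_rescale, coeff_zero_eq_constantCoeff_apply, H.1]
  simp

end Exponential

/-! ### Integrality of the Artin-Hasse exponential -/

section ArtinHasse

open PowerSeries

variable (p : ℕ) [hp : Fact p.Prime]

open Classical in
/-- The logarithm `∑ z ^ (p ^ j) / p ^ j` of the Artin-Hasse exponential. -/
def ahLog (K : Type*) [Field K] : K⟦X⟧ :=
  PowerSeries.mk fun i => if ∃ j, i = p ^ j then (i : K)⁻¹ else 0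

theorem not_exists_zero_eq_pow : ¬ ∃ j, 0 = p ^ j := by
  rintro ⟨j, hj⟩
  exact (pow_pos hp.out.pos j).ne hj

theorem constantCoeff_ahLog (K : Type*) [Field K] : constantCoeff (ahLog p K) = 0 := by
  rw [← coeff_zero_eq_constantCoeff_apply, ahLog, coeff_mk, if_neg (not_exists_zero_eq_pow p)]

/-- Exponentiated, this is the functional equation `E(z)^p = exp(pz) E(z^p)` on which Dwork's
integrality argument rests. -/
theorem smul_ahLog (K : Type*) [Field K] [CharZero K] :
    p • ahLog p K = C (p : K) * X + (ahLog p K).subst (X ^ p : K⟦X⟧) := by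
  have hp0 : (p : K) ≠ 0 := by exact_mod_cast hp.out.ne_zero
  ext i
  rw [map_add, coeff_subst_X_pow hp.out.ne_zero, map_nsmul, coeff_C_mul, coeff_X, ahLog, coeff_mk,
    coeff_mk]
  by_cases h1 : i = 1
  · subst h1
    rw [if_pos ⟨0, by simp⟩, if_pos rfl, if_neg (fun h => hp.out.one_lt.ne' (Nat.dvd_one.mp h))]
    simp
  rw [if_neg h1, mul_zero, zero_add]
  by_cases h2 : p ∣ i
  · obtain ⟨k, rfl⟩ := h2
    rw [if_pos (Dvd.intro k rfl), Nat.mul_div_cancel_left _ hp.out.pos]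
    have : (∃ j, p * k = p ^ j) ↔ ∃ j, k = p ^ j := by
      constructor
      · rintro ⟨j, hj⟩
        cases j with
        | zero => exact absurd (Nat.dvd_one.mp ⟨k, by simpa using hj.symm⟩) hp.out.one_lt.ne'
        | succ j => exact ⟨j, Nat.eq_of_mul_eq_mul_left hp.out.pos (by rw [hj, pow_succ']) ⟩
      · rintro ⟨j, rfl⟩; exact ⟨j + 1, by rw [pow_succ']⟩
    by_cases h3 : ∃ j, k = p ^ j
    · rw [if_pos h3, if_pos (this.mpr h3), Nat.cast_mul, mul_inv, nsmul_eq_mul,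
        mul_inv_cancel_left₀ hp0]
      rfl
    · rw [if_neg h3, if_neg (mt this.mp h3), smul_zero, map_zero]
  · have h3 : ¬ ∃ j, i = p ^ j := by
      rintro ⟨j, rfl⟩
      cases j with
      | zero => exact h1 (by simp)
      | succ j => exact h2 (dvd_pow_self _ (Nat.succ_ne_zero _))
    rw [if_neg h2, if_neg h3, smul_zero]

/-- Legendre's formula: `(p-1) v_p(i!)` is `i` minus the sum of the base-`p` digits of `i`, and that
sum is at least `1` for `i > 0`. -/
theorem sub_one_mul_padicValNat_factorial_le {i : ℕ} (hi : 0 < i) :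
    (p - 1) * padicValNat p i.factorial + 1 ≤ i := by
  rw [sub_one_mul_padicValNat_factorial]
  have h1 : 0 < (p.digits i).sum := by
    by_contra h
    have h0 : ∀ d ∈ p.digits i, d = 0 := fun d hd => by
      have := List.single_le_sum (fun _ _ => Nat.zero_le _) d hd
      omega
    have := Nat.getLast_digit_ne_zero p hi.ne'
    exact this (h0 _ (List.getLast_mem _))
  have := Nat.digit_sum_le p i
  omega

theorem exists_padicInt_pow_div_factorial {i : ℕ} (hi : 0 < i) :
    ∃ z : ℤ_[p], (p : ℚ_[p]) ^ i / i.factorial = p * z := by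
  have hp0 : (p : ℚ_[p]) ≠ 0 := by exact_mod_cast hp.out.ne_zero
  have h0 : (i.factorial : ℚ_[p]) ≠ 0 := by exact_mod_cast Nat.factorial_ne_zero i
  refine ⟨⟨(p : ℚ_[p]) ^ (i - 1) / i.factorial, ?_⟩, ?_⟩
  · rw [norm_div, norm_pow, Padic.norm_p, div_le_one (norm_pos_iff.mpr h0)]
    have h1 := Padic.norm_eq_zpow_neg_valuation h0
    rw [h1, Padic.valuation_natCast, inv_pow, ← zpow_natCast, ← zpow_neg]
    refine zpow_le_zpow_right₀ (by exact_mod_cast hp.out.one_lt.le) ?_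
    have h2 := sub_one_mul_padicValNat_factorial_le p hi
    have h3 : 1 * padicValNat p i.factorial ≤ (p - 1) * padicValNat p i.factorial :=
      Nat.mul_le_mul_right _ (by have := hp.out.two_le; omega)
    omega
  · simp only
    rw [← mul_div_assoc, ← pow_succ', Nat.sub_add_cancel hi]

theorem dvd_expand_sub_pow (f : Polynomial ℤ_[p]) :
    ∃ g, f ^ p = Polynomial.expand ℤ_[p] p f + Polynomial.C (p : ℤ_[p]) * g := by
  have h : Polynomial.C (p : ℤ_[p]) ∣ f ^ p - Polynomial.expand ℤ_[p] p f := by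
    rw [Polynomial.C_dvd_iff_dvd_coeff]
    intro i
    have h1 : (f ^ p - Polynomial.expand ℤ_[p] p f).map (PadicInt.toZMod (p := p)) = 0 := by
      rw [Polynomial.map_sub, Polynomial.map_pow, Polynomial.map_expand, ZMod.expand_card, sub_self]
    have h2 := congrArg (fun q => q.coeff i) h1
    simp only [Polynomial.coeff_map, Polynomial.coeff_zero] at h2
    rw [← RingHom.mem_ker, PadicInt.ker_toZMod, PadicInt.maximalIdeal_eq_span_p,
      Ideal.mem_span_singleton] at h2
    exact h2
  obtain ⟨g, hg⟩ := h
  exact ⟨g, by rw [← hg]; ring⟩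

/-- Dwork's lemma for the Artin-Hasse exponential. -/
theorem norm_coeff_artinHasse_le {E : ℚ_[p]⟦X⟧} (hE : IsExp (ahLog p ℚ_[p]) E) (n : ℕ) :
    ‖coeff n E‖ ≤ 1 := by
  have hp0 : (p : ℚ_[p]) ≠ 0 := by exact_mod_cast hp.out.ne_zero
  -- Both sides of this equation are compared at `z^n`. With `f` the truncation of `E` below degree
  -- `n`, the left side is the coefficient of `f^p` plus `p e_n`, where `e_n` is the coefficient of
  -- `E`. The right side is that of `f(z^p)` plus an element of `pℤ_p`, since `exp(pz) ≡ 1` modulo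
  -- `p`. As `f^p ≡ f(z^p)` modulo `p`, it follows that `p e_n ∈ pℤ_p`.
  have key : E ^ p = rescale (p : ℚ_[p]) (exp ℚ_[p]) * E.subst (X ^ p : ℚ_[p]⟦X⟧) := by
    refine (hE.nsmul p).unique (by simp [constantCoeff_ahLog]) ?_
    rw [smul_ahLog]
    exact (isExp_rescale_exp _).add (hE.subst_X_pow hp.out.ne_zero)
  induction n using Nat.strong_induction_on with
  | _ n ih =>
    rcases Nat.eq_zero_or_pos n with rfl | hn
    · rw [coeff_zero_eq_constantCoeff_apply, hE.1]; simp
    -- the truncation of `E`, as a polynomial with integral coefficients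
    obtain ⟨f, hf⟩ : ∃ f : Polynomial ℤ_[p], ∀ i,
        ((f.coeff i : ℤ_[p]) : ℚ_[p]) = if i < n then coeff i E else 0 := by
      have hc : ∀ i : Fin n, ∃ c : ℤ_[p], (c : ℚ_[p]) = coeff i.1 E := fun i => ⟨⟨_, ih _ i.2⟩, rfl⟩
      choose c hc using hc
      refine ⟨∑ i : Fin n, Polynomial.monomial i.1 (c i), fun i => ?_⟩
      rw [Polynomial.finsetSum_coeff]
      simp only [Polynomial.coeff_monomial]
      split_ifs with h
      · rw [Finset.sum_eq_single ⟨i, h⟩]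
        · simp [hc]
        · intro b _ hb
          rw [if_neg]
          rintro rfl
          exact hb rfl
        · simp
      · rw [Finset.sum_eq_zero]
        · simp
        · intro b _
          rw [if_neg]
          rintro rfl
          exact h b.2
    set φ : Polynomial ℤ_[p] →+* ℚ_[p]⟦X⟧ :=
      (Polynomial.coeToPowerSeries.ringHom).comp (Polynomial.mapRingHom PadicInt.Coe.ringHom)
      with hφ
    have hφc : ∀ g i, coeff i (φ g) = ((g.coeff i : ℤ_[p]) : ℚ_[p]) := fun g i => by
      simp [hφ]; rfl
    obtain ⟨r, hr⟩ : ∃ r, E = φ f + X ^ n * r := by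
      have : X ^ n ∣ E - φ f := by
        rw [X_pow_dvd_iff]
        intro m hm
        rw [map_sub, hφc, hf, if_pos hm, sub_self]
      obtain ⟨r, hr⟩ := this
      exact ⟨r, by rw [← hr]; ring⟩
    have hr0 : coeff 0 r = coeff n E := by
      rw [hr, map_add, hφc, hf, if_neg (lt_irrefl n), zero_add]
      simpa using (coeff_X_pow_mul r n 0).symm
    have hlhs : coeff n (E ^ p) = coeff n (φ (f ^ p)) + p * coeff n E := by
      -- Expand `(φ f + X^n r)^p` to second order: the quadratic remainder is divisible by `X^(2n)`,
      -- and the linear term contributes exactly `p e_n` because `f` has constant term `1`.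
      obtain ⟨k, hk⟩ : ∃ k, E ^ p = φ f ^ p + (p : ℚ_[p]⟦X⟧) * (φ f) ^ (p - 1) * (X ^ n * r)
          + k * (X ^ n * r) ^ 2 := by
        rw [hr]
        obtain ⟨k, hk⟩ := Polynomial.powAddExpansion (φ f) (X ^ n * r) p
        exact ⟨k, hk⟩
      rw [hk, map_pow]
      have e1 : (p : ℚ_[p]⟦X⟧) * (φ f) ^ (p - 1) * (X ^ n * r)
          = X ^ n * (C (p : ℚ_[p]) * ((φ f) ^ (p - 1) * r)) := by
        rw [map_natCast]; ring
      have e2 : k * (X ^ n * r) ^ 2 = X ^ n * (X ^ n * (k * r ^ 2)) := by ring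
      have c1 : coeff n (X ^ n * (C (p : ℚ_[p]) * ((φ f) ^ (p - 1) * r)))
          = p * coeff n E := by
        have := coeff_X_pow_mul (C (p : ℚ_[p]) * ((φ f) ^ (p - 1) * r)) n 0
        rw [zero_add] at this
        rw [coeff_zero_eq_constantCoeff_apply] at hr0
        rw [this, coeff_C_mul, coeff_zero_eq_constantCoeff_apply, map_mul, hr0, map_pow,
          ← coeff_zero_eq_constantCoeff_apply, hφc, hf, if_pos hn,
          coeff_zero_eq_constantCoeff_apply, hE.1, one_pow, one_mul]
      have c2 : coeff n (X ^ n * (X ^ n * (k * r ^ 2))) = 0 := by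
        have := coeff_X_pow_mul (X ^ n * (k * r ^ 2)) n 0
        rw [zero_add] at this
        rw [this]
        simp [hn.ne']
      rw [map_add, map_add, e1, e2, c1, c2, add_zero]
    have hexp : ∀ i, ∃ z : ℤ_[p], coeff i (rescale (p : ℚ_[p]) (exp ℚ_[p])) =
        (if i = 0 then 1 else 0) + p * z := fun i => by
      rw [coeff_rescale, coeff_exp]
      split_ifs with h
      · exact ⟨0, by simp [h]⟩
      · obtain ⟨z, hz⟩ := exists_padicInt_pow_div_factorial p (Nat.pos_of_ne_zero h)
        refine ⟨z, ?_⟩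
        rw [← hz]
        simp [div_eq_mul_inv]
    choose z hz using hexp
    have hsub : ∀ i ≤ n, coeff i (E.subst (X ^ p : ℚ_[p]⟦X⟧)) =
        (((Polynomial.expand ℤ_[p] p f).coeff i : ℤ_[p]) : ℚ_[p]) := fun i hi => by
      rw [coeff_subst_X_pow hp.out.ne_zero, Polynomial.coeff_expand hp.out.pos]
      split_ifs with h
      · rw [hf, if_pos]
        · simp
        · exact lt_of_le_of_lt (Nat.div_le_div_right hi) (Nat.div_lt_self hn hp.out.one_lt)
      · simp
    have hrhs : coeff n (E ^ p) = (((Polynomial.expand ℤ_[p] p f).coeff n : ℤ_[p]) : ℚ_[p]) +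
        p * ((∑ x ∈ Finset.HasAntidiagonal.antidiagonal n, z x.1 * (Polynomial.expand ℤ_[p] p f).coeff x.2 :
          ℤ_[p]) : ℚ_[p]) := by
      rw [key, coeff_mul]
      have : ∀ x ∈ Finset.HasAntidiagonal.antidiagonal n, coeff x.1 (rescale (p : ℚ_[p]) (exp ℚ_[p])) *
          coeff x.2 (E.subst (X ^ p : ℚ_[p]⟦X⟧)) =
          (if x.1 = 0 then (((Polynomial.expand ℤ_[p] p f).coeff x.2 : ℤ_[p]) : ℚ_[p]) else 0) +
          p * ((z x.1 * (Polynomial.expand ℤ_[p] p f).coeff x.2 : ℤ_[p]) : ℚ_[p]) := by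
        intro x hx
        have hx' := Finset.HasAntidiagonal.mem_antidiagonal.mp hx
        rw [hz, hsub x.2 (by omega), PadicInt.coe_mul]
        split_ifs <;> ring
      rw [Finset.sum_congr rfl this, Finset.sum_add_distrib, ← Finset.mul_sum, PadicInt.coe_sum,
        Finset.sum_eq_single (0, n)]
      · simp
      · intro b hb hb'
        rw [if_neg]
        intro h0
        have := Finset.HasAntidiagonal.mem_antidiagonal.mp hb
        exact hb' (Prod.ext h0 (by simp only; omega))
      · intro h
        exact absurd (Finset.HasAntidiagonal.mem_antidiagonal.mpr (zero_add n)) h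
    obtain ⟨g, hg⟩ := dvd_expand_sub_pow p f
    have h5 : coeff n (φ (f ^ p)) = (((Polynomial.expand ℤ_[p] p f).coeff n : ℤ_[p]) : ℚ_[p]) +
        p * ((g.coeff n : ℤ_[p]) : ℚ_[p]) := by
      rw [hφc, hg, Polynomial.coeff_add, Polynomial.coeff_C_mul, PadicInt.coe_add,
        PadicInt.coe_mul, PadicInt.coe_natCast]
    rw [hlhs, h5] at hrhs
    set w : ℤ_[p] := ∑ x ∈ Finset.HasAntidiagonal.antidiagonal n, z x.1 * (Polynomial.expand ℤ_[p] p f).coeff x.2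
    have h6 : coeff n E = ((w - g.coeff n : ℤ_[p]) : ℚ_[p]) := by
      rw [PadicInt.coe_sub]
      apply mul_left_cancel₀ hp0
      linear_combination hrhs
    rw [h6]
    exact PadicInt.norm_le_one _

/-- The Artin-Hasse exponential over `ℚ`. -/
def artinHasse : ℚ⟦X⟧ := (exp ℚ).subst (ahLog p ℚ)

theorem isExp_artinHasse : IsExp (ahLog p ℚ) (artinHasse p) :=
  isExp_subst (constantCoeff_ahLog p ℚ)

theorem map_ahLog (K : Type*) [Field K] [CharZero K] :
    PowerSeries.map (algebraMap ℚ K) (ahLog p ℚ) = ahLog p K := by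
  ext i
  rw [coeff_map, ahLog, ahLog, coeff_mk, coeff_mk]
  split_ifs <;> simp

/-- Integrality is proved with the norm of `ℚ_p`, but is needed in the fraction field of `R`.
Stating it over `ℚ` lets it pass from one field to the other. -/
theorem not_dvd_den_coeff_artinHasse (n : ℕ) : ¬ p ∣ (coeff n (artinHasse p)).den := by
  have h := (isExp_artinHasse p).map (algebraMap ℚ ℚ_[p])
  rw [map_ahLog] at h
  have h1 := norm_coeff_artinHasse_le p h n
  rw [coeff_map] at h1
  set q := coeff n (artinHasse p)
  intro hd
  have hnum : ¬ (p : ℤ) ∣ q.num := fun hn => by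
    have := Nat.dvd_gcd (Int.natCast_dvd.mp hn) hd
    rw [q.reduced] at this
    exact hp.out.one_lt.ne' (Nat.dvd_one.mp this)
  have h2 : (algebraMap ℚ ℚ_[p] q) * (q.den : ℚ_[p]) = (q.num : ℚ_[p]) := by
    rw [eq_ratCast]
    exact_mod_cast congrArg (fun x : ℚ => (x : ℚ_[p])) (Rat.mul_den_eq_num q)
  have h3 := congrArg norm h2
  rw [norm_mul] at h3
  have h4 : ‖(q.den : ℚ_[p])‖ < 1 := by
    rw [Padic.norm_natCast_lt_one_iff]; exact hd
  have h5 : ‖(q.num : ℚ_[p])‖ = 1 := by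
    refine le_antisymm (Padic.norm_int_le_one _) (not_lt.mp fun h => hnum ?_)
    exact (Padic.norm_intCast_lt_one_iff).mp h
  rw [h5] at h3
  have := mul_lt_one_of_nonneg_of_lt_one_right h1 (norm_nonneg _) h4
  linarith

end ArtinHasse

end DworkTrace
end

noncomputable section
set_option linter.unusedSectionVars false
namespace DworkTrace

/-! ### The ring `R` is a domain of characteristic zero -/

section Domain

variable (p : ℕ) [hp : Fact p.Prime] (F : Type*) [Field F] [CharP F p] [Finite F]

theorem piPoly_monic : (piPoly p F).Monic :=
  Polynomial.monic_X_pow_add_C _ (Nat.sub_pos_of_lt hp.out.one_lt).ne'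

theorem natDegree_piPoly : (piPoly p F).natDegree = p - 1 :=
  Polynomial.natDegree_X_pow_add_C

theorem prime_natCast_witt : Prime (p : WittVector p F) :=
  (WittVector.irreducible p (k := F)).prime

/-- Eisenstein at `p`. It makes `R` a domain of characteristic zero, so that exponentials can be
manipulated in its fraction field and the results brought back to `R`. -/
theorem irreducible_piPoly : Irreducible (piPoly p F) := by
  have hp1 : 0 < p - 1 := Nat.sub_pos_of_lt hp.out.one_lt
  have hprime := prime_natCast_witt p F
  refine Polynomial.IsEisensteinAt.irreducible (𝓟 := Ideal.span {(p : WittVector p F)})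
    ⟨?_, ?_, ?_⟩ ?_ (piPoly_monic p F).isPrimitive (by rwa [natDegree_piPoly])
  · rw [piPoly_monic p F, Ideal.mem_span_singleton]
    exact fun h => hprime.not_isUnit (isUnit_of_dvd_one h)
  · intro n hn
    rw [natDegree_piPoly] at hn
    rw [piPoly, Polynomial.coeff_add, Polynomial.coeff_X_pow, if_neg hn.ne, zero_add,
      Polynomial.coeff_C]
    split_ifs
    · exact Ideal.mem_span_singleton_self _
    · exact Ideal.zero_mem _
  · rw [piPoly, Polynomial.coeff_add, Polynomial.coeff_X_pow, if_neg hp1.ne, zero_add,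
      Polynomial.coeff_C_zero, Ideal.span_singleton_pow, Ideal.mem_span_singleton]
    rintro ⟨c, hc⟩
    have : (p : WittVector p F) * 1 = p * (p * c) := by rw [mul_one, ← mul_assoc, ← sq]; exact hc
    exact hprime.not_isUnit (isUnit_of_dvd_one ⟨c, mul_left_cancel₀ hprime.ne_zero this⟩)
  · exact (Ideal.span_singleton_prime hprime.ne_zero).mpr hprime

instance : IsDomain (DRing p F) :=
  AdjoinRoot.isDomain_of_prime (irreducible_piPoly p F).prime

theorem factorial_witt_ne_zero (d : ℕ) : (d.factorial : WittVector p F) ≠ 0 := by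
  obtain ⟨m, hm, hm'⟩ := exists_factorial_eq p d
  rw [hm, Nat.cast_mul, Nat.cast_pow]
  exact mul_ne_zero (pow_ne_zero _ (WittVector.p_nonzero p F)) (isUnit_natCast_witt p F hm').ne_zero

instance : CharZero (WittVector p F) :=
  charZero_of_inj_zero fun n hn => by
    by_contra h
    obtain ⟨c, hc⟩ := Nat.dvd_factorial (Nat.pos_of_ne_zero h) le_rfl
    apply factorial_witt_ne_zero p F n
    rw [hc, Nat.cast_mul, hn, zero_mul]

theorem of_injective : Function.Injective (AdjoinRoot.of (piPoly p F)) :=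
  AdjoinRoot.of.injective_of_degree_ne_zero (by
    rw [Polynomial.degree_eq_natDegree (piPoly_monic p F).ne_zero, natDegree_piPoly]
    have := hp.out.one_lt
    exact_mod_cast (Nat.sub_pos_of_lt this).ne')

instance : CharZero (DRing p F) :=
  charZero_of_inj_zero fun n hn => by
    have : AdjoinRoot.of (piPoly p F) (n : WittVector p F) = AdjoinRoot.of (piPoly p F) 0 := by
      rw [map_natCast, hn, map_zero]
    exact_mod_cast of_injective p F this

instance : CharZero (FractionRing (DRing p F)) :=
  charZero_of_injective_algebraMap (IsFractionRing.injective (DRing p F) _)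

theorem isUnit_natCast {m : ℕ} (hm : ¬ p ∣ m) : IsUnit (m : DRing p F) := by
  simpa using (isUnit_natCast_witt p F hm).map (AdjoinRoot.of (piPoly p F))

theorem natCast_ne_zero_of_prime : (p : DRing p F) ≠ 0 := by exact_mod_cast hp.out.ne_zero

/-- For `d > 0` the digit sum in Legendre's formula saves one power of `π` over
`factorial_dvd_piElt_pow`. This saving is the `+ 1` in the bounds on exponentials below. -/
theorem factorial_dvd_piElt_pow_sub_one {d : ℕ} (hd : 0 < d) :
    (d.factorial : DRing p F) ∣ piElt p F ^ (d - 1) := by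
  obtain ⟨m, hm, hm'⟩ := exists_factorial_eq p d
  have hle : (p - 1) * padicValNat p d.factorial ≤ d - 1 :=
    Nat.le_sub_one_of_lt (sub_one_mul_padicValNat_factorial_le p hd)
  have h2 : (p : DRing p F) ^ padicValNat p d.factorial ∣
      piElt p F ^ ((p - 1) * padicValNat p d.factorial) := by
    rw [pow_mul, piElt_pow]
    exact pow_dvd_pow_of_dvd (dvd_neg.mpr dvd_rfl) _
  rw [hm, Nat.cast_mul, Nat.cast_pow, (isUnit_natCast p F hm').mul_right_dvd]
  exact h2.trans (pow_dvd_pow _ hle)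

end Domain

/-! ### Divisibility of the coefficients of `θ` -/

section Theta

open PowerSeries

variable (p : ℕ) [hp : Fact p.Prime] (F : Type*) [Field F] [CharP F p] [Finite F]

local notation "𝓓" => DRing p F
local notation "𝓚" => FractionRing (DRing p F)

/-- The image of `π` in the fraction field of `R`. -/
def piK : FractionRing (DRing p F) := algebraMap 𝓓 𝓚 (piElt p F)

theorem piK_pow : piK p F ^ (p - 1) = -(p : 𝓚) := by
  rw [piK, ← map_pow, piElt_pow, map_neg, map_natCast]

theorem map_piDiv (d : ℕ) : algebraMap 𝓓 𝓚 (piDiv p F d) = piK p F ^ d / d.factorial := by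
  rw [eq_div_iff (by exact_mod_cast Nat.factorial_ne_zero d), mul_comm, piK, ← map_pow,
    ← factorial_mul_piDiv, map_mul, map_natCast]

theorem map_expPi : PowerSeries.map (algebraMap 𝓓 𝓚) (expPi p F) =
    rescale (piK p F) (exp 𝓚) := by
  ext d
  rw [coeff_map, expPi, coeff_mk, map_piDiv, coeff_rescale, coeff_exp, div_eq_mul_inv]
  simp

theorem isExp_theta : IsExp (C (piK p F) * X - C (piK p F) * X ^ p)
    (PowerSeries.map (algebraMap 𝓓 𝓚) (theta p F)) := by
  have h0 : constantCoeff (X - X ^ p : 𝓓⟦X⟧) = 0 := by simp [hp.out.ne_zero]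
  have h0' : constantCoeff (X - X ^ p : 𝓚⟦X⟧) = 0 := by simp [hp.out.ne_zero]
  have h1 : PowerSeries.map (algebraMap 𝓓 𝓚) (theta p F) =
      (rescale (piK p F) (exp 𝓚)).subst (X - X ^ p : 𝓚⟦X⟧) := by
    rw [theta, ← map_expPi]
    have := PowerSeries.map_subst (HasSubst.of_constantCoeff_zero' h0) (h := algebraMap 𝓓 𝓚)
      (expPi p F)
    have e : MvPowerSeries.map (algebraMap 𝓓 𝓚) (X - X ^ p : 𝓓⟦X⟧) = (X - X ^ p : 𝓚⟦X⟧) := by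
      change PowerSeries.map (algebraMap 𝓓 𝓚) (X - X ^ p : 𝓓⟦X⟧) = (X - X ^ p : 𝓚⟦X⟧)
      simp
    rw [e] at this
    exact this
  rw [h1]
  have h2 := (isExp_rescale_exp (piK p F)).subst h0'
  have hs : HasSubst (X - X ^ p : 𝓚⟦X⟧) := HasSubst.of_constantCoeff_zero' h0'
  rwa [← smul_eq_C_mul, subst_smul hs, subst_X hs, smul_sub, smul_eq_C_mul, smul_eq_C_mul] at h2

/-- The coefficients of degree `i < M` of `g` are divisible by `π ^ (ω i)` in `R`. -/
def PiBounded (ω : ℕ → ℕ) (M : ℕ) (g : (FractionRing (DRing p F))⟦X⟧) : Prop :=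
  ∀ i < M, ∃ d : DRing p F, coeff i g = piK p F ^ ω i * algebraMap 𝓓 𝓚 d

variable {p F}

/-- A subadditive lower bound on the `π`-orders of coefficients is inherited by products, which is
why the factors of `θ` can be estimated separately. -/
theorem PiBounded.mul {ω : ℕ → ℕ} (hω : ∀ i j, ω (i + j) ≤ ω i + ω j) {M : ℕ}
    {g g' : 𝓚⟦X⟧} (hg : PiBounded p F ω M g) (hg' : PiBounded p F ω M g') :
    PiBounded p F ω M (g * g') := by
  intro i hi
  have : ∀ x : ℕ × ℕ, ∃ d : 𝓓, x ∈ Finset.HasAntidiagonal.antidiagonal i →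
      coeff x.1 g * coeff x.2 g' = piK p F ^ ω i * algebraMap 𝓓 𝓚 d := by
    intro x
    by_cases hx : x ∈ Finset.HasAntidiagonal.antidiagonal i
    · have hx' := Finset.HasAntidiagonal.mem_antidiagonal.mp hx
      obtain ⟨d, hd⟩ := hg x.1 (by omega)
      obtain ⟨d', hd'⟩ := hg' x.2 (by omega)
      refine ⟨piElt p F ^ (ω x.1 + ω x.2 - ω i) * (d * d'), fun _ => ?_⟩
      have h1 : ω i ≤ ω x.1 + ω x.2 := hx' ▸ hω x.1 x.2
      have h2 : piK p F ^ ω x.1 * piK p F ^ ω x.2 =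
          piK p F ^ ω i * piK p F ^ (ω x.1 + ω x.2 - ω i) := by
        rw [← pow_add, ← pow_add, Nat.add_sub_cancel' h1]
      rw [hd, hd', map_mul, map_mul, map_pow]
      change _ = _ * (piK p F ^ _ * _)
      linear_combination (algebraMap 𝓓 𝓚 d * algebraMap 𝓓 𝓚 d') * h2
    · exact ⟨0, fun h => absurd h hx⟩
  choose d hd using this
  refine ⟨∑ x ∈ Finset.HasAntidiagonal.antidiagonal i, d x, ?_⟩
  rw [coeff_mul, map_sum, Finset.mul_sum]
  exact Finset.sum_congr rfl fun x hx => hd x hx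

variable (p F)

open Classical in
/-- The tail `∑_{j ≥ J} (π z) ^ (p ^ j) / p ^ j` of the Artin-Hasse logarithm. -/
def ahTail (J : ℕ) : (FractionRing (DRing p F))⟦X⟧ :=
  PowerSeries.mk fun i => if (∃ j, i = p ^ j) ∧ p ^ J ≤ i then piK p F ^ i / i else 0

theorem ahTail_zero : ahTail p F 0 = rescale (piK p F) (ahLog p 𝓚) := by
  ext i
  rw [coeff_rescale, ahTail, ahLog, coeff_mk, coeff_mk]
  by_cases h : ∃ j, i = p ^ j
  · have h1 : p ^ 0 ≤ i := by
      obtain ⟨j, rfl⟩ := h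
      exact Nat.pow_le_pow_right hp.out.pos (Nat.zero_le _)
    rw [if_pos ⟨h, h1⟩, if_pos h, div_eq_mul_inv]
  · rw [if_neg (fun h' => h h'.1), if_neg h, mul_zero]

theorem ahTail_succ (J : ℕ) : ahTail p F J =
    C (piK p F ^ p ^ J / (p : 𝓚) ^ J) * X ^ p ^ J + ahTail p F (J + 1) := by
  ext i
  rw [map_add, coeff_C_mul, coeff_X_pow, ahTail, ahTail, coeff_mk, coeff_mk]
  by_cases h : ∃ j, i = p ^ j
  · obtain ⟨j, rfl⟩ := h
    have hle : ∀ {a b : ℕ}, p ^ a ≤ p ^ b ↔ a ≤ b := Nat.pow_le_pow_iff_right hp.out.one_lt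
    rcases lt_trichotomy j J with h | rfl | h
    · rw [if_neg, if_neg, if_neg]
      · simp
      · rw [hle]; omega
      · exact fun h => absurd (Nat.pow_right_injective hp.out.two_le h) (by omega)
      · rw [hle]; omega
    · rw [if_pos ⟨⟨j, rfl⟩, le_rfl⟩, if_pos rfl, if_neg]
      · simp
      · rw [hle]; omega
    · rw [if_pos ⟨⟨j, rfl⟩, hle.mpr h.le⟩, if_neg, if_pos ⟨⟨j, rfl⟩, hle.mpr h⟩]
      · simp
      · exact fun h => absurd (Nat.pow_right_injective hp.out.two_le h) (by omega)
  · rw [if_neg (fun h' => h h'.1), if_neg (fun h' => h ⟨_, h'⟩), if_neg (fun h' => h h'.1)]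
    simp

theorem constantCoeff_ahTail (J : ℕ) : constantCoeff (ahTail p F J) = 0 := by
  rw [← coeff_zero_eq_constantCoeff_apply, ahTail, coeff_mk,
    if_neg (fun h => not_exists_zero_eq_pow p h.1)]

theorem coeff_ahTail_eq_zero {J i : ℕ} (hi : i < p ^ J) : coeff i (ahTail p F J) = 0 := by
  rw [ahTail, coeff_mk, if_neg (fun h => absurd h.2 (by omega))]

theorem piK_pow_div {j n : ℕ} (hn : j * (p - 1) ≤ n) :
    piK p F ^ n / (p : 𝓚) ^ j = (-1) ^ j * piK p F ^ (n - j * (p - 1)) := by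
  have h0 : (p : 𝓚) ≠ 0 := by exact_mod_cast hp.out.ne_zero
  have h1 : (p : 𝓚) = -piK p F ^ (p - 1) := by rw [piK_pow, neg_neg]
  rw [div_eq_iff (pow_ne_zero _ h0), h1, neg_pow (piK p F ^ (p - 1)), ← pow_mul]
  have h2 : piK p F ^ n = piK p F ^ (n - j * (p - 1)) * piK p F ^ ((p - 1) * j) := by
    rw [← pow_add, mul_comm (p - 1), Nat.sub_add_cancel hn]
  have h3 : ((-1 : 𝓚) ^ j) * (-1) ^ j = 1 := by rw [← mul_pow]; simp
  rw [h2]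
  linear_combination (-piK p F ^ (n - j * (p - 1)) * piK p F ^ ((p - 1) * j)) * h3

theorem mul_sub_one_lt_pow (j : ℕ) : j * (p - 1) + 1 ≤ p ^ j := by
  have h := one_add_mul_le_pow (R := ℤ) (a := (p : ℤ) - 1) (by have := hp.out.two_le; omega) j
  have hp1 := hp.out.one_lt
  have : ((p - 1 : ℕ) : ℤ) = p - 1 := by omega
  zify
  rw [this]
  simp only [add_sub_cancel] at h
  linarith

/-- Since `p = -π^(p-1)`, the exponent is `c z^(p^j)` with `c = ±π^A`, `A = p^j - j(p-1)`. Its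
exponential has coefficients `c^m/m!`, and `m!` costs at most `π^(m-1)`, leaving order at least `mA
- (m-1) = m(A-1) + 1`. -/
theorem PiBounded.exp_term {ω : ℕ → ℕ} {j : ℕ}
    (hpow : ∀ m, 0 < m → ω (p ^ j * m) ≤ m * (p ^ j - j * (p - 1) - 1) + 1) (h0 : ω 0 = 0)
    {g : 𝓚⟦X⟧} (hg : IsExp (-(C (piK p F ^ p ^ j / (p : 𝓚) ^ j) * X ^ p ^ j)) g) (M : ℕ) :
    PiBounded p F ω M g := by
  intro i _
  rw [← neg_mul, ← map_neg] at hg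
  rw [hg.coeff_monomial (pow_pos hp.out.pos j).ne']
  split_ifs with hd
  swap
  · exact ⟨0, by simp⟩
  obtain ⟨m, rfl⟩ := hd
  rw [Nat.mul_div_cancel_left _ (pow_pos hp.out.pos j)]
  rcases Nat.eq_zero_or_pos m with rfl | hm
  · exact ⟨1, by simp [h0]⟩
  obtain ⟨d, hd⟩ := factorial_dvd_piElt_pow_sub_one p F hm
  have hlt := mul_sub_one_lt_pow p j
  have hmf : (m.factorial : 𝓚) ≠ 0 := by exact_mod_cast Nat.factorial_ne_zero m
  have hd' : piK p F ^ (m - 1) / (m.factorial : 𝓚) = algebraMap 𝓓 𝓚 d := by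
    rw [div_eq_iff hmf, piK, ← map_pow, hd, map_mul, map_natCast, mul_comm]
  rw [piK_pow_div p F (by omega), neg_eq_neg_one_mul, ← mul_assoc, ← pow_succ', mul_pow, ← pow_mul,
    ← pow_mul]
  set A := p ^ j - j * (p - 1) with hA
  have hA1 : 0 < A := by omega
  set B := m * (A - 1) + 1 with hB
  have h1 : A * m = ω (p ^ j * m) + (B - ω (p ^ j * m)) + (m - 1) := by
    have h2 : A * m = B + (m - 1) := by
      obtain ⟨A', hA'⟩ : ∃ A', A = A' + 1 := ⟨A - 1, by omega⟩
      rw [hB, hA', Nat.add_sub_cancel]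
      have : (A' + 1) * m = m * A' + m := by ring
      omega
    have := hpow m hm
    omega
  refine ⟨(-1) ^ ((j + 1) * m) * piElt p F ^ (B - ω (p ^ j * m)) * d, ?_⟩
  rw [h1, pow_add, pow_add, map_mul, map_mul, ← hd', map_pow, map_pow, map_neg, map_one]
  change _ = _ * ((-1) ^ ((j + 1) * m) * piK p F ^ _ * _)
  ring

/-- Peel off the terms of the tail one at a time. Only degrees below `M` matter, and once `p^J ≥ M`
the remaining exponential is `1` in those degrees, so no infinite product occurs. -/
theorem PiBounded.exp_neg_ahTail {ω : ℕ → ℕ} (hsub : ∀ i j, ω (i + j) ≤ ω i + ω j)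
    (h0 : ω 0 = 0)
    (hpow : ∀ j m, 2 ≤ j → 0 < m → ω (p ^ j * m) ≤ m * (p ^ j - j * (p - 1) - 1) + 1)
    {J : ℕ} (hJ : 2 ≤ J) {g : 𝓚⟦X⟧} (hg : IsExp (-ahTail p F J) g) (M : ℕ) :
    PiBounded p F ω M g := by
  induction hk : M - p ^ J using Nat.strong_induction_on generalizing J g with
  | _ k ih =>
    by_cases hM : M ≤ p ^ J
    · intro i hi
      rcases Nat.eq_zero_or_pos i with rfl | hi0
      · exact ⟨1, by rw [coeff_zero_eq_constantCoeff_apply, hg.1]; simp [h0]⟩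
      · refine ⟨0, ?_⟩
        rw [hg.coeff_eq_zero (M := p ^ J) _ hi0 (by omega), map_zero, mul_zero]
        intro i hi
        rw [map_neg, coeff_ahTail_eq_zero p F hi, neg_zero]
    · have h1 := isExp_subst (K := 𝓚) (h := -(C (piK p F ^ p ^ J / (p : 𝓚) ^ J) * X ^ p ^ J))
        (by simp [hp.out.ne_zero])
      have h2 := isExp_subst (K := 𝓚) (h := -ahTail p F (J + 1))
        (by rw [map_neg, constantCoeff_ahTail, neg_zero])
      have h3 := h1.add h2
      rw [← neg_add, ← ahTail_succ] at h3
      rw [hg.unique (by rw [map_neg, constantCoeff_ahTail, neg_zero]) h3]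
      refine (PiBounded.exp_term p F (fun m hm => hpow J m hJ hm) h0 h1 M).mul hsub
        (ih _ ?_ (by omega) h2 rfl)
      have : p ^ J < p ^ (J + 1) := Nat.pow_lt_pow_right hp.out.one_lt (Nat.lt_succ_self _)
      omega

theorem exists_algebraMap_rat_eq (q : ℚ) (hq : ¬ p ∣ q.den) :
    ∃ d : 𝓓, algebraMap ℚ 𝓚 q = algebraMap 𝓓 𝓚 d := by
  obtain ⟨u, hu⟩ := isUnit_natCast p F hq
  refine ⟨(q.num : 𝓓) * (↑u⁻¹ : 𝓓), ?_⟩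
  have h0 : (q.den : 𝓚) ≠ 0 := by exact_mod_cast q.den_ne_zero
  have h1 : algebraMap 𝓓 𝓚 (↑u⁻¹ : 𝓓) * (q.den : 𝓚) = 1 := by
    rw [← map_natCast (algebraMap 𝓓 𝓚) q.den, ← hu, ← map_mul, Units.inv_mul, map_one]
  rw [eq_ratCast, Rat.cast_def, div_eq_iff h0, map_mul, map_intCast, mul_assoc, h1, mul_one]

/-- `θ(z)` is the Artin-Hasse exponential at `πz` times the exponential of minus the tail from `j =
2`. The first factor has `i`-th coefficient divisible by `π^i`, the second is bounded term by term.
The conditions on `ω` say that it lies below both bounds and is stable under products. -/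
theorem pow_dvd_coeff_theta {ω : ℕ → ℕ} (hsub : ∀ i j, ω (i + j) ≤ ω i + ω j)
    (hle : ∀ i, ω i ≤ i)
    (hpow : ∀ j m, 2 ≤ j → 0 < m → ω (p ^ j * m) ≤ m * (p ^ j - j * (p - 1) - 1) + 1) (i : ℕ) :
    piElt p F ^ ω i ∣ coeff i (theta p F) := by
  have h0 : ω 0 = 0 := Nat.le_zero.mp (hle 0)
  have h1 := ((isExp_artinHasse p).map (algebraMap ℚ 𝓚)).rescale (piK p F)
  rw [map_ahLog, ← ahTail_zero, ahTail_succ, ahTail_succ] at h1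
  have h2 := isExp_subst (K := 𝓚) (h := -ahTail p F 2)
    (by rw [map_neg, constantCoeff_ahTail, neg_zero])
  have h3 := h1.add h2
  -- Here `π^p/p = -π`: the terms `j = 0` and `j = 1` of the logarithm are exactly `πz` and `-πz^p`,
  -- the exponent of `θ`.
  have h4 : C (piK p F ^ p ^ 1 / (p : 𝓚) ^ 1) = -C (piK p F) := by
    have hp1 := hp.out.one_lt
    rw [piK_pow_div p F (by rw [one_mul, pow_one]; omega), pow_one, one_mul, pow_one,
      Nat.sub_sub_self hp1.le]
    simp
  have h5 : C (piK p F ^ p ^ 0 / (p : 𝓚) ^ 0) * X ^ p ^ 0 +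
      (C (piK p F ^ p ^ (0 + 1) / (p : 𝓚) ^ (0 + 1)) * X ^ p ^ (0 + 1) + ahTail p F (0 + 1 + 1)) +
      -ahTail p F 2 = C (piK p F) * X - C (piK p F) * X ^ p := by
    rw [zero_add, h4]
    simp
    ring
  rw [h5] at h3
  have h6 := (isExp_theta p F).unique (by simp [hp.out.ne_zero]) h3
  have hE : PiBounded p F ω (i + 1) (rescale (piK p F)
      (PowerSeries.map (algebraMap ℚ 𝓚) (artinHasse p))) := by
    intro m _
    obtain ⟨d, hd⟩ := exists_algebraMap_rat_eq p F _ (not_dvd_den_coeff_artinHasse p m)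
    refine ⟨piElt p F ^ (m - ω m) * d, ?_⟩
    rw [coeff_rescale, coeff_map, hd, map_mul, map_pow]
    change _ = _ * (piK p F ^ _ * _)
    rw [← mul_assoc, ← pow_add, Nat.add_sub_cancel' (hle m)]
  obtain ⟨d, hd⟩ := (hE.mul hsub (PiBounded.exp_neg_ahTail p F hsub h0 hpow le_rfl h2 (i + 1)))
    i (Nat.lt_succ_self i)
  rw [← h6, coeff_map] at hd
  refine ⟨d, IsFractionRing.injective 𝓓 𝓚 ?_⟩
  rw [hd, map_mul, map_pow, piK]

theorem coeff_zero_theta : coeff 0 (theta p F) = 1 := by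
  apply IsFractionRing.injective 𝓓 𝓚
  rw [← coeff_map, coeff_zero_eq_constantCoeff_apply, (isExp_theta p F).1, map_one]

theorem coeff_one_theta : coeff 1 (theta p F) = piElt p F := by
  apply IsFractionRing.injective 𝓓 𝓚
  have h1 := congrArg (coeff 0) (isExp_theta p F).2
  rw [coeff_derivative, coeff_zero_eq_constantCoeff_apply, map_mul, (isExp_theta p F).1, mul_one,
    ← coeff_zero_eq_constantCoeff_apply, coeff_derivative, map_sub, coeff_C_mul, coeff_C_mul,
    zero_add, coeff_one_X, coeff_X_pow, if_neg hp.out.one_lt.ne, coeff_map] at h1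
  rw [← piK]
  simpa using h1

/-- The choice `ω(i) = min(i, 2)`. Together with the first two coefficients it yields `θ(z) ≡ 1 +
πz` modulo `π²`. -/
theorem sq_piElt_dvd_coeff_theta {i : ℕ} (hi : 2 ≤ i) : piElt p F ^ 2 ∣ coeff i (theta p F) := by
  have h := pow_dvd_coeff_theta p F (ω := fun i => min i 2) (fun i j => by omega)
    (fun i => min_le_left _ _) (fun j m hj hm => ?_) i
  · simpa [min_eq_right hi] using h
  · have h1 : j * (p - 1) + 2 ≤ p ^ j := by
      obtain ⟨k, rfl⟩ : ∃ k, j = k + 1 := ⟨j - 1, by omega⟩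
      obtain ⟨r, hr⟩ : ∃ r, p = r + 2 := ⟨p - 2, by have := hp.out.two_le; omega⟩
      have h2 := mul_sub_one_lt_pow p k
      have h3 : (k * (p - 1) + 1) * p ≤ p ^ (k + 1) := by
        rw [pow_succ]; exact Nat.mul_le_mul_right _ h2
      refine le_trans ?_ h3
      rw [hr]
      have : r + 2 - 1 = r + 1 := by omega
      rw [this]
      nlinarith [Nat.zero_le (r * r * k), Nat.zero_le (r * k), (by omega : 1 ≤ k)]
    have h2 : 1 ≤ m * (p ^ j - j * (p - 1) - 1) := Nat.mul_pos hm (by omega)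
    exact (min_le_right _ _).trans (by omega)

/-- The coefficient of `z ^ i` in `θ` has `p`-adic valuation at least `i (p - 1) / p ^ 2`. -/
theorem exists_pow_dvd_coeff_theta (i : ℕ) :
    ∃ e : ℕ, i * (p - 1) ^ 2 ≤ p ^ 2 * e ∧ piElt p F ^ e ∣ coeff i (theta p F) := by
  have hp2 : 0 < p ^ 2 := pow_pos hp.out.pos 2
  have hceil : ∀ x y : ℕ, x ⌈/⌉ p ^ 2 ≤ y ↔ x ≤ p ^ 2 * y := fun x y => by
    rw [ceilDiv_le_iff_le_mul hp2]
  have hmul : ∀ x : ℕ, x ≤ p ^ 2 * (x ⌈/⌉ p ^ 2) := fun x => (hceil x _).mp le_rfl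
  refine ⟨(i * (p - 1) ^ 2) ⌈/⌉ p ^ 2, hmul _,
    pow_dvd_coeff_theta p F (ω := fun i => (i * (p - 1) ^ 2) ⌈/⌉ p ^ 2) ?_ ?_ ?_ i⟩
  · intro i j
    rw [hceil, mul_add, add_mul]
    exact add_le_add (hmul _) (hmul _)
  · intro i
    rw [hceil, mul_comm]
    exact Nat.mul_le_mul_right _ (Nat.pow_le_pow_left (Nat.sub_le _ _) _)
  · intro j m hj hm
    rw [hceil]
    -- With `j = k + 2` and `p² - (p-1)² = 2p - 1`, this is `p^j (p-1)² ≤ p² (p^j - j(p-1) - 1)`.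
    -- Equality holds at `j = 2`, which is where the slope `(p-1)²/p²` comes from.
    have key : ∀ k, p ^ 2 * ((k + 2) * (p - 1) + 1) ≤ p ^ (k + 2) * (2 * p - 1) := by
      obtain ⟨r, hr⟩ : ∃ r, p = r + 1 := ⟨p - 1, by have := hp.out.two_le; omega⟩
      have e1 : p - 1 = r := by omega
      have e2 : 2 * p - 1 = 2 * r + 1 := by omega
      intro k
      induction k with
      | zero => rw [e1, e2, zero_add]
      | succ k ih =>
        calc p ^ 2 * ((k + 1 + 2) * (p - 1) + 1)
            ≤ p * (p ^ 2 * ((k + 2) * (p - 1) + 1)) := by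
              rw [e1, hr]
              nlinarith [Nat.zero_le ((r + 1) ^ 2 * (r * r * (k + 2)))]
          _ ≤ p * (p ^ (k + 2) * (2 * p - 1)) := Nat.mul_le_mul_left _ ih
          _ = p ^ (k + 1 + 2) * (2 * p - 1) := by ring
    obtain ⟨k, rfl⟩ : ∃ k, j = k + 2 := ⟨j - 2, by omega⟩
    have hk := key k
    have hlt := mul_sub_one_lt_pow p (k + 2)
    obtain ⟨A, hA⟩ : ∃ A, p ^ (k + 2) = (k + 2) * (p - 1) + 1 + A := ⟨_, (Nat.add_sub_cancel' hlt).symm⟩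
    have e3 : p ^ (k + 2) - (k + 2) * (p - 1) - 1 = A := by omega
    rw [e3]
    have e4 : p ^ (k + 2) * (p - 1) ^ 2 ≤ p ^ 2 * A := by
      obtain ⟨r, hr⟩ : ∃ r, p = r + 1 := ⟨p - 1, by have := hp.out.two_le; omega⟩
      have e1 : p - 1 = r := by omega
      have e2 : 2 * p - 1 = 2 * r + 1 := by omega
      rw [e1] at hA hk ⊢
      rw [e2] at hk
      have e5 : p ^ (k + 2) * p ^ 2 = p ^ 2 * ((k + 2) * r + 1) + p ^ 2 * A := by
        rw [hA]; ring
      have e6 : p ^ (k + 2) * p ^ 2 = p ^ (k + 2) * r ^ 2 + p ^ (k + 2) * (2 * r + 1) := by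
        rw [hr]; ring
      omega
    calc p ^ (k + 2) * m * (p - 1) ^ 2 = m * (p ^ (k + 2) * (p - 1) ^ 2) := by ring
      _ ≤ m * (p ^ 2 * A) := Nat.mul_le_mul_left _ e4
      _ ≤ p ^ 2 * (m * A + 1) := by nlinarith

end Theta

end DworkTrace
end

noncomputable section
set_option linter.unusedSectionVars false
namespace DworkTrace

/-! ### Teichmüller representatives in `R` -/

section Teich

variable (p : ℕ) [hp : Fact p.Prime] (F : Type*) [Field F] [CharP F p]

/-- The Teichmüller lift as a multiplicative map. -/
def teichHom : F →* DRing p F :=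
  (AdjoinRoot.of (piPoly p F) : WittVector p F →* DRing p F).comp (WittVector.teichmuller p)

variable {F}

theorem teich_mul (x y : F) : teich p F (x * y) = teich p F x * teich p F y :=
  map_mul (teichHom p F) x y

theorem teich_pow (x : F) (n : ℕ) : teich p F (x ^ n) = teich p F x ^ n :=
  map_pow (teichHom p F) x n

theorem teich_one : teich p F (1 : F) = 1 := map_one (teichHom p F)

theorem teich_zero : teich p F (0 : F) = 0 := by
  rw [teich, WittVector.teichmuller_zero, map_zero]

theorem piElt_dvd_natCast : piElt p F ∣ (p : DRing p F) := by
  rw [← dvd_neg, ← piElt_pow]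
  exact dvd_pow_self _ (Nat.sub_pos_of_lt hp.out.one_lt).ne'

/-- `p` is up to sign a power of `π`. This allows factors that are units modulo `π` to be cancelled
from divisibilities by `p^L`. -/
theorem isCoprime_pow_of_piElt_dvd {u : DRing p F} (h : IsCoprime (piElt p F) u) (L : ℕ) :
    IsCoprime ((p : DRing p F) ^ L) u := by
  have : (p : DRing p F) = -piElt p F ^ (p - 1) := by rw [piElt_pow, neg_neg]
  rw [this]
  exact (h.pow_left.neg_left).pow_left

variable [Finite F]

theorem natCast_dvd_witt_iff (w : WittVector p F) : (p : WittVector p F) ∣ w ↔ w.coeff 0 = 0 := by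
  rw [← Ideal.mem_span_singleton, ← pow_one (p : WittVector p F),
    WittVector.mem_span_p_pow_iff_le_coeff_eq_zero]
  exact ⟨fun h => h 0 one_pos, fun h i hi => by rwa [Nat.lt_one_iff.mp hi]⟩

theorem natCast_dvd_teich_add (x y : F) :
    (p : DRing p F) ∣ teich p F x + teich p F y - teich p F (x + y) := by
  have h : (p : WittVector p F) ∣ WittVector.teichmuller p x + WittVector.teichmuller p y -
      WittVector.teichmuller p (x + y) := by
    have e : ∀ z : WittVector p F, z.coeff 0 = WittVector.constantCoeff z := fun _ => rfl
    rw [natCast_dvd_witt_iff, e, map_sub, map_add]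
    have h : ∀ z : F, WittVector.constantCoeff (WittVector.teichmuller p z) = z :=
      WittVector.teichmuller_coeff_zero p
    rw [h, h, h, sub_self]
  have := map_dvd (AdjoinRoot.of (piPoly p F)) h
  rwa [map_natCast, map_sub, map_add] at this

end Teich

/-! ### The additive character -/

section Character

open PowerSeries

variable (p : ℕ) [hp : Fact p.Prime] (F : Type*) [Field F] [CharP F p] [Finite F]

local notation "𝓓" => DRing p F
local notation "𝓚" => FractionRing (DRing p F)

theorem map_subst_X_pow {R S : Type*} [CommRing R] [CommRing S] (φ : R →+* S) (f : R⟦X⟧) {k : ℕ}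
    (hk : k ≠ 0) : PowerSeries.map φ (f.subst (X ^ k : R⟦X⟧)) =
      (PowerSeries.map φ f).subst (X ^ k : S⟦X⟧) := by
  ext i
  rw [coeff_map, coeff_subst_X_pow hk, coeff_subst_X_pow hk]
  split_ifs <;> simp

theorem coe_expand {R : Type*} [CommRing R] (f : Polynomial R) {k : ℕ} (hk : 0 < k) :
    ((Polynomial.expand R k f : Polynomial R) : R⟦X⟧) = (f : R⟦X⟧).subst (X ^ k : R⟦X⟧) := by
  ext i
  rw [Polynomial.coeff_coe, Polynomial.coeff_expand hk, coeff_subst_X_pow hk.ne']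
  simp

/-- The power series `exp (p π z)`. -/
def expPPi : 𝓓⟦X⟧ := rescale (p : 𝓓) (expPi p F)

theorem map_rescale_expPi (c : 𝓓) : PowerSeries.map (algebraMap 𝓓 𝓚) (rescale c (expPi p F)) =
    rescale (algebraMap 𝓓 𝓚 c * piK p F) (exp 𝓚) := by
  have : PowerSeries.map (algebraMap 𝓓 𝓚) (rescale c (expPi p F)) =
      rescale (algebraMap 𝓓 𝓚 c) (PowerSeries.map (algebraMap 𝓓 𝓚) (expPi p F)) := by
    ext; simp [coeff_rescale]
  rw [this, map_expPi, rescale_rescale, mul_comm]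

theorem map_algebraMap_injective :
    Function.Injective (PowerSeries.map (algebraMap 𝓓 𝓚)) :=
  PowerSeries.map_injective _ (IsFractionRing.injective 𝓓 𝓚)

theorem expPPi_mul_inv : expPPi p F * rescale (-(p : 𝓓)) (expPi p F) = 1 := by
  apply map_algebraMap_injective p F
  have h := (isExp_rescale_exp (algebraMap 𝓓 𝓚 p * piK p F)).add
    (isExp_rescale_exp (algebraMap 𝓓 𝓚 (-p) * piK p F))
  rw [map_mul, map_one, expPPi, map_rescale_expPi, map_rescale_expPi]
  have h0 : C (algebraMap 𝓓 𝓚 p * piK p F) * X + C (algebraMap 𝓓 𝓚 (-p) * piK p F) * X = 0 := by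
    simp
  rw [h0] at h
  exact h.unique (by simp) isExp_zero

/-- The exponents telescope: the product of the `θ(z^(p^i))` is the exponential of `π(z - z^(p^m))`.
The `p`-th power is taken because `exp(pπz)`, unlike `exp(πz)`, is a polynomial modulo every power
of `p` and can be evaluated. -/
theorem prod_theta_pow_mul (m : ℕ) :
    (∏ i ∈ Finset.range m, (theta p F).subst (X ^ p ^ i : 𝓓⟦X⟧)) ^ p *
      (expPPi p F).subst (X ^ p ^ m : 𝓓⟦X⟧) = expPPi p F := by
  apply map_algebraMap_injective p F
  have hpos : ∀ i, p ^ i ≠ 0 := fun i => (pow_pos hp.out.pos i).ne'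
  rw [map_mul, map_pow, map_prod, map_subst_X_pow _ _ (hpos m)]
  simp_rw [map_subst_X_pow _ _ (hpos _)]
  have hexp : IsExp (C ((p : 𝓚) * piK p F) * X)
      (PowerSeries.map (algebraMap 𝓓 𝓚) (expPPi p F)) := by
    rw [expPPi, map_rescale_expPi, map_natCast]
    exact isExp_rescale_exp _
  have hCX : ∀ (c : 𝓚) (n k : ℕ), k ≠ 0 →
      (C c * X ^ n : 𝓚⟦X⟧).subst (X ^ k : 𝓚⟦X⟧) = C c * X ^ (k * n) := fun c n k hk => by
    have hs : HasSubst (X ^ k : 𝓚⟦X⟧) := HasSubst.X_pow hk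
    rw [← smul_eq_C_mul, subst_smul hs, subst_pow hs, subst_X hs, smul_eq_C_mul, ← pow_mul]
  have h1 : IsExp (∑ i ∈ Finset.range m, (C (piK p F) * X ^ p ^ i - C (piK p F) * X ^ p ^ (i + 1)))
      (∏ i ∈ Finset.range m,
        (PowerSeries.map (algebraMap 𝓓 𝓚) (theta p F)).subst (X ^ p ^ i : 𝓚⟦X⟧)) := by
    refine IsExp.sum _ fun i _ => ?_
    have h := (isExp_theta p F).subst_X_pow (hpos i)
    have hs : HasSubst (X ^ p ^ i : 𝓚⟦X⟧) := HasSubst.X_pow (hpos i)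
    have e := hCX (piK p F) 1 (p ^ i) (hpos i)
    rw [pow_one, mul_one] at e
    rwa [subst_sub hs, hCX _ _ _ (hpos i), e, ← pow_succ] at h
  rw [Finset.sum_range_sub', pow_zero, pow_one] at h1
  have h2 := (h1.nsmul p).add (hexp.subst_X_pow (hpos m))
  have e := hCX ((p : 𝓚) * piK p F) 1 (p ^ m) (hpos m)
  rw [pow_one, mul_one] at e
  rw [e] at h2
  refine IsExp.unique ?_ h2 ?_
  · simp [hp.out.ne_zero]
  · have : p • (C (piK p F) * X - C (piK p F) * X ^ p ^ m) + C ((p : 𝓚) * piK p F) * X ^ p ^ m =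
        C ((p : 𝓚) * piK p F) * X := by
      rw [nsmul_eq_mul, map_mul, map_natCast]; ring
    rwa [this]

/-- The truncation of `θ`. -/
def thetaPoly (M : ℕ) : Polynomial 𝓓 := trunc M (theta p F)

theorem natCast_pow_dvd_of_le {L e : ℕ} (h : (p - 1) * L ≤ e) {x : 𝓓} (hx : piElt p F ^ e ∣ x) :
    (p : 𝓓) ^ L ∣ x := by
  have h2 : (p : 𝓓) ^ L ∣ piElt p F ^ ((p - 1) * L) := by
    rw [pow_mul, piElt_pow]
    exact pow_dvd_pow_of_dvd (dvd_neg.mpr dvd_rfl) _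
  exact (h2.trans (pow_dvd_pow _ h)).trans hx

theorem natCast_pow_dvd_coeff_theta (L : ℕ) {i : ℕ} (hi : p ^ 2 * ((p - 1) * L) ≤ i) :
    (p : 𝓓) ^ L ∣ coeff i (theta p F) := by
  obtain ⟨e, he, hd⟩ := exists_pow_dvd_coeff_theta p F i
  refine natCast_pow_dvd_of_le p F ?_ hd
  have h1 : 1 ≤ (p - 1) ^ 2 := Nat.one_le_pow _ _ (Nat.sub_pos_of_lt hp.out.one_lt)
  have h2 : i * 1 ≤ i * (p - 1) ^ 2 := Nat.mul_le_mul_left _ h1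
  exact Nat.le_of_mul_le_mul_left (by omega : p ^ 2 * ((p - 1) * L) ≤ p ^ 2 * e)
    (pow_pos hp.out.pos 2)

theorem exists_coe_eq_map {R S : Type*} [CommRing R] [CommRing S] (φ : R →+* S) (f : R⟦X⟧) {M : ℕ}
    (hM : ∀ i, M ≤ i → φ (coeff i f) = 0) :
    (((trunc M f).map φ : Polynomial S) : S⟦X⟧) = PowerSeries.map φ f := by
  ext i
  rw [Polynomial.coeff_coe, Polynomial.coeff_map, coeff_trunc, coeff_map]
  split_ifs with h
  · rfl
  · rw [map_zero, hM i (by omega)]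

/-- The product `∏_{i < m} θ(t ^ (p ^ i))` over the conjugates of the Teichmüller lift of `x`, with
`θ` truncated at degree `M`. -/
def thetaChar (M m : ℕ) (x : F) : 𝓓 :=
  ∏ i ∈ Finset.range m, (thetaPoly p F M).eval (teich p F x ^ p ^ i)

variable {F}

variable {m : ℕ} (hm : Nat.card F = p ^ m) {M L : ℕ}
  (hM : ∀ i, M ≤ i → (p : DRing p F) ^ (L + 1) ∣ coeff i (theta p F)) (hM2 : 2 ≤ M)

include hm in
theorem pow_card_eq (x : F) : x ^ p ^ m = x := by
  have := Fintype.ofFinite F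
  rw [← hm, Nat.card_eq_fintype_card, FiniteField.pow_card]

include hm hM in
-- Modulo `p^(L+1)` all series in `prod_theta_pow_mul` are polynomials. At a Teichmüller point
-- `t^(p^m) = t`, so the factor `exp(pπt)` appears on both sides; it is invertible and cancels.
theorem thetaChar_pow (x : F) : (p : 𝓓) ^ (L + 1) ∣ thetaChar p F M m x ^ p - 1 := by
  set φ := Ideal.Quotient.mk (Ideal.span {(p : 𝓓) ^ (L + 1)}) with hφ
  have hφ0 : ∀ y, φ y = 0 ↔ (p : 𝓓) ^ (L + 1) ∣ y := fun y => by
    rw [hφ, Ideal.Quotient.eq_zero_iff_mem, Ideal.mem_span_singleton]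
  have hpos : ∀ i, 0 < p ^ i := fun i => pow_pos hp.out.pos i
  have hM' : ∀ i, M ≤ i → φ (coeff i (theta p F)) = 0 := fun i hi => (hφ0 _).mpr (hM i hi)
  -- For `p ∣ c` the coefficient of degree `i` in `exp(cπz)` is divisible by `p^i`, so cutting at
  -- degree `L + 1` loses nothing modulo `p^(L+1)`.
  have hU : ∀ (c : 𝓓), (p : 𝓓) ∣ c → ∀ i, L + 1 ≤ i → φ (coeff i (rescale c (expPi p F))) = 0 :=
    fun c hc i hi => by
      rw [hφ0, coeff_rescale]
      exact ((pow_dvd_pow _ hi).trans (pow_dvd_pow_of_dvd hc i)).mul_right _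
  set T := (thetaPoly p F M).map φ with hT
  set U := (trunc (L + 1) (expPPi p F)).map φ with hUdef
  set V := (trunc (L + 1) (rescale (-(p : 𝓓)) (expPi p F))).map φ with hVdef
  have cT : (T : (𝓓 ⧸ Ideal.span {(p : 𝓓) ^ (L + 1)})⟦X⟧) = PowerSeries.map φ (theta p F) :=
    exists_coe_eq_map φ _ hM'
  have cU : (U : (𝓓 ⧸ Ideal.span {(p : 𝓓) ^ (L + 1)})⟦X⟧) = PowerSeries.map φ (expPPi p F) :=
    exists_coe_eq_map φ _ (hU _ dvd_rfl)
  have cV : (V : (𝓓 ⧸ Ideal.span {(p : 𝓓) ^ (L + 1)})⟦X⟧) =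
      PowerSeries.map φ (rescale (-(p : 𝓓)) (expPi p F)) :=
    exists_coe_eq_map φ _ (hU _ (dvd_neg.mpr dvd_rfl))
  have h1 : U * V = 1 := by
    apply Polynomial.coe_injective
    rw [Polynomial.coe_mul, cU, cV, ← map_mul, expPPi_mul_inv, map_one, Polynomial.coe_one]
  have h2 : (∏ i ∈ Finset.range m, Polynomial.expand _ (p ^ i) T) ^ p *
      Polynomial.expand _ (p ^ m) U = U := by
    apply Polynomial.coe_injective
    rw [Polynomial.coe_mul, Polynomial.coe_pow, coe_expand _ (hpos m), cU,
      ← map_subst_X_pow _ _ (hpos m).ne']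
    have : ((∏ i ∈ Finset.range m, Polynomial.expand _ (p ^ i) T : Polynomial _) :
        (𝓓 ⧸ Ideal.span {(p : 𝓓) ^ (L + 1)})⟦X⟧) =
        PowerSeries.map φ (∏ i ∈ Finset.range m, (theta p F).subst (X ^ p ^ i : 𝓓⟦X⟧)) := by
      rw [map_prod, ← Polynomial.coeToPowerSeries.ringHom_apply, map_prod]
      refine Finset.prod_congr rfl fun i _ => ?_
      rw [Polynomial.coeToPowerSeries.ringHom_apply, coe_expand _ (hpos i), cT,
        map_subst_X_pow _ _ (hpos i).ne']
    rw [this, ← map_pow, ← map_mul, prod_theta_pow_mul]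
  set t := φ (teich p F x) with ht
  have ht' : t ^ p ^ m = t := by rw [ht, ← map_pow, ← teich_pow, pow_card_eq p hm]
  have h3 := congrArg (Polynomial.eval t) h1
  have h4 := congrArg (Polynomial.eval t) h2
  rw [Polynomial.eval_mul, Polynomial.eval_one] at h3
  rw [Polynomial.eval_mul, Polynomial.eval_pow, Polynomial.eval_prod, Polynomial.expand_eval,
    ht'] at h4
  have h5 : φ (thetaChar p F M m x) =
      ∏ i ∈ Finset.range m, Polynomial.eval t (Polynomial.expand _ (p ^ i) T) := by
    rw [thetaChar, map_prod]
    refine Finset.prod_congr rfl fun i _ => ?_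
    rw [Polynomial.expand_eval, hT, ht, ← map_pow, Polynomial.eval_map_apply]
  rw [← hφ0, map_sub, map_pow, map_one, h5]
  linear_combination (V.eval t) * h4 +
    (1 - (∏ i ∈ Finset.range m, Polynomial.eval t (Polynomial.expand _ (p ^ i) T)) ^ p) * h3

theorem eval_thetaPoly (y : 𝓓) :
    (thetaPoly p F M).eval y = ∑ i ∈ Finset.range M, coeff i (theta p F) * y ^ i := by
  rw [thetaPoly, Polynomial.eval, eval₂_trunc_eq_sum_range]
  rfl

include hM2 in
theorem exists_eval_thetaPoly (y : 𝓓) : ∃ s, (thetaPoly p F M).eval y =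
    1 + piElt p F * y + piElt p F ^ 2 * s := by
  obtain ⟨M', rfl⟩ : ∃ M', M = M' + 2 := ⟨M - 2, by omega⟩
  have h : ∀ i, piElt p F ^ 2 ∣ coeff (i + 2) (theta p F) := fun i =>
    sq_piElt_dvd_coeff_theta p F (by omega)
  choose c hc using h
  refine ⟨∑ i ∈ Finset.range M', c i * y ^ (i + 2), ?_⟩
  rw [eval_thetaPoly, Finset.sum_range_succ', Finset.sum_range_succ', coeff_zero_theta]
  simp only [zero_add, coeff_one_theta, add_assoc, one_add_one_eq_two]
  rw [Finset.mul_sum]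
  simp only [hc]
  simp only [mul_assoc]
  ring

theorem exists_prod_one_add {R : Type*} [CommRing R] (ϖ : R) (n : ℕ) (f y : ℕ → R)
    (h : ∀ i, ∃ s, f i = 1 + ϖ * y i + ϖ ^ 2 * s) :
    ∃ s, ∏ i ∈ Finset.range n, f i = 1 + ϖ * (∑ i ∈ Finset.range n, y i) + ϖ ^ 2 * s := by
  induction n with
  | zero => exact ⟨0, by simp⟩
  | succ n ih =>
    obtain ⟨s, hs⟩ := ih
    obtain ⟨s', hs'⟩ := h n
    refine ⟨s + s' + (∑ i ∈ Finset.range n, y i) * y n + ϖ * (s * y n) +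
      ϖ * ((∑ i ∈ Finset.range n, y i) * s') + ϖ ^ 2 * (s * s'), ?_⟩
    rw [Finset.prod_range_succ, Finset.sum_range_succ, hs, hs']
    ring

/-- The sum of the conjugates of the Teichmüller lift of `x`. -/
def teichTrace (m : ℕ) (x : F) : 𝓓 := ∑ i ∈ Finset.range m, teich p F x ^ p ^ i

include hM2 in
theorem exists_thetaChar_eq (m : ℕ) (x : F) : ∃ s, thetaChar p F M m x =
    1 + piElt p F * teichTrace p m x + piElt p F ^ 2 * s :=
  exists_prod_one_add _ m _ _ fun _ => exists_eval_thetaPoly p hM2 _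

theorem natCast_dvd_teichTrace_add (m : ℕ) (x y : F) :
    (p : 𝓓) ∣ teichTrace p m x + teichTrace p m y - teichTrace p m (x + y) := by
  rw [teichTrace, teichTrace, teichTrace, ← Finset.sum_add_distrib, ← Finset.sum_sub_distrib]
  refine Finset.dvd_sum fun i _ => ?_
  rw [← teich_pow, ← teich_pow, ← teich_pow, add_pow_char_pow]
  exact natCast_dvd_teich_add p _ _

/-! ### Additivity of the truncated character modulo a power of `p` -/

theorem exists_one_add_pow_prime {R : Type*} [CommRing R] (y : R) :
    ∃ c, (1 + y) ^ p = 1 + p * y + p * y ^ 2 * c + y ^ p := by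
  obtain ⟨q, hq⟩ : ∃ q, p = q + 2 := ⟨p - 2, by have := hp.out.two_le; omega⟩
  have h : ∀ i, ∃ c : ℕ, i < q → p.choose (i + 2) = p * c := fun i => by
    by_cases hi : i < q
    · obtain ⟨c, hc⟩ := hp.out.dvd_choose_self (k := i + 2) (by omega) (by omega)
      exact ⟨c, fun _ => hc⟩
    · exact ⟨0, fun h => absurd h hi⟩
  choose c hc using h
  refine ⟨∑ i ∈ Finset.range q, y ^ i * c i, ?_⟩
  have h1 : (y + 1) ^ p = ∑ i ∈ Finset.range (p + 1), y ^ i * p.choose i := by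
    rw [add_pow]; simp
  have h2 : Finset.range (p + 1) = Finset.range (q + 1 + 1 + 1) := by rw [hq]
  rw [add_comm, h1, h2, Finset.sum_range_succ, Finset.sum_range_succ', Finset.sum_range_succ']
  have h3 : q + 1 + 1 = p := by omega
  have h4 : ∑ i ∈ Finset.range q, y ^ (i + 1 + 1) * ((p.choose (i + 1 + 1) : ℕ) : R) =
      p * y ^ 2 * ∑ i ∈ Finset.range q, y ^ i * c i := by
    rw [Finset.mul_sum]
    refine Finset.sum_congr rfl fun i hi => ?_
    rw [hc i (Finset.mem_range.mp hi)]
    push_cast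
    ring
  rw [h3, h4]
  simp
  ring

/-- An approximate `p`-th root of unity close to `1` is `1`, at the cost of one factor `p`. Indeed
`(1+y)^p - 1` is `py` times an element congruent to `1` modulo `π`: for `y = π²z` one has `y^(p-1) =
p² z^(p-1)`, so even the term `y^p` is divisible by `p² y`. -/
theorem natCast_pow_dvd_of_pow_eq_one {y : 𝓓} (hy : piElt p F ^ 2 ∣ y)
    (h : (p : 𝓓) ^ (L + 1) ∣ (1 + y) ^ p - 1) : (p : 𝓓) ^ L ∣ y := by
  obtain ⟨c, hc⟩ := exists_one_add_pow_prime p y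
  obtain ⟨z, hz⟩ := hy
  have hp1 : y ^ p = p * y * (p * z ^ (p - 1)) := by
    have e1 : y ^ p = y * y ^ (p - 1) := by
      rw [← pow_succ', Nat.sub_add_cancel hp.out.one_lt.le]
    have e2 : y ^ (p - 1) = (p : 𝓓) ^ 2 * z ^ (p - 1) := by
      rw [hz, mul_pow, ← pow_mul, mul_comm 2, pow_mul, piElt_pow, neg_sq]
    rw [e1, e2]; ring
  have h1 : (1 + y) ^ p - 1 = p * (y * (1 + y * c + p * z ^ (p - 1))) := by
    rw [hc, hp1]; ring
  rw [h1, pow_succ', mul_dvd_mul_iff_left (natCast_ne_zero_of_prime p F)] at h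
  have hcop : IsCoprime (piElt p F) (1 + y * c + p * z ^ (p - 1)) := by
    obtain ⟨w, hw⟩ := piElt_dvd_natCast p (F := F)
    refine ⟨-(piElt p F * z * c + w * z ^ (p - 1)), 1, ?_⟩
    linear_combination c * hz + z ^ (p - 1) * hw
  exact (isCoprime_pow_of_piElt_dvd p hcop L).dvd_of_dvd_mul_right h

include hm hM hM2 in
-- Apply the rigidity of approximate roots of unity to `ζ = ψ(x)ψ(y)ψ(x+y)^(p-1)`. Its `p`-th power
-- is `1` modulo `p^(L+1)`, and its first-order term vanishes modulo `π²` because Teichmüller traces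
-- are additive modulo `p`. Multiplying `ζ ≡ 1` by `ψ(x+y)` gives the claim.
theorem thetaChar_add (x y : F) :
    (p : 𝓓) ^ L ∣ thetaChar p F M m x * thetaChar p F M m y - thetaChar p F M m (x + y) := by
  have hpow := thetaChar_pow p hm hM
  obtain ⟨a, ha⟩ := exists_thetaChar_eq p hM2 m x
  obtain ⟨b, hb⟩ := exists_thetaChar_eq p hM2 m y
  obtain ⟨c, hc⟩ := exists_prod_one_add (piElt p F) (p - 1) (fun _ => thetaChar p F M m (x + y))
    _ (fun _ => exists_thetaChar_eq p hM2 m (x + y))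
  rw [Finset.prod_const, Finset.sum_const, Finset.card_range, nsmul_eq_mul,
    Nat.cast_sub hp.out.one_lt.le, Nat.cast_one] at hc
  obtain ⟨d, hd⟩ := natCast_dvd_teichTrace_add p m x y
  obtain ⟨w, hw⟩ := piElt_dvd_natCast p (F := F)
  set A := thetaChar p F M m x
  set B := thetaChar p F M m y
  set C' := thetaChar p F M m (x + y)
  set ζ := A * B * C' ^ (p - 1) with hζ
  have h1 : piElt p F ^ 2 ∣ ζ - 1 := by
    set ϖ := piElt p F
    set s := teichTrace p m x
    set t := teichTrace p m y
    set u := teichTrace p m (x + y)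
    -- The left side is `(s + t - u) + pu`; both summands are divisible by `p`, hence by `π`.
    have e : s + t + (p - 1) * u = ϖ * (w * (d + u)) := by
      linear_combination hd + (d + u) * hw
    have e' : ζ - 1 = ϖ * (s + t + (p - 1) * u) + ϖ ^ 2 * (a + b + c + s * t
        + s * ((p - 1) * u) + t * ((p - 1) * u) + ϖ * (a * t + s * b + a * ((p - 1) * u)
        + s * c + b * ((p - 1) * u) + t * c + s * t * ((p - 1) * u))
        + ϖ ^ 2 * (a * b + a * c + b * c + s * t * c + s * b * ((p - 1) * u)
        + a * t * ((p - 1) * u)) + ϖ ^ 3 * (s * b * c + a * t * c + a * b * ((p - 1) * u))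
        + ϖ ^ 4 * (a * b * c)) := by
      rw [hζ, hc, ha, hb]; ring
    rw [e', e]
    exact dvd_add ⟨w * (d + u), by ring⟩ (dvd_mul_right _ _)
  have h2 : (p : 𝓓) ^ (L + 1) ∣ (1 + (ζ - 1)) ^ p - 1 := by
    rw [add_sub_cancel, ← Ideal.mem_span_singleton, ← Ideal.Quotient.eq_zero_iff_mem, map_sub,
      sub_eq_zero, map_pow, hζ]
    have hq : ∀ z, Ideal.Quotient.mk (Ideal.span {(p : 𝓓) ^ (L + 1)}) (thetaChar p F M m z) ^ p
        = 1 := fun z => by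
      rw [← map_pow, ← sub_eq_zero, ← map_one (Ideal.Quotient.mk _), ← map_sub,
        Ideal.Quotient.eq_zero_iff_mem, Ideal.mem_span_singleton]
      exact hpow z
    rw [map_mul, map_mul, mul_pow, mul_pow, map_pow, ← pow_mul, mul_comm (p - 1), pow_mul, hq, hq,
      hq]
    simp
  have h3 := natCast_pow_dvd_of_pow_eq_one p h1 h2
  have h4 : (p : 𝓓) ^ L ∣ C' ^ p - 1 := (pow_dvd_pow _ (Nat.le_succ L)).trans (hpow (x + y))
  have e : A * B - C' = C' * (ζ - 1) - A * B * (C' ^ p - 1) := by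
    have : C' ^ p = C' ^ (p - 1) * C' := by
      rw [← pow_succ, Nat.sub_add_cancel hp.out.one_lt.le]
    rw [hζ, this]; ring
  rw [e]
  exact dvd_sub (h3.mul_left _) (h4.mul_left _)

theorem thetaChar_zero (hM2 : 2 ≤ M) : thetaChar p F M m 0 = 1 := by
  refine Finset.prod_eq_one fun i _ => ?_
  rw [teich_zero, zero_pow (pow_pos hp.out.pos i).ne', eval_thetaPoly,
    Finset.sum_eq_single_of_mem 0 (Finset.mem_range.mpr (by omega)), coeff_zero_theta]
  · simp
  · intro i _ hi
    rw [zero_pow hi, mul_zero]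

/-! ### Vanishing of the character sum -/

include hm in
-- The trace polynomial has degree at most `p^(m-1) < |F|` and its coefficient at `X` is `1`, so it
-- cannot vanish on all of `F`.
theorem exists_trace_ne_zero : ∃ x : F, ∑ i ∈ Finset.range m, x ^ p ^ i ≠ 0 := by
  by_contra! h
  have := Fintype.ofFinite F
  have hm0 : 0 < m := by
    rcases Nat.eq_zero_or_pos m with rfl | h0
    · rw [pow_zero] at hm
      exact absurd (hm ▸ Finite.one_lt_card (α := F)) (lt_irrefl 1)
    · exact h0
  set P : Polynomial F := ∑ i ∈ Finset.range m, Polynomial.X ^ p ^ i with hP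
  have hdeg : P.natDegree ≤ p ^ (m - 1) := by
    refine Polynomial.natDegree_sum_le_of_forall_le _ _ fun i hi => ?_
    rw [Polynomial.natDegree_X_pow]
    exact Nat.pow_le_pow_right hp.out.pos (by have := Finset.mem_range.mp hi; omega)
  have hlt : p ^ (m - 1) < p ^ m := Nat.pow_lt_pow_right hp.out.one_lt (by omega)
  have h0 : P = 0 := by
    refine Polynomial.eq_zero_of_natDegree_lt_card_of_eval_eq_zero P Function.injective_id
      (fun x => ?_) ?_
    · rw [hP, Polynomial.eval_finsetSum]
      simpa using h x
    · rw [← Nat.card_eq_fintype_card, hm]; omega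
  have h1 : P.coeff 1 = 1 := by
    rw [hP, Polynomial.finsetSum_coeff, Finset.sum_eq_single_of_mem 0 (Finset.mem_range.mpr hm0)]
    · simp
    · intro i _ hi
      rw [Polynomial.coeff_X_pow, if_neg]
      exact fun h => (Nat.one_lt_pow hi hp.out.one_lt).ne h
  rw [h0] at h1
  simp at h1

include hm hM hM2 in
-- Translation by `x₀` gives `(ψ(x₀) - 1) S ≡ 0` modulo `p^L`. If `x₀` has nonzero trace, `ψ(x₀) -
-- 1` is `π` times an element coprime to `π`; cancelling that element and bounding `π` by `p` costs
-- one factor `p`.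
theorem sum_thetaChar [Fintype F] :
    (p : 𝓓) ^ (L - 1) ∣ ∑ x : F, thetaChar p F M m x := by
  rcases Nat.eq_zero_or_pos L with rfl | hL
  · simp
  obtain ⟨x₀, hx₀⟩ := exists_trace_ne_zero p hm
  obtain ⟨s, hs⟩ := exists_thetaChar_eq p hM2 m x₀
  set S := ∑ x : F, thetaChar p F M m x with hS
  have h1 : (p : 𝓓) ^ L ∣ (thetaChar p F M m x₀ - 1) * S := by
    have e : ∑ x : F, thetaChar p F M m (x₀ + x) = S :=
      Fintype.sum_equiv (Equiv.addLeft x₀) _ _ fun _ => rfl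
    have : (thetaChar p F M m x₀ - 1) * S = ∑ x : F, (thetaChar p F M m x₀ * thetaChar p F M m x
        - thetaChar p F M m (x₀ + x)) := by
      rw [Finset.sum_sub_distrib, e, ← Finset.mul_sum, ← hS]; ring
    rw [this]
    exact Finset.dvd_sum fun x _ => thetaChar_add p hm hM hM2 x₀ x
  set w : WittVector p F := ∑ i ∈ Finset.range m, WittVector.teichmuller p x₀ ^ p ^ i with hw
  have hwu : IsUnit w := by
    apply WittVector.isUnit_of_coeff_zero_ne_zero
    have : w.coeff 0 = ∑ i ∈ Finset.range m, x₀ ^ p ^ i := by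
      change WittVector.constantCoeff (p := p) (R := F) w = _
      rw [hw, map_sum]
      refine Finset.sum_congr rfl fun i _ => ?_
      rw [map_pow]
      exact congrArg (· ^ p ^ i) (WittVector.teichmuller_coeff_zero p x₀)
    rwa [this]
  have htr : teichTrace p m x₀ = AdjoinRoot.of (piPoly p F) w := by
    rw [hw, map_sum]
    exact Finset.sum_congr rfl fun i _ => (map_pow _ _ _).symm
  obtain ⟨u, hu⟩ : IsUnit (teichTrace p m x₀) := htr ▸ hwu.map _
  have h2 : thetaChar p F M m x₀ - 1 = piElt p F * (teichTrace p m x₀ + piElt p F * s) := by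
    rw [hs]; ring
  have hcop : IsCoprime (piElt p F) (teichTrace p m x₀ + piElt p F * s) := by
    refine ⟨-(s * ↑u⁻¹), ↑u⁻¹, ?_⟩
    rw [← hu]
    have := Units.inv_mul u
    linear_combination this
  rw [h2, mul_comm, ← mul_assoc] at h1
  have h3 := (isCoprime_pow_of_piElt_dvd p hcop L).dvd_of_dvd_mul_right h1
  have h4 : (p : 𝓓) ^ L ∣ S * p := h3.trans (mul_dvd_mul_left _ (piElt_dvd_natCast p))
  obtain ⟨k, rfl⟩ : ∃ k, L = k + 1 := ⟨L - 1, by omega⟩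
  rw [pow_succ, mul_dvd_mul_iff_right (natCast_ne_zero_of_prime p F)] at h4
  exact h4

end Character

end DworkTrace
end

noncomputable section
set_option linter.unusedSectionVars false
namespace DworkTrace

/-! ### The trace formula for polynomials over a commutative ring -/

section TraceFormula

variable {σ : Type*} [Fintype σ] [DecidableEq σ] {B : Type*} [CommRing B]

/-- The exponents bounded by `T`. -/
abbrev Box (T : σ →₀ ℕ) : Type _ := {u : σ →₀ ℕ // u ∈ Finset.Iic T}

/-- The matrix `(G_{q u - v})`, with rows and columns in a box. -/
def coeffMat (T : σ →₀ ℕ) (q : ℕ) (G : MvPolynomial σ B) : Matrix (Box T) (Box T) B :=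
  fun u v => if v.1 ≤ q • u.1 then MvPolynomial.coeff (q • u.1 - v.1) G else 0

theorem coeff_expand_mul (q : ℕ) (G H : MvPolynomial σ B) (r : σ →₀ ℕ) :
    MvPolynomial.coeff r (MvPolynomial.expand q G * H) = ∑ g ∈ G.support,
      if q • g ≤ r then MvPolynomial.coeff g G * MvPolynomial.coeff (r - q • g) H else 0 := by
  conv_lhs => rw [G.as_sum, map_sum, Finset.sum_mul, MvPolynomial.coeff_sum]
  refine Finset.sum_congr rfl fun g _ => ?_
  rw [MvPolynomial.expand_monomial, MvPolynomial.coeff_monomial_mul']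

theorem smul_sub_le {p q : ℕ} {u v w : σ →₀ ℕ} (hv : v ≤ p • u) (hw : w ≤ q • v) :
    w ≤ (p * q) • u ∧ q • (p • u - v) ≤ (p * q) • u - w ∧
      (p * q) • u - w - q • (p • u - v) = q • v - w := by
  have key : ∀ i, ∃ a, p * u i - v i = a ∧ p * q * u i = q * v i + q * a ∧ w i ≤ q * v i := by
    intro i
    have h1 := hv i
    have h2 := hw i
    simp only [Finsupp.smul_apply, smul_eq_mul] at h1 h2
    obtain ⟨a, ha⟩ := Nat.exists_eq_add_of_le h1
    refine ⟨a, by omega, ?_, h2⟩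
    rw [mul_comm p q, mul_assoc, ha, mul_add]
  refine ⟨fun i => ?_, fun i => ?_, ?_⟩
  · obtain ⟨a, _, h2, h3⟩ := key i
    simp only [Finsupp.smul_apply, smul_eq_mul]
    omega
  · obtain ⟨a, h1, h2, h3⟩ := key i
    simp only [Finsupp.smul_apply, smul_eq_mul, Finsupp.tsub_apply, h1]
    omega
  · ext i
    obtain ⟨a, h1, h2, h3⟩ := key i
    simp only [Finsupp.smul_apply, smul_eq_mul, Finsupp.tsub_apply, h1]
    omega

/-- This makes the box large enough: any middle index `v` contributing to a product, with `w` in the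
box and `qv - w` in the support, is again in the box. -/
theorem le_of_smul_sub_le {q : ℕ} (hq : q ≠ 0) {v w T : σ →₀ ℕ} (hw : w ≤ T)
    (h : q • v - w ≤ (q - 1) • T) : v ≤ T := by
  intro i
  have h1 := h i
  have h2 := hw i
  simp only [Finsupp.smul_apply, smul_eq_mul, Finsupp.tsub_apply] at h1
  obtain ⟨r, rfl⟩ : ∃ r, q = r + 1 := ⟨q - 1, by omega⟩
  rw [Nat.add_sub_cancel] at h1
  have h3 : (r + 1) * v i ≤ (r + 1) * T i := by
    rw [add_mul r 1 (T i), one_mul]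
    omega
  exact Nat.le_of_mul_le_mul_left h3 (Nat.succ_pos r)

theorem le_smul_of_smul_le {p q : ℕ} (hq : q ≠ 0) {u w g : σ →₀ ℕ} (hw : w ≤ (p * q) • u)
    (h : q • g ≤ (p * q) • u - w) : g ≤ p • u ∧ w ≤ q • (p • u - g) ∧
      (p * q) • u - w - q • g = q • (p • u - g) - w := by
  have key : ∀ i, g i ≤ p * u i ∧ q * (p * u i - g i) + q * g i = p * q * u i ∧
      w i ≤ p * q * u i ∧ q * g i ≤ p * q * u i - w i := by
    intro i
    have h1 := h i
    have h2 := hw i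
    simp only [Finsupp.smul_apply, smul_eq_mul, Finsupp.tsub_apply] at h1 h2
    have h3 : g i ≤ p * u i := by
      have h4 : q * g i ≤ q * (p * u i) := by
        rw [← mul_assoc, mul_comm q p]
        omega
      exact Nat.le_of_mul_le_mul_left h4 (Nat.pos_of_ne_zero hq)
    refine ⟨h3, ?_, h2, h1⟩
    rw [← mul_add, Nat.sub_add_cancel h3, ← mul_assoc, mul_comm q p]
  refine ⟨fun i => (key i).1, fun i => ?_, ?_⟩
  · obtain ⟨h1, h2, h3, h4⟩ := key i
    simp only [Finsupp.smul_apply, smul_eq_mul, Finsupp.tsub_apply]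
    omega
  · ext i
    obtain ⟨h1, h2, h3, h4⟩ := key i
    simp only [Finsupp.smul_apply, smul_eq_mul, Finsupp.tsub_apply]
    omega

/-- Put `g = pu - v`; then `qg + (qv - w) = pqu - w`, so the sum over `v` is the convolution
computing a coefficient of `G(X^q)H`. The support condition on `H` guarantees that no term is lost
outside the box. -/
theorem coeffMat_mul {p q : ℕ} (hq : q ≠ 0) {T : σ →₀ ℕ} (G H : MvPolynomial σ B)
    (hH : ∀ r ∈ H.support, r ≤ (q - 1) • T) :
    coeffMat T p G * coeffMat T q H = coeffMat T (p * q) (MvPolynomial.expand q G * H) := by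
  ext u w
  have hwT : w.1 ≤ T := Finset.mem_Iic.mp w.2
  rw [Matrix.mul_apply]
  simp only [coeffMat]
  rw [coeff_expand_mul]
  by_cases hwu : w.1 ≤ (p * q) • u.1
  swap
  · rw [if_neg hwu]
    refine Finset.sum_eq_zero fun v _ => ?_
    split_ifs with h1 h2
    · exact absurd (smul_sub_le h1 h2).1 hwu
    all_goals simp
  rw [if_pos hwu]
  refine Finset.sum_bij_ne_zero (fun v _ _ => p • u.1 - v.1) ?_ ?_ ?_ ?_
  · intro v _ hv
    rw [MvPolynomial.mem_support_iff]
    intro h0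
    rw [h0, ite_self, zero_mul] at hv
    exact hv rfl
  · intro v _ hv v' _ hv' h
    have hle : v.1 ≤ p • u.1 := by
      by_contra h; rw [if_neg h, zero_mul] at hv; exact hv rfl
    have hle' : v'.1 ≤ p • u.1 := by
      by_contra h; rw [if_neg h, zero_mul] at hv'; exact hv' rfl
    ext i
    have h1 := DFunLike.congr_fun h i
    have h2 := hle i
    have h3 := hle' i
    simp only [Finsupp.tsub_apply] at h1
    omega
  · intro g _ hg
    have hqg : q • g ≤ (p * q) • u.1 - w.1 := by
      by_contra h; rw [if_neg h] at hg; exact hg rfl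
    rw [if_pos hqg] at hg
    obtain ⟨h1, h2, h3⟩ := le_smul_of_smul_le hq hwu hqg
    rw [h3] at hg
    have hvT : p • u.1 - g ≤ T :=
      le_of_smul_sub_le hq hwT (hH _ (MvPolynomial.mem_support_iff.mpr (right_ne_zero_of_mul hg)))
    refine ⟨⟨p • u.1 - g, Finset.mem_Iic.mpr hvT⟩, Finset.mem_univ _, ?_, ?_⟩
    · rw [if_pos tsub_le_self, if_pos h2, tsub_tsub_cancel_of_le h1]
      exact hg
    · exact tsub_tsub_cancel_of_le h1
  · intro v _ hv
    have h1 : v.1 ≤ p • u.1 := by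
      by_contra h; rw [if_neg h, zero_mul] at hv; exact hv rfl
    have h2 : w.1 ≤ q • v.1 := by
      by_contra h; rw [if_neg h, mul_zero] at hv; exact hv rfl
    obtain ⟨_, h4, h5⟩ := smul_sub_le h1 h2
    rw [if_pos h1, if_pos h2, if_pos h4, h5]

/-- The product `∏ G_i (X ^ (p ^ (m - 1 - i)))`. -/
def expandProd (p m : ℕ) (G : ℕ → MvPolynomial σ B) : MvPolynomial σ B :=
  ∏ i ∈ Finset.range m, MvPolynomial.expand (p ^ (m - 1 - i)) (G i)

theorem expandProd_succ (p m : ℕ) (G : ℕ → MvPolynomial σ B) :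
    expandProd p (m + 1) G =
      MvPolynomial.expand (p ^ m) (G 0) * expandProd p m (fun i => G (i + 1)) := by
  rw [expandProd, Finset.prod_range_succ', mul_comm]
  congr 1
  refine Finset.prod_congr rfl fun i _ => ?_
  have : m + 1 - 1 - (i + 1) = m - 1 - i := by omega
  rw [this]

theorem le_of_mem_support_expandProd {p : ℕ} (hp : p ≠ 0) {T : σ →₀ ℕ} (m : ℕ)
    (G : ℕ → MvPolynomial σ B) (hG : ∀ i, ∀ r ∈ (G i).support, r ≤ (p - 1) • T) :
    ∀ r ∈ (expandProd p m G).support, r ≤ (p ^ m - 1) • T := by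
  induction m generalizing G with
  | zero =>
    intro r hr
    rw [expandProd, Finset.prod_range_zero] at hr
    rw [MvPolynomial.mem_support_iff, MvPolynomial.coeff_one] at hr
    have : r = 0 := by by_contra h; exact hr (if_neg (Ne.symm h))
    rw [this]
    exact zero_le
  | succ m ih =>
    intro r hr
    have hq : p ^ m ≠ 0 := pow_ne_zero m hp
    rw [MvPolynomial.mem_support_iff, expandProd_succ, coeff_expand_mul] at hr
    obtain ⟨g, hg, hg0⟩ := Finset.exists_ne_zero_of_sum_ne_zero hr
    have hle : p ^ m • g ≤ r := by
      by_contra h; rw [if_neg h] at hg0; exact hg0 rfl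
    rw [if_pos hle] at hg0
    have h1 := hG 0 g hg
    have h2 := ih (fun i => G (i + 1)) (fun i => hG (i + 1)) _
      (MvPolynomial.mem_support_iff.mpr (right_ne_zero_of_mul hg0))
    intro i
    have h3 := h1 i
    have h4 := h2 i
    have h5 := hle i
    simp only [Finsupp.smul_apply, smul_eq_mul, Finsupp.tsub_apply] at h3 h4 h5 ⊢
    have h6 := Nat.mul_le_mul_left (p ^ m) h3
    obtain ⟨s, hs⟩ : ∃ s, p = s + 1 := ⟨p - 1, by omega⟩
    obtain ⟨t, ht⟩ : ∃ t, p ^ m = t + 1 := ⟨p ^ m - 1, by omega⟩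
    have e1 : p - 1 = s := by omega
    have e2 : p ^ (m + 1) = (t + 1) * (s + 1) := by rw [pow_succ, ht, hs]
    rw [ht] at h4 h5 h6
    rw [e1] at h6
    rw [Nat.add_sub_cancel] at h4
    -- Supports add up through `p^(m+1) - 1 = p^m (p - 1) + (p^m - 1)`.
    have e3 : ((t + 1) * (s + 1) - 1) * T i = (t + 1) * (s * T i) + t * T i := by
      have : (t + 1) * (s + 1) - 1 = (t + 1) * s + t := by
        have : (t + 1) * (s + 1) = (t + 1) * s + t + 1 := by ring
        omega
      rw [this]; ring
    rw [e2, e3]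
    omega

theorem prod_coeffMat {p : ℕ} (hp : p ≠ 0) {T : σ →₀ ℕ} (m : ℕ)
    (G : ℕ → MvPolynomial σ B) (hG : ∀ i, ∀ r ∈ (G i).support, r ≤ (p - 1) • T) :
    ((List.range m).map fun i => coeffMat T p (G i)).prod =
      coeffMat T (p ^ m) (expandProd p m G) := by
  induction m generalizing G with
  | zero =>
    ext u v
    rw [List.range_zero, List.map_nil, List.prod_nil, expandProd, Finset.prod_range_zero, coeffMat,
      pow_zero, one_smul, MvPolynomial.coeff_one, Matrix.one_apply]
    by_cases h : u = v
    · subst h; simp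
    · rw [if_neg h]
      split_ifs with h1 h2
      · exact absurd (Subtype.ext (le_antisymm (tsub_eq_zero_iff_le.mp h2.symm) h1)) h
      all_goals rfl
  | succ m ih =>
    have hq : p ^ m ≠ 0 := pow_ne_zero m hp
    rw [List.range_succ_eq_map, List.map_cons, List.prod_cons, List.map_map, expandProd_succ,
      pow_succ', ← coeffMat_mul hq _ _
        (le_of_mem_support_expandProd hp m _ (fun i => hG (i + 1))),
      ← ih _ (fun i => hG (i + 1))]
    rfl

theorem trace_coeffMat {T : σ →₀ ℕ} {Q : ℕ} (hQ : Q ≠ 0) (P : MvPolynomial σ B) :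
    (coeffMat T Q P).trace = ∑ u ∈ Finset.Iic T, MvPolynomial.coeff ((Q - 1) • u) P := by
  rw [Matrix.trace, ← Finset.sum_coe_sort (Finset.Iic T)
    (fun u => MvPolynomial.coeff ((Q - 1) • u) P)]
  refine Finset.sum_congr rfl fun u _ => ?_
  obtain ⟨r, rfl⟩ : ∃ r, Q = r + 1 := ⟨Q - 1, by omega⟩
  rw [Matrix.diag_apply, coeffMat, add_smul, one_smul, if_pos (le_add_of_nonneg_left zero_le),
    add_tsub_cancel_right, Nat.add_sub_cancel]

/-- The sum of a polynomial over the points with coordinates in a group of roots of unity. -/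
theorem sum_eval_eq {G : Type*} [CommGroup G] [Fintype G] (χ : G →* B) {Q : ℕ} (hQ : 1 < Q)
    (hχ : ∀ r : ℕ, ∑ x, χ x ^ r = if Q - 1 ∣ r then (Q : B) - 1 else 0) {T : σ →₀ ℕ}
    (P : MvPolynomial σ B) (hP : ∀ r ∈ P.support, r ≤ (Q - 1) • T) :
    ∑ x : σ → G, MvPolynomial.eval (fun i => χ (x i)) P =
      ((Q : B) - 1) ^ Fintype.card σ * ∑ u ∈ Finset.Iic T, MvPolynomial.coeff ((Q - 1) • u) P := by
  have hQ1 : 0 < Q - 1 := by omega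
  have h1 : ∑ x : σ → G, MvPolynomial.eval (fun i => χ (x i)) P = ∑ r ∈ P.support,
      MvPolynomial.coeff r P * (if ∀ i, Q - 1 ∣ r i then ((Q : B) - 1) ^ Fintype.card σ else 0) := by
    simp_rw [MvPolynomial.eval_eq']
    rw [Finset.sum_comm]
    refine Finset.sum_congr rfl fun r _ => ?_
    rw [← Finset.mul_sum]
    congr 1
    have := Finset.prod_univ_sum (fun _ : σ => (Finset.univ : Finset G)) (fun i x => χ x ^ r i)
    rw [Fintype.piFinset_univ] at this
    rw [← this]
    simp_rw [hχ]
    split_ifs with h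
    · rw [Finset.prod_congr rfl (fun i _ => if_pos (h i)), Finset.prod_const, Finset.card_univ]
    · obtain ⟨i, hi⟩ := not_forall.mp h
      exact Finset.prod_eq_zero (Finset.mem_univ i) (if_neg hi)
  rw [h1, Finset.mul_sum]
  symm
  refine Finset.sum_bij_ne_zero (fun u _ _ => (Q - 1) • u) ?_ ?_ ?_ ?_
  · intro u _ hu
    exact MvPolynomial.mem_support_iff.mpr (right_ne_zero_of_mul hu)
  · intro u _ _ v _ _ h
    ext i
    have := DFunLike.congr_fun h i
    simp only [Finsupp.smul_apply, smul_eq_mul] at this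
    exact Nat.eq_of_mul_eq_mul_left hQ1 this
  · intro r hr h
    have hd : ∀ i, Q - 1 ∣ r i := by
      by_contra h'; rw [if_neg h', mul_zero] at h; exact h rfl
    rw [if_pos hd, mul_comm] at h
    choose c hc using hd
    have e : (Q - 1) • Finsupp.equivFunOnFinite.symm c = r := by
      ext i
      simp [hc i]
    refine ⟨Finsupp.equivFunOnFinite.symm c, Finset.mem_Iic.mpr fun i => ?_, ?_, e⟩
    · have h2 := hP r hr i
      rw [← e] at h2
      simp only [Finsupp.smul_apply, smul_eq_mul] at h2
      exact Nat.le_of_mul_le_mul_left h2 hQ1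
    · rw [e]; exact h
  · intro u _ _
    rw [if_pos (fun i => by simp), mul_comm]

end TraceFormula

/-! ### Truncation of the trace -/

section Truncation

variable {B : Type*} [CommRing B]

/-- The elements divisible by `ϖ ^ e` for some `e ≥ c / s`. -/
def weightIdeal (ϖ : B) {s : ℕ} (hs : 0 < s) (c : ℤ) : Ideal B where
  carrier := {x | ∃ e : ℕ, c ≤ s * e ∧ ϖ ^ e ∣ x}
  zero_mem' := by
    refine ⟨c.toNat, ?_, dvd_zero _⟩
    have h1 : (1 : ℤ) * c.toNat ≤ s * c.toNat :=
      mul_le_mul_of_nonneg_right (by exact_mod_cast hs) (Int.natCast_nonneg _)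
    have h2 := Int.self_le_toNat c
    linarith
  add_mem' := by
    rintro x y ⟨e, he, hx⟩ ⟨e', he', hy⟩
    rcases le_total e e' with h | h
    · exact ⟨e, he, dvd_add hx ((pow_dvd_pow _ h).trans hy)⟩
    · exact ⟨e', he', dvd_add ((pow_dvd_pow _ h).trans hx) hy⟩
  smul_mem' := by
    rintro a x ⟨e, he, hx⟩
    exact ⟨e, he, hx.mul_left a⟩

variable {ϖ : B} {s : ℕ} {hs : 0 < s}

theorem weightIdeal_mono {c d : ℤ} (h : c ≤ d) {x : B} (hx : x ∈ weightIdeal ϖ hs d) :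
    x ∈ weightIdeal ϖ hs c := by
  obtain ⟨e, he, hx⟩ := hx
  exact ⟨e, h.trans he, hx⟩

theorem mul_mem_weightIdeal {c d : ℤ} {x y : B} (hx : x ∈ weightIdeal ϖ hs c)
    (hy : y ∈ weightIdeal ϖ hs d) : x * y ∈ weightIdeal ϖ hs (c + d) := by
  obtain ⟨e, he, hx⟩ := hx
  obtain ⟨e', he', hy⟩ := hy
  refine ⟨e + e', ?_, pow_add ϖ e e' ▸ mul_dvd_mul hx hy⟩
  push_cast
  linarith

theorem one_mem_weightIdeal {c : ℤ} (hc : c ≤ 0) : (1 : B) ∈ weightIdeal ϖ hs c :=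
  ⟨0, by simpa using hc, by simp⟩

theorem eq_zero_of_mem_weightIdeal {e : ℕ} (he : ϖ ^ e = 0) {x : B}
    (hx : x ∈ weightIdeal ϖ hs (s * e)) : x = 0 := by
  obtain ⟨e', he', hx⟩ := hx
  have h : e ≤ e' := by
    have : (0 : ℤ) < s := by exact_mod_cast hs
    exact_mod_cast le_of_mul_le_mul_left he' this
  have := (pow_dvd_pow ϖ h).trans hx
  rwa [he, zero_dvd_iff] at this

variable {ι : Type*} [Fintype ι] [DecidableEq ι]

/-- The entry at `(u, v)` has weight at least `φ u - φ v + c`. -/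
def WeightBounded (ϖ : B) {s : ℕ} (hs : 0 < s) (φ : ι → ℤ) (c : ℤ) (X : Matrix ι ι B) : Prop :=
  ∀ u v, X u v ∈ weightIdeal ϖ hs (φ u - φ v + c)

variable {φ : ι → ℤ}

/-- The potential differences `φ u - φ v` telescope along a product, and the surpluses `c`, `d` add.
On the diagonal only the surplus remains. -/
theorem WeightBounded.mul {c d : ℤ} {X Y : Matrix ι ι B} (hX : WeightBounded ϖ hs φ c X)
    (hY : WeightBounded ϖ hs φ d Y) : WeightBounded ϖ hs φ (c + d) (X * Y) := by
  intro u w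
  rw [Matrix.mul_apply]
  refine Ideal.sum_mem _ fun v _ => ?_
  have := mul_mem_weightIdeal (hX u v) (hY v w)
  exact weightIdeal_mono (by linarith) this

theorem WeightBounded.add {c : ℤ} {X Y : Matrix ι ι B} (hX : WeightBounded ϖ hs φ c X)
    (hY : WeightBounded ϖ hs φ c Y) : WeightBounded ϖ hs φ c (X + Y) :=
  fun u v => Ideal.add_mem _ (hX u v) (hY u v)

theorem WeightBounded.prod {X : ℕ → Matrix ι ι B} (hX : ∀ i, WeightBounded ϖ hs φ 0 (X i))
    (m : ℕ) : WeightBounded ϖ hs φ 0 ((List.range m).map X).prod := by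
  induction m generalizing X with
  | zero =>
    intro u v
    rw [List.range_zero, List.map_nil, List.prod_nil, Matrix.one_apply]
    split_ifs with h
    · subst h; exact one_mem_weightIdeal (by simp)
    · exact Ideal.zero_mem _
  | succ m ih =>
    rw [List.range_succ_eq_map, List.map_cons, List.prod_cons, List.map_map]
    simpa using (hX 0).mul (ih (X := X ∘ Nat.succ) fun i => hX (i + 1))

open Classical in
/-- The matrix `X` with the rows outside `S` replaced by zero. -/
def rowRestrict (S : ι → Prop) (X : Matrix ι ι B) : Matrix ι ι B :=
  fun u v => if S u then X u v else 0

theorem WeightBounded.rowRestrict {c : ℤ} {X : Matrix ι ι B} (hX : WeightBounded ϖ hs φ c X)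
    (S : ι → Prop) : WeightBounded ϖ hs φ c (rowRestrict S X) := by
  intro u v
  rw [DworkTrace.rowRestrict]
  split_ifs
  · exact hX u v
  · exact Ideal.zero_mem _

/-- Replace the factors one at a time: each replacement changes the product by a matrix of surplus
`c`, the deleted rows having that surplus and every other factor surplus `0`. -/
theorem WeightBounded.prod_sub {X : ℕ → Matrix ι ι B} (hX : ∀ i, WeightBounded ϖ hs φ 0 (X i))
    {S : ι → Prop} {c : ℤ} (hS : ∀ i u v, ¬ S u → X i u v ∈ weightIdeal ϖ hs (φ u - φ v + c))
    (m : ℕ) : WeightBounded ϖ hs φ c (((List.range m).map X).prod -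
      ((List.range m).map fun i => DworkTrace.rowRestrict S (X i)).prod) := by
  induction m generalizing X with
  | zero =>
    intro u v
    rw [List.range_zero, List.map_nil, List.map_nil, sub_self]
    exact Ideal.zero_mem _
  | succ m ih =>
    rw [List.range_succ_eq_map, List.map_cons, List.prod_cons, List.map_map, List.map_cons,
      List.prod_cons, List.map_map]
    have h1 := ih (X := X ∘ Nat.succ) (fun i => hX (i + 1)) (fun i => hS (i + 1))
    have h2 := WeightBounded.prod (X := X ∘ Nat.succ) (fun i => hX (i + 1)) m
    have h3 : WeightBounded ϖ hs φ c (X 0 - DworkTrace.rowRestrict S (X 0)) := by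
      intro u v
      rw [Matrix.sub_apply, DworkTrace.rowRestrict]
      split_ifs with h
      · rw [sub_self]; exact Ideal.zero_mem _
      · rw [sub_zero]; exact hS 0 u v h
    have h4 := (h3.mul h2).add (by simpa using ((hX 0).rowRestrict S).mul h1)
    rw [add_zero] at h4
    convert h4 using 1
    rw [sub_mul, mul_sub, sub_add_sub_cancel]
    rfl

/-- Block triangularity with respect to the range of `f`: the block on that range is multiplicative,
and the vanishing off-diagonal block persists in products. -/
theorem prod_submatrix {κ : Type*} [Fintype κ] [DecidableEq κ] {f : κ → ι}
    (hf : Function.Injective f) {X : ℕ → Matrix ι ι B}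
    (hX : ∀ i u v, v ∈ Set.range f → u ∉ Set.range f → X i u v = 0) (m : ℕ) :
    ((List.range m).map X).prod.submatrix f f =
      ((List.range m).map fun i => (X i).submatrix f f).prod ∧
    ∀ u v, v ∈ Set.range f → u ∉ Set.range f → ((List.range m).map X).prod u v = 0 := by
  induction m generalizing X with
  | zero =>
    refine ⟨?_, fun u v hv hu => ?_⟩
    · rw [List.range_zero, List.map_nil, List.prod_nil, List.map_nil, List.prod_nil,
        Matrix.submatrix_one _ hf]
    · rw [List.range_zero, List.map_nil, List.prod_nil, Matrix.one_apply_ne]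
      rintro rfl; exact hu hv
  | succ m ih =>
    obtain ⟨h1, h2⟩ := ih (X := X ∘ Nat.succ) (fun i => hX (i + 1))
    simp only [List.range_succ_eq_map, List.map_cons, List.prod_cons, List.map_map]
    constructor
    · change _ = (X 0).submatrix f f *
        (List.map (fun i => ((X ∘ Nat.succ) i).submatrix f f) (List.range m)).prod
      rw [← h1]
      ext a b
      rw [Matrix.submatrix_apply, Matrix.mul_apply, Matrix.mul_apply]
      symm
      refine Finset.sum_of_injOn f hf.injOn (fun _ _ => Finset.mem_coe.mpr (Finset.mem_univ _)) ?_
        (fun _ _ => rfl)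
      intro v _ hv
      rw [h2 v (f b) ⟨b, rfl⟩ (by simpa using hv), mul_zero]
    · intro u w hw hu
      rw [Matrix.mul_apply]
      refine Finset.sum_eq_zero fun v _ => ?_
      by_cases hv : v ∈ Set.range f
      · rw [hX 0 u v hv hu, zero_mul]
      · rw [h2 v w hw hv, mul_zero]

/-- If the entry at `(u, v)` vanishes unless `q u - v` lies in the convex cone `C`, then the
diagonal entries of a product vanish outside `C`. -/
theorem smul_sub_mem_of_prod_ne_zero {V : Type*} [AddCommGroup V] [Module ℝ V] {C : Set V}
    (h0 : 0 ∈ C) (hadd : ∀ x ∈ C, ∀ y ∈ C, x + y ∈ C)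
    (hsmul : ∀ t : ℝ, 0 ≤ t → ∀ x ∈ C, t • x ∈ C) {g : ι → V} {p : ℝ} (hp : 0 ≤ p)
    {X : ℕ → Matrix ι ι B} (hX : ∀ i u v, X i u v ≠ 0 → p • g u - g v ∈ C) (m : ℕ) (u v : ι)
    (huv : ((List.range m).map X).prod u v ≠ 0) : p ^ m • g u - g v ∈ C := by
  induction m generalizing X u with
  | zero =>
    rw [List.range_zero, List.map_nil, List.prod_nil] at huv
    have : u = v := by by_contra h; exact huv (Matrix.one_apply_ne h)
    subst this
    rwa [pow_zero, one_smul, sub_self]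
  | succ m ih =>
    rw [List.range_succ_eq_map, List.map_cons, List.prod_cons, List.map_map, Matrix.mul_apply]
      at huv
    obtain ⟨w, _, hw⟩ := Finset.exists_ne_zero_of_sum_ne_zero huv
    have h1 := hX 0 u w (left_ne_zero_of_mul hw)
    have h2 := ih (X := X ∘ Nat.succ) (fun i => hX (i + 1)) w (right_ne_zero_of_mul hw)
    have h3 := hadd _ (hsmul (p ^ m) (pow_nonneg hp m) _ h1) _ h2
    convert h3 using 1
    rw [smul_sub, smul_smul, ← pow_succ, sub_add_sub_cancel]

/-- Rows outside `S` are first zeroed; their surplus kills the difference of the traces because `ϖ^e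
= 0`. The new matrices are block triangular for the cone: `v` and `pu - v` in `C` force `u` in `C`.
A nonzero diagonal entry of the product at `u` puts `(p^m - 1)u` in `C`, hence `u` too, so the
complementary block adds nothing to the trace. -/
theorem trace_prod_eq_trace_prod_submatrix {κ : Type*} [Fintype κ] [DecidableEq κ] {f : κ → ι}
    (hf : Function.Injective f) {X : ℕ → Matrix ι ι B} {S : ι → Prop}
    {V : Type*} [AddCommGroup V] [Module ℝ V] {C : Set V}
    (h0 : 0 ∈ C) (hadd : ∀ x ∈ C, ∀ y ∈ C, x + y ∈ C)
    (hsmul : ∀ t : ℝ, 0 ≤ t → ∀ x ∈ C, t • x ∈ C) {g : ι → V} {p : ℝ} (hp : 1 < p)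
    (hX : ∀ i u v, X i u v ≠ 0 → p • g u - g v ∈ C)
    (hrange : ∀ u, u ∈ Set.range f ↔ S u ∧ g u ∈ C)
    (hw : ∀ i, WeightBounded ϖ hs φ 0 (X i)) {e : ℕ} (he : ϖ ^ e = 0)
    (hS : ∀ i u v, ¬ S u → X i u v ∈ weightIdeal ϖ hs (φ u - φ v + s * e)) {m : ℕ} (hm : 0 < m) :
    ((List.range m).map X).prod.trace =
      ((List.range m).map fun i => (X i).submatrix f f).prod.trace := by
  have hp0 : 0 < p := by linarith
  set Y : ℕ → Matrix ι ι B := fun i => rowRestrict S (X i) with hY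
  have hYX : ∀ i u v, S u → Y i u v = X i u v := fun i u v h => by
    rw [hY]; simp only [rowRestrict]; rw [if_pos h]
  have hY0 : ∀ i u v, ¬ S u → Y i u v = 0 := fun i u v h => by
    rw [hY]; simp only [rowRestrict]; rw [if_neg h]
  have hYne : ∀ i u v, Y i u v ≠ 0 → p • g u - g v ∈ C := fun i u v h => by
    by_cases hu : S u
    · rw [hYX i u v hu] at h; exact hX i u v h
    · exact absurd (hY0 i u v hu) h
  have h1 : ((List.range m).map X).prod.trace = ((List.range m).map Y).prod.trace := by
    rw [← sub_eq_zero, ← Matrix.trace_sub]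
    refine Finset.sum_eq_zero fun u _ => eq_zero_of_mem_weightIdeal (hs := hs) he ?_
    have := WeightBounded.prod_sub hw hS m u u
    rwa [sub_self, zero_add] at this
  have hcone : ∀ u v, g v ∈ C → p • g u - g v ∈ C → g u ∈ C := fun u v hv h => by
    have h2 := hsmul p⁻¹ (inv_nonneg.mpr hp0.le) _ (hadd _ h _ hv)
    rwa [sub_add_cancel, smul_smul, inv_mul_cancel₀ hp0.ne', one_smul] at h2
  have hYr : ∀ i u v, v ∈ Set.range f → u ∉ Set.range f → Y i u v = 0 := by
    intro i u v hv hu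
    by_contra hne
    have hSu : S u := by by_contra h; exact hne (hY0 i u v h)
    exact hu ((hrange u).mpr ⟨hSu, hcone u v ((hrange v).mp hv).2 (hYne i u v hne)⟩)
  have h2 := (prod_submatrix hf hYr m).1
  have h3 : (fun i => (Y i).submatrix f f) = fun i => (X i).submatrix f f := by
    funext i
    ext a b
    exact hYX i _ _ ((hrange _).mp ⟨a, rfl⟩).1
  rw [h1, ← h3, ← h2]
  symm
  refine Finset.sum_of_injOn f hf.injOn (fun _ _ => Finset.mem_coe.mpr (Finset.mem_univ _)) ?_
    (fun _ _ => rfl)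
  intro u _ hu
  have hu' : u ∉ Set.range f := by simpa using hu
  rw [Matrix.diag_apply]
  by_cases hSu : S u
  · by_contra hne
    have h4 := smul_sub_mem_of_prod_ne_zero h0 hadd hsmul hp0.le hYne m u u hne
    have h5 : 0 < p ^ m - 1 := sub_pos.mpr (one_lt_pow₀ hp hm.ne')
    have h6 := hsmul (p ^ m - 1)⁻¹ (inv_nonneg.mpr h5.le) _ h4
    have e : p ^ m • g u - g u = (p ^ m - 1) • g u := by rw [sub_smul, one_smul]
    rw [e, smul_smul, inv_mul_cancel₀ h5.ne', one_smul] at h6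
    exact hu' ((hrange u).mpr ⟨hSu, h6⟩)
  -- Outside `S` the first factor has a zero row; this needs at least one factor, hence `0 < m`.
  · obtain ⟨k, rfl⟩ : ∃ k, m = k + 1 := ⟨m - 1, by omega⟩
    rw [List.range_succ_eq_map, List.map_cons, List.prod_cons, Matrix.mul_apply]
    exact Finset.sum_eq_zero fun v _ => by rw [hY0 0 u v hSu, zero_mul]

/-- Applied to the conjugates `τ^(-i)(A_N)`, periodic because `τ^a = 1`, this replaces the `k`-th
power by a single product of length `ak`. -/
theorem prod_range_pow {M : Type*} [Monoid M] {a : ℕ} {X : ℕ → M} (hX : ∀ i, X (i + a) = X i)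
    (k : ℕ) : ((List.range a).map X).prod ^ k = ((List.range (a * k)).map X).prod := by
  have h : ∀ k i, X (a * k + i) = X i := fun k => by
    induction k with
    | zero => simp
    | succ k ih => intro i; rw [mul_add, mul_one, add_right_comm, hX, ih]
  induction k with
  | zero => simp
  | succ k ih =>
    rw [pow_succ, ih, mul_add, mul_one, List.range_add, List.map_append, List.prod_append,
      List.map_map]
    congr 3
    funext i
    exact (h k i).symm

end Truncation

end DworkTrace
end

noncomputable section
set_option linter.unusedSectionVars false
namespace DworkTrace

/-! ### The cone `C(Δ)` -/

section Cone

variable {n : ℕ} {δ : Set (Fin n → ℝ)}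

/-- The point `(1, y)`. -/
def liftOne (y : Fin n → ℝ) : Fin (n + 1) → ℝ := Fin.cons 1 y

theorem liftOne_zero (y : Fin n → ℝ) : liftOne y 0 = 1 := rfl

theorem smul_liftOne_add {c c' : ℝ} (h : c + c' ≠ 0) (y y' : Fin n → ℝ) :
    c • liftOne y + c' • liftOne y' =
      (c + c') • liftOne ((c / (c + c')) • y + (c' / (c + c')) • y') := by
  ext i
  refine Fin.cases ?_ (fun i => ?_) i
  · simp [liftOne]
  · simp only [liftOne, Pi.add_apply, Pi.smul_apply, Fin.cons_succ, smul_eq_mul]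
    field_simp

theorem exists_smul_liftOne_add (hδ : Convex ℝ δ) {c c' : ℝ} (hc : 0 ≤ c) (hc' : 0 ≤ c')
    {y y' : Fin n → ℝ} (hy : y ∈ δ) (hy' : y' ∈ δ) :
    ∃ z ∈ δ, c • liftOne y + c' • liftOne y' = (c + c') • liftOne z := by
  rcases (add_nonneg hc hc').eq_or_lt with h | h
  · have h1 : c = 0 := by linarith
    have h2 : c' = 0 := by linarith
    exact ⟨y, hy, by simp [h1, h2]⟩
  · refine ⟨_, ?_, smul_liftOne_add h.ne' y y'⟩
    exact hδ hy hy' (div_nonneg hc h.le) (div_nonneg hc' h.le) (by field_simp)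

/-- The right side is already convex. The case `x = 0` is listed separately because `δ` may be
empty. -/
theorem mem_bigDelta_iff (hδ : Convex ℝ δ) {x : Fin (n + 1) → ℝ} :
    x ∈ bigDelta δ ↔ x = 0 ∨ ∃ s : ℝ, 0 ≤ s ∧ s ≤ 1 ∧ ∃ y ∈ δ, x = s • liftOne y := by
  constructor
  · intro hx
    set D : Set (Fin (n + 1) → ℝ) :=
      {x | x = 0 ∨ ∃ s : ℝ, 0 ≤ s ∧ s ≤ 1 ∧ ∃ y ∈ δ, x = s • liftOne y} with hD
    have hconv : Convex ℝ D := by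
      intro x hx y hy a b ha hb hab
      rcases hx with rfl | ⟨s, hs, hs1, z, hz, rfl⟩ <;> rcases hy with rfl | ⟨t, ht, ht1, w, hw, rfl⟩
      · left; simp
      · right
        exact ⟨b * t, by positivity, by nlinarith, w, hw, by rw [smul_zero, zero_add, smul_smul]⟩
      · right
        exact ⟨a * s, by positivity, by nlinarith, z, hz, by rw [smul_zero, add_zero, smul_smul]⟩
      · right
        obtain ⟨v, hv, e⟩ := exists_smul_liftOne_add hδ (mul_nonneg ha hs) (mul_nonneg hb ht) hz hw
        exact ⟨a * s + b * t, by positivity, by nlinarith, v, hv,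
          by rw [smul_smul, smul_smul, e]⟩
    refine convexHull_min ?_ hconv hx
    rintro z (rfl | ⟨y, hy, rfl⟩)
    · left; rfl
    · right
      exact ⟨1, zero_le_one, le_rfl, y, hy, by rw [one_smul]; rfl⟩
  · have h0 : (0 : Fin (n + 1) → ℝ) ∈ bigDelta δ := subset_convexHull ℝ _ (Set.mem_insert _ _)
    rintro (rfl | ⟨s, hs, hs1, y, hy, rfl⟩)
    · exact h0
    · have h1 : liftOne y ∈ bigDelta δ := subset_convexHull ℝ _ (Set.mem_insert_of_mem _ ⟨y, hy, rfl⟩)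
      have := (convex_convexHull ℝ _) h0 h1 (sub_nonneg.mpr hs1) hs (by ring)
      rwa [smul_zero, zero_add] at this

theorem mem_cone_iff (hδ : Convex ℝ δ) {x : Fin (n + 1) → ℝ} :
    x ∈ cone δ ↔ x = 0 ∨ ∃ c : ℝ, 0 ≤ c ∧ ∃ y ∈ δ, x = c • liftOne y := by
  constructor
  · rintro ⟨c, hc, y, hy, rfl⟩
    rcases (mem_bigDelta_iff hδ).mp hy with rfl | ⟨s, hs, _, z, hz, rfl⟩
    · left; simp
    · right; exact ⟨c * s, mul_nonneg hc hs, z, hz, by rw [smul_smul]⟩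
  · rintro (rfl | ⟨c, hc, y, hy, rfl⟩)
    · exact ⟨0, le_rfl, 0, (mem_bigDelta_iff hδ).mpr (Or.inl rfl), by simp⟩
    · exact ⟨c, hc, liftOne y, (mem_bigDelta_iff hδ).mpr
        (Or.inr ⟨1, zero_le_one, le_rfl, y, hy, (one_smul _ _).symm⟩), rfl⟩

theorem zero_mem_cone (hδ : Convex ℝ δ) : (0 : Fin (n + 1) → ℝ) ∈ cone δ :=
  (mem_cone_iff hδ).mpr (Or.inl rfl)

theorem add_mem_cone (hδ : Convex ℝ δ) {x y : Fin (n + 1) → ℝ} (hx : x ∈ cone δ)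
    (hy : y ∈ cone δ) : x + y ∈ cone δ := by
  rcases (mem_cone_iff hδ).mp hx with rfl | ⟨c, hc, z, hz, rfl⟩
  · rwa [zero_add]
  rcases (mem_cone_iff hδ).mp hy with rfl | ⟨c', hc', z', hz', rfl⟩
  · rwa [add_zero]
  obtain ⟨w, hw, e⟩ := exists_smul_liftOne_add hδ hc hc' hz hz'
  exact (mem_cone_iff hδ).mpr (Or.inr ⟨c + c', add_nonneg hc hc', w, hw, e⟩)

theorem smul_mem_cone {t : ℝ} (ht : 0 ≤ t) {x : Fin (n + 1) → ℝ} (hx : x ∈ cone δ) :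
    t • x ∈ cone δ := by
  obtain ⟨c, hc, y, hy, rfl⟩ := hx
  exact ⟨t * c, mul_nonneg ht hc, y, hy, by rw [smul_smul]⟩

theorem liftOne_mem_cone (hδ : Convex ℝ δ) {y : Fin n → ℝ} (hy : y ∈ δ) : liftOne y ∈ cone δ :=
  (mem_cone_iff hδ).mpr (Or.inr ⟨1, zero_le_one, y, hy, (one_smul _ _).symm⟩)

theorem mem_smul_bigDelta_iff (hδ : Convex ℝ δ) {t : ℝ} (ht : 0 < t) {x : Fin (n + 1) → ℝ} :
    x ∈ t • bigDelta δ ↔ x ∈ cone δ ∧ x 0 ≤ t := by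
  rw [Set.mem_smul_set]
  constructor
  · rintro ⟨y, hy, rfl⟩
    refine ⟨⟨t, ht.le, y, hy, rfl⟩, ?_⟩
    rcases (mem_bigDelta_iff hδ).mp hy with rfl | ⟨s, hs, hs1, z, hz, rfl⟩
    · simpa using ht.le
    · simp only [Pi.smul_apply, smul_eq_mul, liftOne_zero, mul_one]
      nlinarith
  · rintro ⟨hx, hxt⟩
    rcases (mem_cone_iff hδ).mp hx with rfl | ⟨c, hc, y, hy, rfl⟩
    · exact ⟨0, (mem_bigDelta_iff hδ).mpr (Or.inl rfl), smul_zero _⟩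
    · simp only [Pi.smul_apply, smul_eq_mul, liftOne_zero, mul_one] at hxt
      refine ⟨(c / t) • liftOne y, (mem_bigDelta_iff hδ).mpr
        (Or.inr ⟨c / t, div_nonneg hc ht.le, (div_le_one ht).mpr hxt, y, hy, rfl⟩), ?_⟩
      rw [smul_smul, mul_div_cancel₀ _ ht.ne']

variable {d : ℕ}

theorem bounds_of_mem_bigSimplex {y : Fin n → ℝ} (hy : y ∈ bigSimplex n d) (i : Fin n) :
    0 ≤ y i ∧ y i ≤ d := by
  have h : y ∈ Set.Icc (0 : Fin n → ℝ) (fun _ => (d : ℝ)) := by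
    refine convexHull_min ?_ (convex_Icc _ _) hy
    rintro z (rfl | ⟨i, rfl⟩)
    · exact ⟨le_rfl, fun _ => Nat.cast_nonneg d⟩
    · refine ⟨fun j => ?_, fun j => ?_⟩
      · by_cases h : j = i
        · subst h; simp
        · simp [h]
      · by_cases h : j = i
        · subst h; simp
        · simp [h]
  exact ⟨h.1 i, h.2 i⟩

/-- The factor `d + 1` in place of `d` also covers the coordinate `x₀` itself. Bounding every
coordinate by `x₀` makes the set of small exponents finite, and nonnegativity makes the integer
points of the cone exponents. -/
theorem bounds_of_mem_cone (hδ : Convex ℝ δ) (hδ₂ : δ ⊆ bigSimplex n d) {x : Fin (n + 1) → ℝ}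
    (hx : x ∈ cone δ) (i : Fin (n + 1)) : 0 ≤ x i ∧ x i ≤ (d + 1) * x 0 := by
  rcases (mem_cone_iff hδ).mp hx with rfl | ⟨c, hc, y, hy, rfl⟩
  · simp
  · have hd : (0 : ℝ) ≤ d := Nat.cast_nonneg d
    refine Fin.cases ?_ (fun j => ?_) i
    · simp only [Pi.smul_apply, smul_eq_mul, liftOne_zero, mul_one]
      exact ⟨hc, by nlinarith⟩
    · obtain ⟨h1, h2⟩ := bounds_of_mem_bigSimplex (hδ₂ hy) j
      simp only [Pi.smul_apply, smul_eq_mul, liftOne_zero, mul_one]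
      have e : liftOne y j.succ = y j := rfl
      rw [e]
      exact ⟨mul_nonneg hc h1, by nlinarith⟩

/-- The real vector of an exponent. -/
def realVec (u : Fin (n + 1) →₀ ℕ) : Fin (n + 1) → ℝ := fun i => (u i : ℝ)

theorem le_of_realVec_mem_cone (hδ : Convex ℝ δ) (hδ₂ : δ ⊆ bigSimplex n d)
    {u : Fin (n + 1) →₀ ℕ} (hu : realVec u ∈ cone δ) (i : Fin (n + 1)) :
    u i ≤ (d + 1) * u 0 := by
  have := (bounds_of_mem_cone hδ hδ₂ hu i).2
  simp only [realVec] at this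
  exact_mod_cast this

variable (p N : ℕ) [hp : Fact p.Prime]

theorem natCast_lt_threshold_iff (k : ℕ) :
    (k : ℝ) < ((p : ℝ) / ((p : ℝ) - 1)) ^ 2 * (N : ℝ) ↔ k * (p - 1) ^ 2 < p ^ 2 * N := by
  have h1 : (0 : ℝ) < (p : ℝ) - 1 := sub_pos.mpr (by exact_mod_cast hp.out.one_lt)
  have h2 : ((p - 1 : ℕ) : ℝ) = (p : ℝ) - 1 := by
    rw [Nat.cast_sub hp.out.one_lt.le, Nat.cast_one]
  rw [div_pow, div_mul_eq_mul_div, lt_div_iff₀ (pow_pos h1 2), ← h2]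
  exact_mod_cast Iff.rfl

variable {p N}

theorem weight_lt_iff {u : Fin (n + 1) →₀ ℕ} (hu : realVec u ∈ cone δ) :
    weight δ (fun i => (u i : ℝ)) <
      ((((p : ℝ) / ((p : ℝ) - 1)) ^ 2 * (N : ℝ) : ℝ) : WithTop ℝ) ↔
      u 0 * (p - 1) ^ 2 < p ^ 2 * N := by
  have hu' : (fun i => (u i : ℝ)) ∈ cone δ := hu
  rw [weight, if_pos hu', WithTop.coe_lt_coe, natCast_lt_threshold_iff]

theorem smallPt_weight (u : SmallPt p N δ) : u.1.1 0 * (p - 1) ^ 2 < p ^ 2 * N :=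
  (weight_lt_iff u.1.2).mp u.2

theorem smallPt_le (hδ : Convex ℝ δ) (hδ₂ : δ ⊆ bigSimplex n d) (u : SmallPt p N δ)
    (i : Fin (n + 1)) : u.1.1 i ≤ (d + 1) * (p ^ 2 * N) := by
  refine (le_of_realVec_mem_cone hδ hδ₂ u.1.2 i).trans (Nat.mul_le_mul_left _ ?_)
  have h1 := smallPt_weight u
  have h2 : 1 ≤ (p - 1) ^ 2 := Nat.one_le_pow _ _ (Nat.sub_pos_of_lt hp.out.one_lt)
  have h3 : u.1.1 0 * 1 ≤ u.1.1 0 * (p - 1) ^ 2 := Nat.mul_le_mul_left _ h2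
  omega

theorem finite_smallPt (hδ : Convex ℝ δ) (hδ₂ : δ ⊆ bigSimplex n d) : Finite (SmallPt p N δ) := by
  set T : Fin (n + 1) →₀ ℕ :=
    Finsupp.equivFunOnFinite.symm fun _ => (d + 1) * (p ^ 2 * N) with hT
  refine Finite.of_injective (β := Finset.Iic T)
    (fun u => ⟨u.1.1, Finset.mem_Iic.mpr fun i => smallPt_le hδ hδ₂ u i⟩) ?_
  intro u v h
  have h2 : u.1.1 = v.1.1 := by simpa using h
  exact Subtype.ext (Subtype.ext h2)

theorem card_smallPt (hδ : Convex ℝ δ) (hδ₂ : δ ⊆ bigSimplex n d) (hN : 0 < N) :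
    Nat.card (SmallPt p N δ) = latticeCount
      (((⌈(p : ℝ) ^ 2 * (N : ℝ) / ((p : ℝ) - 1) ^ 2⌉ - 1 : ℤ) : ℝ) • bigDelta δ) := by
  have h1 : (0 : ℝ) < (p : ℝ) - 1 := sub_pos.mpr (by exact_mod_cast hp.out.one_lt)
  have e : (p : ℝ) ^ 2 * (N : ℝ) / ((p : ℝ) - 1) ^ 2 = ((p : ℝ) / ((p : ℝ) - 1)) ^ 2 * (N : ℝ) := by
    rw [div_pow, div_mul_eq_mul_div]
  rw [e]
  set c := ((p : ℝ) / ((p : ℝ) - 1)) ^ 2 * (N : ℝ) with hc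
  -- This makes `t = ⌈c⌉ - 1` positive, as required to rescale by `t`.
  have hc1 : (1 : ℝ) < c := by
    have := (natCast_lt_threshold_iff p N 1).mpr (by
      have h3 : (p - 1) ^ 2 < p ^ 2 :=
        Nat.pow_lt_pow_left (Nat.sub_lt hp.out.pos one_pos) two_ne_zero
      have h4 : p ^ 2 * 1 ≤ p ^ 2 * N := Nat.mul_le_mul_left _ hN
      omega)
    simpa using this
  have ht : (0 : ℝ) < ((⌈c⌉ - 1 : ℤ) : ℝ) := by
    have : (1 : ℤ) < ⌈c⌉ := Int.lt_ceil.mpr (by exact_mod_cast hc1)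
    exact_mod_cast (by omega : (0 : ℤ) < ⌈c⌉ - 1)
  -- An integer is strictly below `c` exactly when it is at most `⌈c⌉ - 1`; this accounts for the `-
  -- 1` in `t`.
  have hle : ∀ k : ℤ, (k : ℝ) ≤ ((⌈c⌉ - 1 : ℤ) : ℝ) ↔ (k : ℝ) < c := fun k => by
    rw [Int.cast_le, Int.le_sub_one_iff, Int.lt_ceil]
  rw [latticeCount, ← Nat.card_coe_set_eq]
  refine Nat.card_eq_of_bijective (fun u : SmallPt p N δ =>
    (⟨fun i => (u.1.1 i : ℤ), ?_⟩ : {u : Fin (n + 1) → ℤ |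
      (fun i => (u i : ℝ)) ∈ ((⌈c⌉ - 1 : ℤ) : ℝ) • bigDelta δ})) ⟨?_, ?_⟩
  · rw [Set.mem_ofPred_eq, mem_smul_bigDelta_iff hδ ht]
    have e2 : (fun i => (((u.1.1 i : ℕ) : ℤ) : ℝ)) = realVec u.1.1 := by
      funext i; simp [realVec]
    rw [e2]
    refine ⟨u.1.2, ?_⟩
    have := (hle (u.1.1 0)).mpr (by
      rw [Int.cast_natCast]
      exact (natCast_lt_threshold_iff p N _).mpr (smallPt_weight u))
    simpa [realVec] using this
  · intro u v h
    have h2 := congrArg Subtype.val h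
    refine Subtype.ext (Subtype.ext (Finsupp.ext fun i => ?_))
    have h3 : ((u.1.1 i : ℕ) : ℤ) = ((v.1.1 i : ℕ) : ℤ) := congrFun h2 i
    exact_mod_cast h3
  · rintro ⟨u, hu⟩
    rw [Set.mem_ofPred_eq, mem_smul_bigDelta_iff hδ ht] at hu
    have hnn : ∀ i, 0 ≤ u i := fun i => by
      have := (bounds_of_mem_cone hδ hδ₂ hu.1 i).1
      exact_mod_cast this
    set v : Fin (n + 1) →₀ ℕ := Finsupp.equivFunOnFinite.symm fun i => (u i).toNat with hv
    have hvu : ∀ i, ((v i : ℕ) : ℤ) = u i := fun i => by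
      rw [hv]; simp [hnn i]
    have hvr : (fun i => (u i : ℝ)) = realVec v := by
      funext i; rw [← hvu i]; simp [realVec]
    have hcone : realVec v ∈ cone δ := hvr ▸ hu.1
    refine ⟨⟨⟨v, hcone⟩, (weight_lt_iff hcone).mpr ?_⟩, Subtype.ext (funext hvu)⟩
    rw [← natCast_lt_threshold_iff p N, ← hc]
    have := (hle (u 0)).mp hu.2
    rw [← hvu 0] at this
    exact_mod_cast this

end Cone

/-! ### Support and divisibility of the coefficients of `F` -/

section Support

variable {n : ℕ} {F : Type*} [Field F]

theorem exists_of_mem_support_homog {f : MvPolynomial (Fin n) F} {j : Fin (n + 1) →₀ ℕ}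
    (hj : j ∈ (homog f).support) :
    j 0 = 1 ∧ ∃ j' ∈ f.support, realVec j = liftOne (fun i => (j' i : ℝ)) := by
  rw [homog, MvPolynomial.support_X_mul, Finset.mem_map] at hj
  obtain ⟨r, hr, rfl⟩ := hj
  rw [MvPolynomial.support_rename_of_injective (Fin.succ_injective n), Finset.mem_image] at hr
  obtain ⟨j', hj', rfl⟩ := hr
  have h0 : Finsupp.mapDomain Fin.succ j' 0 = 0 :=
    Finsupp.mapDomain_of_notMem_range _ _ (by rintro ⟨i, hi⟩; exact Fin.succ_ne_zero i hi)
  have h1 : ∀ i : Fin n, Finsupp.mapDomain Fin.succ j' i.succ = j' i := fun i =>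
    Finsupp.mapDomain_apply (Fin.succ_injective n) _ _
  refine ⟨by simp [h0], j', hj', ?_⟩
  ext i
  refine Fin.cases ?_ (fun i => ?_) i
  · simp [realVec, liftOne, h0]
  · simp [realVec, liftOne, h1]

theorem realVec_mem_cone_of_mem_support {f : MvPolynomial (Fin n) F} {δ : Set (Fin n → ℝ)}
    (hδ : Convex ℝ δ) (hδ₁ : newtonPolytope f ⊆ δ) {j : Fin (n + 1) →₀ ℕ}
    (hj : j ∈ (homog f).support) : realVec j ∈ cone δ := by
  obtain ⟨_, j', hj', e⟩ := exists_of_mem_support_homog hj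
  rw [e]
  exact liftOne_mem_cone hδ (hδ₁ (subset_convexHull ℝ _ ⟨j', hj', rfl⟩))

/-- As `j` has `X₀`-degree `1`, the power of the monomial that meets the exponent `r` can only be
the one of index `r 0`. -/
theorem coeff_subst_monomial {R : Type*} [CommRing R] {j : Fin (n + 1) →₀ ℕ} (hj : j 0 = 1) (a : R)
    (g : PowerSeries R) (r : Fin (n + 1) →₀ ℕ) :
    MvPowerSeries.coeff r (g.subst (MvPowerSeries.monomial j a)) =
      if r = r 0 • j then PowerSeries.coeff (r 0) g * a ^ r 0 else 0 := by
  classical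
  have hj0 : j ≠ 0 := by rintro rfl; simp at hj
  rw [PowerSeries.coeff_subst (PowerSeries.HasSubst.monomial hj0 a), finsum_eq_single _ (r 0)]
  · rw [MvPowerSeries.monomial_pow, MvPowerSeries.coeff_monomial, smul_eq_mul]
    split_ifs <;> simp
  · intro d hd
    rw [MvPowerSeries.monomial_pow, MvPowerSeries.coeff_monomial, if_neg, smul_zero]
    intro h
    apply hd
    rw [h, Finsupp.smul_apply, hj, smul_eq_mul, mul_one]

variable (p : ℕ) [hp : Fact p.Prime] [CharP F p] [Finite F]

theorem sq_pos_of_prime : 0 < p ^ 2 := pow_pos hp.out.pos 2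

/-- A factor `θ(a_j X^j)` involves only the exponents `ij`, which lie on a ray of the cone and have
`X₀`-degree `i`, so the bound for `θ_i` becomes one in terms of `r 0`. Both properties are additive
in the exponent and survive products. -/
theorem coeff_dworkF_mem {f : MvPolynomial (Fin n) F} {δ : Set (Fin n → ℝ)}
    (hδ : Convex ℝ δ) (hδ₁ : newtonPolytope f ⊆ δ) (r : Fin (n + 1) →₀ ℕ) :
    MvPowerSeries.coeff r (dworkF p f) ∈
      weightIdeal (piElt p F) (sq_pos_of_prime p) (r 0 * ((p : ℤ) - 1) ^ 2) ∧
    (MvPowerSeries.coeff r (dworkF p f) ≠ 0 → realVec r ∈ cone δ) := by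
  classical
  rw [dworkF]
  have hp1 : ((p - 1 : ℕ) : ℤ) = (p : ℤ) - 1 := by rw [Nat.cast_sub hp.out.one_lt.le, Nat.cast_one]
  suffices h : ∀ s ⊆ (homog f).support, ∀ r : Fin (n + 1) →₀ ℕ,
      MvPowerSeries.coeff r (∏ j ∈ s, PowerSeries.subst
        (MvPowerSeries.monomial j (teich p F ((homog f).coeff j))) (theta p F)) ∈
        weightIdeal (piElt p F) (sq_pos_of_prime p) (r 0 * ((p : ℤ) - 1) ^ 2) ∧
      (MvPowerSeries.coeff r (∏ j ∈ s, PowerSeries.subst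
        (MvPowerSeries.monomial j (teich p F ((homog f).coeff j))) (theta p F)) ≠ 0 →
        realVec r ∈ cone δ) from h _ subset_rfl r
  intro s
  induction s using Finset.induction_on with
  | empty =>
    intro _ r
    rw [Finset.prod_empty, MvPowerSeries.coeff_one]
    split_ifs with h
    · subst h
      refine ⟨one_mem_weightIdeal (by simp), fun _ => ?_⟩
      convert zero_mem_cone hδ using 1
      ext i; simp [realVec]
    · exact ⟨Ideal.zero_mem _, fun h => absurd rfl h⟩
  | insert j s hj ih =>
    intro hs r
    have hjs := hs (Finset.mem_insert_self j s)
    have ih' := ih ((Finset.subset_insert j s).trans hs)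
    have hj0 := (exists_of_mem_support_homog hjs).1
    have hfac : ∀ r : Fin (n + 1) →₀ ℕ, MvPowerSeries.coeff r (PowerSeries.subst
        (MvPowerSeries.monomial j (teich p F ((homog f).coeff j))) (theta p F)) ∈
        weightIdeal (piElt p F) (sq_pos_of_prime p) (r 0 * ((p : ℤ) - 1) ^ 2) ∧
        (MvPowerSeries.coeff r (PowerSeries.subst
        (MvPowerSeries.monomial j (teich p F ((homog f).coeff j))) (theta p F)) ≠ 0 →
        realVec r ∈ cone δ) := by
      intro r
      rw [coeff_subst_monomial hj0]
      split_ifs with h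
      · refine ⟨Ideal.mul_mem_right _ _ ?_, fun _ => ?_⟩
        · obtain ⟨e, he, hd⟩ := exists_pow_dvd_coeff_theta p F (r 0)
          refine ⟨e, ?_, hd⟩
          rw [← hp1]
          exact_mod_cast he
        · have e : realVec r = (r 0 : ℝ) • realVec j := by
            ext i
            have := DFunLike.congr_fun h i
            rw [Finsupp.smul_apply, smul_eq_mul] at this
            simp only [realVec, Pi.smul_apply, smul_eq_mul]
            exact_mod_cast this
          rw [e]
          exact smul_mem_cone (Nat.cast_nonneg _) (realVec_mem_cone_of_mem_support hδ hδ₁ hjs)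
      · exact ⟨Ideal.zero_mem _, fun h => absurd rfl h⟩
    rw [Finset.prod_insert hj, MvPowerSeries.coeff_mul]
    constructor
    · refine Ideal.sum_mem _ fun x hx => ?_
      have hx' : r 0 = x.1 0 + x.2 0 := by
        rw [← Finset.HasAntidiagonal.mem_antidiagonal.mp hx]; rfl
      have := mul_mem_weightIdeal (hfac x.1).1 (ih' x.2).1
      rw [hx']
      push_cast
      rwa [add_mul]
    · intro hne
      obtain ⟨x, hx, hx0⟩ := Finset.exists_ne_zero_of_sum_ne_zero hne
      have e : realVec r = realVec x.1 + realVec x.2 := by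
        rw [← Finset.HasAntidiagonal.mem_antidiagonal.mp hx]
        ext i; simp [realVec]
      rw [e]
      exact add_mem_cone hδ ((hfac x.1).2 (left_ne_zero_of_mul hx0))
        ((ih' x.2).2 (right_ne_zero_of_mul hx0))

end Support

end DworkTrace
end

noncomputable section
set_option linter.unusedSectionVars false
namespace DworkTrace

/-! ### Functoriality of `R` and the automorphism `τ` -/

section BaseChange

variable (p : ℕ) [hp : Fact p.Prime] (F E : Type*) [Field F] [CharP F p] [Finite F]
  [Field E] [CharP E p] [Finite E]

variable {F E} in
theorem map_piDiv_of_map_piElt (h : DRing p F →+* DRing p E) (hπ : h (piElt p F) = piElt p E)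
    (d : ℕ) : h (piDiv p F d) = piDiv p E d :=
  eq_piDiv p E d _ (by rw [← map_natCast h, ← map_mul, factorial_mul_piDiv, map_pow, hπ])

variable {F E} in
-- The coefficients of `θ` are built from the quotients `π^d/d!`, which are unique and so are
-- preserved by every homomorphism fixing `π`. Thus `τ` and base change act on `F` only through the
-- Teichmüller coefficients.
theorem map_coeff_theta (h : DRing p F →+* DRing p E) (hπ : h (piElt p F) = piElt p E) (i : ℕ) :
    h (PowerSeries.coeff i (theta p F)) = PowerSeries.coeff i (theta p E) := by
  have h0 : PowerSeries.constantCoeff (PowerSeries.X - PowerSeries.X ^ p :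
      PowerSeries (DRing p F)) = 0 := by simp [hp.out.ne_zero]
  have h1 : PowerSeries.map h (expPi p F) = expPi p E := by
    ext d
    rw [PowerSeries.coeff_map, expPi, expPi, PowerSeries.coeff_mk, PowerSeries.coeff_mk,
      map_piDiv_of_map_piElt p h hπ]
  have h2 := PowerSeries.map_subst (PowerSeries.HasSubst.of_constantCoeff_zero' h0) (h := h)
    (expPi p F)
  have e : MvPowerSeries.map h (PowerSeries.X - PowerSeries.X ^ p : PowerSeries (DRing p F)) =
      (PowerSeries.X - PowerSeries.X ^ p : PowerSeries (DRing p E)) := by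
    change PowerSeries.map h (PowerSeries.X - PowerSeries.X ^ p : PowerSeries (DRing p F)) = _
    simp
  rw [e, h1] at h2
  rw [← PowerSeries.coeff_map]
  exact congrArg (PowerSeries.coeff i) h2

theorem tau_piElt : tau p F (piElt p F) = piElt p F := by
  rw [tau, piElt, AdjoinRoot.coe_mapRingEquiv, AdjoinRoot.map_root]

theorem tau_of (w : WittVector p F) : tau p F (AdjoinRoot.of (piPoly p F) w) =
    AdjoinRoot.of (piPoly p F) (WittVector.frobenius w) := by
  rw [tau, AdjoinRoot.coe_mapRingEquiv, AdjoinRoot.map_of]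
  rfl

/-- The iterate `τ ^ i` as a ring homomorphism. -/
def tauPow (i : ℕ) : DRing p F →+* DRing p F := (tau p F : DRing p F →+* DRing p F) ^ i

theorem tauPow_apply (i : ℕ) (x : DRing p F) : tauPow p F i x = (tau p F)^[i] x := by
  rw [tauPow, RingHom.coe_pow]; rfl

theorem tauPow_succ (i : ℕ) (x : DRing p F) : tauPow p F (i + 1) x = tau p F (tauPow p F i x) := by
  rw [tauPow_apply, tauPow_apply, Function.iterate_succ_apply']

theorem tauPow_piElt (i : ℕ) : tauPow p F i (piElt p F) = piElt p F := by
  induction i with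
  | zero => rfl
  | succ i ih => rw [tauPow_succ, ih, tau_piElt]

theorem tauPow_of (i : ℕ) (w : WittVector p F) : tauPow p F i (AdjoinRoot.of (piPoly p F) w) =
    AdjoinRoot.of (piPoly p F) (WittVector.frobenius^[i] w) := by
  induction i with
  | zero => rfl
  | succ i ih => rw [tauPow_succ, ih, tau_of, Function.iterate_succ_apply']

theorem tauPow_teich (i : ℕ) (x : F) : tauPow p F i (teich p F x) = teich p F (x ^ p ^ i) := by
  rw [teich, tauPow_of, teich]
  congr 1
  ext k
  rw [WittVector.iterate_frobenius_coeff]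
  rcases Nat.eq_zero_or_pos k with rfl | hk
  · rw [WittVector.teichmuller_coeff_zero, WittVector.teichmuller_coeff_zero]
  · rw [WittVector.teichmuller_coeff_pos _ _ _ hk, WittVector.teichmuller_coeff_pos _ _ _ hk,
      zero_pow (pow_pos hp.out.pos i).ne']

variable {F} in
theorem tauPow_eq_id {a : ℕ} (ha : Nat.card F = p ^ a) : tauPow p F a = RingHom.id _ := by
  refine AdjoinRoot.ringHom_ext (RingHom.ext fun w => ?_) (tauPow_piElt p F a)
  rw [RingHom.comp_apply, tauPow_of, RingHom.comp_apply, RingHom.id_apply]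
  congr 1
  ext k
  rw [WittVector.iterate_frobenius_coeff, pow_card_eq p ha]

theorem tau_symm_iterate_eq {i : ℕ} {x y : DRing p F} (h : tauPow p F i y = x) :
    (tau p F).symm^[i] x = y := by
  rw [← h, tauPow_apply]
  exact (Function.LeftInverse.iterate (tau p F).symm_apply_apply i) y

theorem tauMod_symm_mk (N : ℕ) (x : DRing p F) :
    (tauMod p F N).symm (Ideal.Quotient.mk _ x) = Ideal.Quotient.mk _ ((tau p F).symm x) := by
  rw [RingEquiv.symm_apply_eq, tauMod, Ideal.quotientEquiv_mk, RingEquiv.apply_symm_apply]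

theorem tauMod_symm_iterate_mk (N i : ℕ) (x : DRing p F) :
    (tauMod p F N).symm^[i] (Ideal.Quotient.mk _ x) =
      Ideal.Quotient.mk _ ((tau p F).symm^[i] x) := by
  induction i with
  | zero => rfl
  | succ i ih => rw [Function.iterate_succ_apply', ih, tauMod_symm_mk, Function.iterate_succ_apply']

theorem tauMod_symm_iterate_add {a : ℕ} (ha : Nat.card F = p ^ a) (N i : ℕ)
    (x : DRingMod p F N) : (tauMod p F N).symm^[i + a] x = (tauMod p F N).symm^[i] x := by
  obtain ⟨x, rfl⟩ := Ideal.Quotient.mk_surjective x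
  rw [Function.iterate_add_apply, tauMod_symm_iterate_mk p F N a,
    tau_symm_iterate_eq p F (x := x) (y := x) (by rw [tauPow_eq_id p ha]; rfl)]

/-! ### Extension of the residue field -/

variable [Algebra F E]

theorem eval₂_piPoly : (piPoly p F).eval₂ ((AdjoinRoot.of (piPoly p E)).comp
    (WittVector.map (algebraMap F E))) (piElt p E) = 0 := by
  have h : piPoly p F = Polynomial.X ^ (p - 1) + Polynomial.C (p : WittVector p F) := rfl
  rw [h, Polynomial.eval₂_add, Polynomial.eval₂_pow, Polynomial.eval₂_X,
    Polynomial.eval₂_C, piElt_pow, map_natCast, neg_add_cancel]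

/-- The homomorphism of rings `R` induced by an extension of finite fields. -/
def extHom : DRing p F →+* DRing p E :=
  AdjoinRoot.lift ((AdjoinRoot.of (piPoly p E)).comp (WittVector.map (algebraMap F E)))
    (piElt p E) (eval₂_piPoly p F E)

theorem extHom_piElt : extHom p F E (piElt p F) = piElt p E :=
  AdjoinRoot.lift_root (eval₂_piPoly p F E)

theorem extHom_teich (x : F) : extHom p F E (teich p F x) = teich p E (algebraMap F E x) := by
  rw [teich, extHom, AdjoinRoot.lift_of, RingHom.comp_apply, WittVector.map_teichmuller, teich]

theorem extHom_mk (g : Polynomial (WittVector p F)) :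
    extHom p F E (AdjoinRoot.mk (piPoly p F) g) =
      AdjoinRoot.mk (piPoly p E) (g.map (WittVector.map (algebraMap F E))) := by
  rw [extHom, AdjoinRoot.lift_mk, ← Polynomial.eval₂_map, piElt, ← AdjoinRoot.aeval_eq]
  rfl

theorem exists_mk_eq (x : DRing p F) :
    ∃ g : Polynomial (WittVector p F), g.degree < (piPoly p F).degree ∧
      AdjoinRoot.mk (piPoly p F) g = x := by
  obtain ⟨g, rfl⟩ := AdjoinRoot.mk_surjective x
  refine ⟨g %ₘ piPoly p F, Polynomial.degree_modByMonic_lt _ (piPoly_monic p F), ?_⟩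
  rw [AdjoinRoot.mk_eq_mk]
  refine ⟨-(g /ₘ piPoly p F), ?_⟩
  linear_combination Polynomial.modByMonic_add_div g (piPoly p F)

/-- Elements have representatives of degree below `p - 1` in `π`, so divisibility by `p^N` can be
tested on Witt vector coefficients. There it means that the first `N` Witt components vanish, which
is detected after a field extension. -/
theorem natCast_pow_dvd_of_extHom (N : ℕ) (x : DRing p F)
    (h : (p : DRing p E) ^ N ∣ extHom p F E x) : (p : DRing p F) ^ N ∣ x := by
  obtain ⟨g, hg, rfl⟩ := exists_mk_eq p F x
  obtain ⟨y, hy⟩ := h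
  obtain ⟨e, he, rfl⟩ := exists_mk_eq p E y
  rw [extHom_mk, ← map_natCast (AdjoinRoot.mk (piPoly p E)), ← map_pow, ← map_mul,
    AdjoinRoot.mk_eq_mk] at hy
  have hdeg : (piPoly p F).degree = (piPoly p E).degree := by
    rw [Polynomial.degree_eq_natDegree (piPoly_monic p F).ne_zero,
      Polynomial.degree_eq_natDegree (piPoly_monic p E).ne_zero, natDegree_piPoly,
      natDegree_piPoly]
  have hconst : ((p : Polynomial (WittVector p E)) ^ N) = Polynomial.C ((p : WittVector p E) ^ N) :=
    by rw [map_pow, map_natCast]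
  have h1 : (g.map (WittVector.map (algebraMap F E)) -
      (p : Polynomial (WittVector p E)) ^ N * e).degree < (piPoly p E).degree := by
    refine lt_of_le_of_lt (Polynomial.degree_sub_le _ _) (max_lt ?_ ?_)
    · exact lt_of_le_of_lt Polynomial.degree_map_le (hdeg ▸ hg)
    · rw [hconst]
      refine lt_of_le_of_lt (Polynomial.degree_mul_le _ _) ?_
      refine lt_of_le_of_lt (add_le_add_left Polynomial.degree_C_le _) ?_
      rwa [zero_add]
  have h2 := Polynomial.eq_zero_of_dvd_of_degree_lt hy h1
  have h3 : Polynomial.C ((p : WittVector p F) ^ N) ∣ g := by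
    rw [Polynomial.C_dvd_iff_dvd_coeff]
    intro i
    have h4 := congrArg (fun q => q.coeff i) (sub_eq_zero.mp h2)
    simp only [hconst, Polynomial.coeff_map, Polynomial.coeff_C_mul] at h4
    rw [← Ideal.mem_span_singleton, WittVector.mem_span_p_pow_iff_le_coeff_eq_zero]
    intro k hk
    have h5 : WittVector.map (algebraMap F E) (g.coeff i) ∈
        Ideal.span {(p : WittVector p E) ^ N} :=
      Ideal.mem_span_singleton.mpr ⟨_, h4⟩
    rw [WittVector.mem_span_p_pow_iff_le_coeff_eq_zero] at h5
    have h6 := h5 k hk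
    rw [WittVector.map_coeff] at h6
    exact (map_eq_zero _).mp h6
  have h7 := map_dvd (AdjoinRoot.mk (piPoly p F)) h3
  rwa [map_pow, map_natCast, map_pow, map_natCast] at h7

/-- The homomorphism `R / (p ^ N) → R_E / (p ^ N)`. -/
def extMod (N : ℕ) : DRingMod p F N →+* DRingMod p E N :=
  Ideal.quotientMap _ (extHom p F E) (by
    rw [Ideal.span_singleton_le_iff_mem, Ideal.mem_comap, map_pow, map_natCast]
    exact Ideal.mem_span_singleton_self _)

theorem extMod_mk (N : ℕ) (x : DRing p F) :
    extMod p F E N (Ideal.Quotient.mk _ x) = Ideal.Quotient.mk _ (extHom p F E x) :=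
  Ideal.quotientMap_mk

theorem extMod_injective (N : ℕ) : Function.Injective (extMod p F E N) := by
  rw [injective_iff_map_eq_zero]
  intro x hx
  obtain ⟨x, rfl⟩ := Ideal.Quotient.mk_surjective x
  rw [extMod_mk, Ideal.Quotient.eq_zero_iff_mem, Ideal.mem_span_singleton] at hx
  rw [Ideal.Quotient.eq_zero_iff_mem, Ideal.mem_span_singleton]
  exact natCast_pow_dvd_of_extHom p F E N x hx

end BaseChange

/-! ### Teichmüller points -/

section Points

variable (p : ℕ) [hp : Fact p.Prime] (E : Type*) [Field E] [CharP E p] [Finite E]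

/-- The Teichmüller lift modulo `p ^ N`, on units. -/
def teichUnits (N : ℕ) : Eˣ →* DRingMod p E N :=
  ((Ideal.Quotient.mk (Ideal.span {(p : DRing p E) ^ N}) : DRing p E →* DRingMod p E N).comp
    (teichHom p E)).comp (Units.coeHom E)

theorem teichUnits_apply (N : ℕ) (x : Eˣ) :
    teichUnits p E N x = Ideal.Quotient.mk _ (teich p E x) := rfl

theorem teich_injective : Function.Injective (teich p E) := fun x y h => by
  have h1 := of_injective p E h
  have h2 := congrArg (fun w => WittVector.coeff w 0) h1
  simpa only [WittVector.teichmuller_coeff_zero] using h2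

/-- Orthogonality of characters is applied in the domain `R_E` and then reduced, since `R_E/(p^N)`
need not be a domain. -/
theorem sum_teichUnits_pow [Fintype Eˣ] {Q : ℕ} (hQ : Nat.card E = Q) (N r : ℕ) :
    ∑ x : Eˣ, teichUnits p E N x ^ r = if Q - 1 ∣ r then (Q : DRingMod p E N) - 1 else 0 := by
  have := Fintype.ofFinite E
  rw [Nat.card_eq_fintype_card] at hQ
  classical
  set χ : Eˣ →* DRing p E := ((teichHom p E).comp (Units.coeHom E)).comp (powMonoidHom r) with hχ
  have hχ1 : χ = 1 ↔ Q - 1 ∣ r := by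
    rw [← hQ, ← FiniteField.forall_pow_eq_one_iff E, MonoidHom.ext_iff]
    refine forall_congr' fun x => ?_
    have e : χ x = teich p E ((x ^ r : Eˣ) : E) := rfl
    rw [e, MonoidHom.one_apply, ← teich_one p (F := E), (teich_injective p E).eq_iff,
      Units.val_eq_one]
  have h1 := sum_hom_units χ
  have h2 : ∑ x : Eˣ, teichUnits p E N x ^ r =
      Ideal.Quotient.mk (Ideal.span {(p : DRing p E) ^ N}) (∑ x : Eˣ, χ x) := by
    rw [map_sum]
    refine Finset.sum_congr rfl fun x _ => ?_
    rw [← map_pow]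
    rfl
  have hQ1 : 1 ≤ Q := hQ ▸ Fintype.card_pos
  have h3 : Fintype.card Eˣ = Q - 1 := by
    rw [← hQ, ← Nat.card_eq_fintype_card, ← Nat.card_eq_fintype_card, Nat.card_units]
  rw [h2, h1, h3]
  simp only [hχ1]
  split_ifs
  · push_cast [hQ1]
    simp
  · simp

end Points

/-! ### The reduction of `F` modulo `p ^ N` as a polynomial -/

section DworkPoly

variable (p : ℕ) [hp : Fact p.Prime] {F : Type*} [Field F] [CharP F p] [Finite F] {n : ℕ}

/-- The product of the truncations of `θ(a_j X ^ j)` modulo `p ^ N`. -/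
def dworkPoly (f : MvPolynomial (Fin n) F) (M N : ℕ) :
    MvPolynomial (Fin (n + 1)) (DRingMod p F N) :=
  ∏ j ∈ (homog f).support, ∑ i ∈ Finset.range M, MvPolynomial.monomial (i • j)
    (Ideal.Quotient.mk _
      (PowerSeries.coeff i (theta p F) * teich p F ((homog f).coeff j) ^ i))

theorem coeff_dworkPoly (f : MvPolynomial (Fin n) F) {M N : ℕ}
    (hM : ∀ i, M ≤ i → (p : DRing p F) ^ N ∣ PowerSeries.coeff i (theta p F))
    (r : Fin (n + 1) →₀ ℕ) :
    MvPolynomial.coeff r (dworkPoly p f M N) =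
      Ideal.Quotient.mk _ (MvPowerSeries.coeff r (dworkF p f)) := by
  classical
  set φ := Ideal.Quotient.mk (Ideal.span {(p : DRing p F) ^ N}) with hφ
  have h : (dworkPoly p f M N : MvPowerSeries (Fin (n + 1)) (DRingMod p F N)) =
      MvPowerSeries.map φ (dworkF p f) := by
    rw [dworkPoly, dworkF, map_prod, ← MvPolynomial.coeToMvPowerSeries.ringHom_apply, map_prod]
    refine Finset.prod_congr rfl fun j hj => ?_
    have hj0 := (exists_of_mem_support_homog hj).1
    ext r
    rw [MvPolynomial.coeToMvPowerSeries.ringHom_apply, MvPolynomial.coeff_coe,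
      MvPowerSeries.coeff_map, coeff_subst_monomial hj0, MvPolynomial.coeff_sum]
    simp only [MvPolynomial.coeff_monomial]
    split_ifs with hr
    · by_cases hlt : r 0 < M
      · rw [Finset.sum_eq_single_of_mem (r 0) (Finset.mem_range.mpr hlt), if_pos hr.symm]
        intro i _ hi
        rw [if_neg]
        rintro rfl
        apply hi
        rw [Finsupp.smul_apply, hj0, smul_eq_mul, mul_one]
      · rw [Finset.sum_eq_zero]
        · symm
          rw [hφ, Ideal.Quotient.eq_zero_iff_mem, Ideal.mem_span_singleton]
          exact (hM _ (not_lt.mp hlt)).mul_right _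
        · intro i hi
          rw [if_neg]
          rintro rfl
          rw [Finsupp.smul_apply, hj0, smul_eq_mul, mul_one] at hlt
          exact hlt (Finset.mem_range.mp hi)
    · rw [map_zero]
      refine Finset.sum_eq_zero fun i _ => if_neg ?_
      rintro rfl
      apply hr
      rw [Finsupp.smul_apply, hj0, smul_eq_mul, mul_one]
  rw [← MvPolynomial.coeff_coe, h, MvPowerSeries.coeff_map]

/-- The homomorphism `τ ^ (-i)` of `R / (p ^ N)`. -/
def twist (F : Type*) [Field F] [CharP F p] [Finite F] (N i : ℕ) :
    DRingMod p F N →+* DRingMod p F N :=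
  ((tauMod p F N).symm : DRingMod p F N →+* DRingMod p F N) ^ i

theorem twist_apply (N i : ℕ) (x : DRingMod p F N) :
    twist p F N i x = (tauMod p F N).symm^[i] x := by
  rw [twist, RingHom.coe_pow]; rfl

/-- `τ^(-i)` replaces the Teichmüller lift of `c` by that of its `p^i`-th root, which is `c^(p^l)`
when `l + i = m` and `c^(p^m) = c`. -/
theorem twist_mk (N : ℕ) {i l m : ℕ} (hm : ∀ c : F, c ^ p ^ m = c) (hil : l + i = m) (k : ℕ)
    (c : F) : twist p F N i (Ideal.Quotient.mk _ (PowerSeries.coeff k (theta p F) *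
      teich p F c ^ k)) = Ideal.Quotient.mk _ (PowerSeries.coeff k (theta p F) *
      teich p F (c ^ p ^ l) ^ k) := by
  rw [twist_apply, tauMod_symm_iterate_mk]
  congr 1
  apply tau_symm_iterate_eq
  rw [map_mul, map_pow, map_coeff_theta p _ (tauPow_piElt p F i), tauPow_teich, ← pow_mul,
    ← pow_add, hil, hm]

variable (E : Type*) [Field E] [CharP E p] [Finite E] [Algebra F E]

/-- The value of the monomial `X ^ j` of `X₀ f`, with its coefficient, at the point `x`. -/
def termValue (f : MvPolynomial (Fin n) F) (x : Fin (n + 1) → Eˣ) (j : Fin (n + 1) →₀ ℕ) : E :=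
  algebraMap F E ((homog f).coeff j) * ∏ v, (x v : E) ^ j v

theorem eval_expand_twist (f : MvPolynomial (Fin n) F) (M N : ℕ) {i l m : ℕ}
    (hm : ∀ c : F, c ^ p ^ m = c) (hil : l + i = m) (x : Fin (n + 1) → Eˣ) :
    MvPolynomial.eval (fun v => teichUnits p E N (x v))
      (MvPolynomial.map (extMod p F E N) (MvPolynomial.expand (p ^ l)
        (MvPolynomial.map (twist p F N i) (dworkPoly p f M N)))) =
    ∏ j ∈ (homog f).support, Ideal.Quotient.mk (Ideal.span {(p : DRing p E) ^ N})
      ((thetaPoly p E M).eval (teich p E (termValue E f x j) ^ p ^ l)) := by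
  rw [dworkPoly, map_prod, map_prod, map_prod, map_prod]
  refine Finset.prod_congr rfl fun j _ => ?_
  rw [map_sum, map_sum, map_sum, map_sum, eval_thetaPoly, map_sum]
  refine Finset.sum_congr rfl fun k _ => ?_
  rw [MvPolynomial.map_monomial, twist_mk p N hm hil, MvPolynomial.expand_monomial,
    MvPolynomial.map_monomial, extMod_mk, MvPolynomial.eval_monomial,
    Finsupp.prod_fintype _ _ (fun _ => pow_zero _), map_mul,
    map_coeff_theta p _ (extHom_piElt p F E), map_pow, extHom_teich, map_mul, map_mul, mul_assoc]
  congr 1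
  have h1 : ∀ v, teichUnits p E N (x v) ^ (p ^ l • k • j) v =
      Ideal.Quotient.mk (Ideal.span {(p : DRing p E) ^ N})
        (teich p E ((((x v : E) ^ j v) ^ p ^ l) ^ k)) := fun v => by
    rw [teichUnits_apply, ← map_pow, ← teich_pow, Finsupp.smul_apply, Finsupp.smul_apply,
      smul_eq_mul, smul_eq_mul, ← pow_mul, ← pow_mul]
    congr 3
    ring
  have h2 : ∏ v, teichUnits p E N (x v) ^ (p ^ l • k • j) v =
      Ideal.Quotient.mk (Ideal.span {(p : DRing p E) ^ N})
        (teich p E (((∏ v, (x v : E) ^ j v) ^ p ^ l) ^ k)) := by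
    rw [Finset.prod_congr rfl fun v _ => h1 v, ← map_prod]
    congr 1
    have := map_prod (teichHom p E) (fun v => (((x v : E) ^ j v) ^ p ^ l) ^ k) Finset.univ
    rw [Finset.prod_pow, Finset.prod_pow] at this
    exact this.symm
  rw [h2, ← map_mul]
  congr 1
  rw [← teich_pow, ← teich_mul, ← teich_pow, ← teich_pow, termValue]
  congr 1
  rw [map_pow]
  ring

/-- The factor twisted by `τ^(-(i+1))` is expanded by `p^l` with `l = m - 1 - i`. Since `l + (i + 1)
= m`, coefficient and variables are raised to the same power `p^l`, and the factors assemble to `ψ`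
of each term. -/
theorem eval_expandProd_twist (f : MvPolynomial (Fin n) F) (M N : ℕ) {m : ℕ}
    (hm : ∀ c : F, c ^ p ^ m = c) (x : Fin (n + 1) → Eˣ) :
    MvPolynomial.eval (fun v => teichUnits p E N (x v))
      (MvPolynomial.map (extMod p F E N) (expandProd p m
        (fun i => MvPolynomial.map (twist p F N (i + 1)) (dworkPoly p f M N)))) =
    ∏ j ∈ (homog f).support, Ideal.Quotient.mk (Ideal.span {(p : DRing p E) ^ N})
      (thetaChar p E M m (termValue E f x j)) := by
  rw [expandProd, map_prod, map_prod, ← Finset.prod_range_reflect]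
  have h : ∀ l ∈ Finset.range m, MvPolynomial.eval (fun v => teichUnits p E N (x v))
      (MvPolynomial.map (extMod p F E N) (MvPolynomial.expand (p ^ (m - 1 - (m - 1 - l)))
        (MvPolynomial.map (twist p F N (m - 1 - l + 1)) (dworkPoly p f M N)))) =
      ∏ j ∈ (homog f).support, Ideal.Quotient.mk (Ideal.span {(p : DRing p E) ^ N})
      ((thetaPoly p E M).eval (teich p E (termValue E f x j) ^ p ^ l)) := fun l hl => by
    have hl' := Finset.mem_range.mp hl
    have e : m - 1 - (m - 1 - l) = l := by omega
    rw [e]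
    exact eval_expand_twist p E f M N hm (by omega) x
  rw [Finset.prod_congr rfl h, Finset.prod_comm]
  refine Finset.prod_congr rfl fun j _ => ?_
  rw [thetaChar, map_prod]

theorem sum_termValue (f : MvPolynomial (Fin n) F) (x : Fin (n + 1) → Eˣ) :
    ∑ j ∈ (homog f).support, termValue E f x j =
      (x 0 : E) * MvPolynomial.aeval (fun i => (x (Fin.succ i) : E)) f := by
  have h : MvPolynomial.aeval (fun i => (x i : E)) (homog f) =
      ∑ j ∈ (homog f).support, termValue E f x j := by
    rw [MvPolynomial.aeval_def, MvPolynomial.eval₂_eq']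
    rfl
  rw [← h, homog, map_mul, MvPolynomial.aeval_X, MvPolynomial.aeval_rename]
  rfl

/-- The sum of an additive character over the values of `x₀ f(x)` on a torus. -/
theorem sum_prod_character {B : Type*} [CommRing B] (ψ : E → B) (h0 : ψ 0 = 1)
    (hadd : ∀ x y, ψ (x + y) = ψ x * ψ y) [Fintype E] [Fintype Eˣ] (hsum : ∑ x, ψ x = 0)
    (f : MvPolynomial (Fin n) F) :
    ∑ x : Fin (n + 1) → Eˣ, ∏ j ∈ (homog f).support, ψ (termValue E f x j) =
      (Fintype.card E : B) * (torusCount f E : ℕ) - ((Fintype.card E : B) - 1) ^ n := by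
  classical
  have h1 : ∀ x : Fin (n + 1) → Eˣ, ∏ j ∈ (homog f).support, ψ (termValue E f x j) =
      ψ ((x 0 : E) * MvPolynomial.aeval (fun i => (x (Fin.succ i) : E)) f) := fun x => by
    rw [← sum_termValue]
    generalize (homog f).support = s
    induction s using Finset.induction_on with
    | empty => simp [h0]
    | insert j s hj ih => rw [Finset.prod_insert hj, Finset.sum_insert hj, hadd, ih]
  have h2 : ∑ z : Eˣ, ψ (z : E) = -1 := by
    have h3 : ∑ x : E, ψ x = ψ 0 + ∑ z : Eˣ, ψ (z : E) := by
      rw [Fintype.sum_eq_add_sum_compl 0]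
      congr 1
      symm
      refine Finset.sum_bij_ne_zero (fun z _ _ => (z : E)) ?_ ?_ ?_ ?_
      · intro z _ _; simp
      · intro a _ _ b _ _ h; exact Units.ext h
      · intro b hb hb0
        have hb' : b ≠ 0 := by simpa using hb
        exact ⟨Units.mk0 b hb', Finset.mem_univ _, hb0, rfl⟩
      · intro _ _ _; rfl
    rw [hsum, h0] at h3
    linear_combination -h3
  have hcard : (Fintype.card Eˣ : B) = (Fintype.card E : B) - 1 := by
    have h3 : Fintype.card Eˣ = Fintype.card E - 1 := by
      rw [← Nat.card_eq_fintype_card, ← Nat.card_eq_fintype_card, Nat.card_units]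
    rw [h3, Nat.cast_sub Fintype.card_pos, Nat.cast_one]
  -- For `y ≠ 0` multiplication by `y` permutes the units and the sum is `-1`; for `y = 0` every
  -- term is `1`.
  have h4 : ∀ y : E, ∑ z : Eˣ, ψ ((z : E) * y) = (if y = 0 then (Fintype.card E : B) else 0) - 1 :=
    fun y => by
    by_cases hy : y = 0
    · subst hy
      simp [h0, hcard]
    · rw [if_neg hy, zero_sub, ← h2]
      exact Fintype.sum_equiv (Equiv.mulRight (Units.mk0 y hy)) _ _ (fun z => by simp)
  rw [Finset.sum_congr rfl fun x _ => h1 x, ← (Fin.consEquiv fun _ : Fin (n + 1) => Eˣ).sum_comp,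
    Fintype.sum_prod_type, Finset.sum_comm]
  simp only [Fin.consEquiv_apply, Fin.cons_zero, Fin.cons_succ, h4]
  rw [Finset.sum_sub_distrib, ← Finset.sum_filter, Finset.sum_const, Finset.sum_const,
    Finset.card_univ, Fintype.card_pi_const, nsmul_eq_mul, nsmul_eq_mul, mul_one, Nat.cast_pow,
    hcard, mul_comm, torusCount, Nat.card_eq_fintype_card, Fintype.card_subtype]

end DworkPoly

end DworkTrace
end

noncomputable section
set_option linter.unusedSectionVars false
namespace DworkTrace

/-! ### The trace formula modulo `p ^ N` -/

section Main

variable (p : ℕ) [hp : Fact p.Prime] {F : Type*} [Field F] [CharP F p] [Finite F] {n : ℕ}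

theorem map_mem_weightIdeal {R S : Type*} [CommRing R] [CommRing S] (h : R →+* S) {ϖ : R} {s : ℕ}
    {hs : 0 < s} {c : ℤ} {x : R} (hx : x ∈ weightIdeal ϖ hs c) :
    h x ∈ weightIdeal (h ϖ) hs c := by
  obtain ⟨e, he, hd⟩ := hx
  exact ⟨e, he, by simpa using map_dvd h hd⟩

theorem mk_piElt_pow_eq_zero (N : ℕ) :
    Ideal.Quotient.mk (Ideal.span {(p : DRing p F) ^ N}) (piElt p F) ^ ((p - 1) * N) = 0 := by
  rw [← map_pow, Ideal.Quotient.eq_zero_iff_mem, Ideal.mem_span_singleton]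
  exact natCast_pow_dvd_of_le p F le_rfl dvd_rfl

theorem twist_mk_piElt (N i : ℕ) :
    twist p F N i (Ideal.Quotient.mk _ (piElt p F)) = Ideal.Quotient.mk _ (piElt p F) := by
  rw [twist_apply, tauMod_symm_iterate_mk, tau_symm_iterate_eq p F (tauPow_piElt p F i)]

/-- The truncated product and `F` have the same coefficients modulo `p ^ N`, up to `τ ^ (-i)`. -/
theorem coeff_twist_dworkPoly (f : MvPolynomial (Fin n) F) {M N : ℕ}
    (hM : ∀ i, M ≤ i → (p : DRing p F) ^ N ∣ PowerSeries.coeff i (theta p F)) (i : ℕ)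
    (r : Fin (n + 1) →₀ ℕ) :
    MvPolynomial.coeff r (MvPolynomial.map (twist p F N i) (dworkPoly p f M N)) =
      twist p F N i (Ideal.Quotient.mk _ (MvPowerSeries.coeff r (dworkF p f))) := by
  rw [MvPolynomial.coeff_map, coeff_dworkPoly p f hM]

/-- The shift to `i + 1` is the `τ⁻¹` already present in the entries of `M`. -/
theorem coeffMat_submatrix (f : MvPolynomial (Fin n) F) (δ : Set (Fin n → ℝ)) {M N : ℕ}
    (hM : ∀ i, M ≤ i → (p : DRing p F) ^ N ∣ PowerSeries.coeff i (theta p F))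
    {T : Fin (n + 1) →₀ ℕ} (hT : ∀ u : SmallPt p N δ, u.1.1 ∈ Finset.Iic T) (i : ℕ) :
    (coeffMat T p (MvPolynomial.map (twist p F N (i + 1)) (dworkPoly p f M N))).submatrix
      (fun u : SmallPt p N δ => (⟨u.1.1, hT u⟩ : Box T)) (fun u => ⟨u.1.1, hT u⟩) =
    (dworkA p f δ N).map ((tauMod p F N).symm)^[i] := by
  ext u v
  have e : dworkA p f δ N u v = Ideal.Quotient.mk _ ((tau p F).symm
      (if v.1.1 ≤ p • u.1.1 then
        MvPowerSeries.coeff (p • u.1.1 - v.1.1) (dworkF p f) else 0)) := rfl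
  rw [Matrix.submatrix_apply, Matrix.map_apply, e, coeffMat, coeff_twist_dworkPoly p f hM,
    twist_apply, Function.iterate_succ_apply, tauMod_symm_mk]
  split_ifs
  · rfl
  · rw [map_zero, map_zero]
    exact (iterate_map_zero (tauMod p F N).symm i).symm

theorem realVec_smul_sub {u v : Fin (n + 1) →₀ ℕ} (h : v ≤ p • u) :
    realVec (p • u - v) = (p : ℝ) • realVec u - realVec v := by
  ext i
  have := h i
  rw [Finsupp.smul_apply, smul_eq_mul] at this
  simp only [realVec, Finsupp.tsub_apply, Finsupp.smul_apply, smul_eq_mul, Pi.sub_apply,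
    Pi.smul_apply]
  rw [Nat.cast_sub this, Nat.cast_mul]

theorem coeffMat_mem_weightIdeal {f : MvPolynomial (Fin n) F} {δ : Set (Fin n → ℝ)}
    (hδ : Convex ℝ δ) (hδ₁ : newtonPolytope f ⊆ δ) {M N : ℕ}
    (hM : ∀ i, M ≤ i → (p : DRing p F) ^ N ∣ PowerSeries.coeff i (theta p F))
    {T : Fin (n + 1) →₀ ℕ} (i : ℕ) (u v : Box T) :
    coeffMat T p (MvPolynomial.map (twist p F N i) (dworkPoly p f M N)) u v ∈
      weightIdeal (Ideal.Quotient.mk _ (piElt p F)) (sq_pos_of_prime p)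
        ((p * u.1 0 - v.1 0) * ((p : ℤ) - 1) ^ 2) := by
  rw [coeffMat]
  split_ifs with h
  · rw [coeff_twist_dworkPoly p f hM]
    have h1 := map_mem_weightIdeal (Ideal.Quotient.mk (Ideal.span {(p : DRing p F) ^ N}))
      (coeff_dworkF_mem p hδ hδ₁ (p • u.1 - v.1)).1
    have h2 := map_mem_weightIdeal (twist p F N i) h1
    rw [twist_mk_piElt] at h2
    have h3 := h 0
    rw [Finsupp.smul_apply, smul_eq_mul] at h3
    rwa [Finsupp.tsub_apply, Finsupp.smul_apply, smul_eq_mul, Nat.cast_sub h3, Nat.cast_mul] at h2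
  · exact Ideal.zero_mem _

theorem smul_sub_mem_cone_of_coeffMat_ne_zero {f : MvPolynomial (Fin n) F} {δ : Set (Fin n → ℝ)}
    (hδ : Convex ℝ δ) (hδ₁ : newtonPolytope f ⊆ δ) {M N : ℕ}
    (hM : ∀ i, M ≤ i → (p : DRing p F) ^ N ∣ PowerSeries.coeff i (theta p F))
    {T : Fin (n + 1) →₀ ℕ} (i : ℕ) (u v : Box T)
    (h : coeffMat T p (MvPolynomial.map (twist p F N i) (dworkPoly p f M N)) u v ≠ 0) :
    (p : ℝ) • realVec u.1 - realVec v.1 ∈ cone δ := by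
  rw [coeffMat] at h
  split_ifs at h with hle
  · rw [coeff_twist_dworkPoly p f hM] at h
    rw [← realVec_smul_sub p hle]
    refine (coeff_dworkF_mem p hδ hδ₁ _).2 fun h0 => h ?_
    rw [h0, map_zero, map_zero]
  · exact absurd rfl h

/-- The trace over a box of exponents agrees with the trace of the truncated matrices. -/
theorem trace_dworkProd_pow {f : MvPolynomial (Fin n) F} {δ : Set (Fin n → ℝ)}
    (hδ : Convex ℝ δ) (hδ₁ : newtonPolytope f ⊆ δ) {M N a k : ℕ}
    (ha : Nat.card F = p ^ a) (hak : 0 < a * k)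
    (hM : ∀ i, M ≤ i → (p : DRing p F) ^ N ∣ PowerSeries.coeff i (theta p F))
    {T : Fin (n + 1) →₀ ℕ} (hT : ∀ u : SmallPt p N δ, u.1.1 ∈ Finset.Iic T)
    [Fintype (SmallPt p N δ)] :
    ((List.range (a * k)).map fun i => coeffMat T p
      (MvPolynomial.map (twist p F N (i + 1)) (dworkPoly p f M N))).prod.trace =
    (dworkProd p f δ N a ^ k).trace := by
  have hp1 : ((p - 1 : ℕ) : ℤ) = (p : ℤ) - 1 := by rw [Nat.cast_sub hp.out.one_lt.le, Nat.cast_one]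
  have hp2 : (2 : ℤ) ≤ p := by exact_mod_cast hp.out.two_le
  have hinj : Function.Injective (fun u : SmallPt p N δ => (⟨u.1.1, hT u⟩ : Box T)) :=
    fun u v h => by
      have h2 : u.1.1 = v.1.1 := by simpa using h
      exact Subtype.ext (Subtype.ext h2)
  rw [dworkProd, prod_range_pow]
  swap
  · intro i
    ext u v
    rw [Matrix.map_apply, Matrix.map_apply, tauMod_symm_iterate_add p F ha]
  have hmem := fun i => coeffMat_mem_weightIdeal p hδ hδ₁ hM (T := T) (i + 1)
  rw [trace_prod_eq_trace_prod_submatrix (hs := sq_pos_of_prime p) hinj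
    (X := fun i => coeffMat T p (MvPolynomial.map (twist p F N (i + 1)) (dworkPoly p f M N)))
    (S := fun u => u.1 0 * (p - 1) ^ 2 < p ^ 2 * N) (C := cone δ) (g := fun u => realVec u.1)
    -- With this potential, `(p u₀ - v₀)(p-1)² = φ u - φ v + (p-1) φ u`; the last term is the
    -- surplus. If `u₀ (p-1)² ≥ p² N`, it is at least `p² (p-1)N`, matching `s = p²` and `π^((p-1)N)
    -- = 0`.
    (φ := fun u => u.1 0 * ((p : ℤ) - 1) ^ 2)
    (p := (p : ℝ)) (zero_mem_cone hδ) (fun _ hx _ hy => add_mem_cone hδ hx hy)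
    (fun _ ht _ hx => smul_mem_cone ht hx) (by exact_mod_cast hp.out.one_lt)
    (fun i => smul_sub_mem_cone_of_coeffMat_ne_zero p hδ hδ₁ hM (i + 1)) ?_ ?_
    (mk_piElt_pow_eq_zero p N) ?_ hak]
  · simp only [coeffMat_submatrix p f δ hM hT]
  · intro u
    constructor
    · rintro ⟨v, rfl⟩
      exact ⟨smallPt_weight v, v.1.2⟩
    · rintro ⟨h1, h2⟩
      exact ⟨⟨⟨u.1, h2⟩, (weight_lt_iff h2).mpr h1⟩, rfl⟩
  · intro i u v
    refine weightIdeal_mono ?_ (hmem i u v)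
    have h1 : (0 : ℤ) ≤ (u.1 0 : ℤ) * ((p : ℤ) - 1) ^ 2 := by positivity
    nlinarith
  · intro i u v hS
    refine weightIdeal_mono ?_ (hmem i u v)
    have h1 : ((p ^ 2 * N : ℕ) : ℤ) ≤ ((u.1 0 * (p - 1) ^ 2 : ℕ) : ℤ) := by
      exact_mod_cast not_lt.mp hS
    push_cast [hp1] at h1 ⊢
    have h2 : (p : ℤ) ^ 2 * ((p - 1) * N) ≤ (p - 1) * (u.1 0 * ((p : ℤ) - 1) ^ 2) := by
      calc (p : ℤ) ^ 2 * ((p - 1) * N) = (p - 1) * (p ^ 2 * N) := by ring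
        _ ≤ _ := mul_le_mul_of_nonneg_left h1 (by linarith)
    linarith

theorem trace_formula {a : ℕ} (ha : Nat.card F = p ^ a) (f : MvPolynomial (Fin n) F)
    {δ : Set (Fin n → ℝ)} (hδ : Convex ℝ δ) (hδ₁ : newtonPolytope f ⊆ δ)
    (hδ₂ : δ ⊆ bigSimplex n f.totalDegree) (N : ℕ) [Fintype (SmallPt p N δ)] {k : ℕ} (hk : 0 < k)
    (E : Type*) [Field E] [Finite E] [Algebra F E] (hE : Nat.card E = (p ^ a) ^ k) :
    (((p : DRingMod p F N) ^ a) ^ k - 1) ^ (n + 1) * (dworkProd p f δ N a ^ k).trace =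
      ((p : DRingMod p F N) ^ a) ^ k * (torusCount f E : ℕ) -
        (((p : DRingMod p F N) ^ a) ^ k - 1) ^ n := by
  have := Fintype.ofFinite E
  have := Fintype.ofFinite Eˣ
  have hchar : CharP E p := charP_of_injective_algebraMap (algebraMap F E).injective p
  have ha0 : 0 < a := by
    rcases Nat.eq_zero_or_pos a with rfl | h
    · rw [pow_zero] at ha
      exact absurd (ha ▸ Finite.one_lt_card (α := F)) (lt_irrefl 1)
    · exact h
  have hak : 0 < a * k := Nat.mul_pos ha0 hk
  rw [← pow_mul] at hE
  set m := a * k with hm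
  have hQ : 1 < p ^ m := Nat.one_lt_pow hak.ne' hp.out.one_lt
  -- The precision is `N + 2` because one factor `p` is lost in proving additivity and another in
  -- the vanishing of the character sum. The bound `2 ≤ M` keeps the terms `1 + πz` in the
  -- truncation.
  obtain ⟨M, hM2, hM⟩ : ∃ M, 2 ≤ M ∧ p ^ 2 * ((p - 1) * (N + 1 + 1)) ≤ M :=
    ⟨max 2 (p ^ 2 * ((p - 1) * (N + 1 + 1))), le_max_left _ _, le_max_right _ _⟩
  have hME : ∀ i, M ≤ i → (p : DRing p E) ^ (N + 1 + 1) ∣ PowerSeries.coeff i (theta p E) :=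
    fun i hi => natCast_pow_dvd_coeff_theta p E _ (hM.trans hi)
  have hMF : ∀ i, M ≤ i → (p : DRing p F) ^ N ∣ PowerSeries.coeff i (theta p F) :=
    fun i hi => (pow_dvd_pow _ (by omega)).trans
      (natCast_pow_dvd_coeff_theta p F (N + 1 + 1) (hM.trans hi))
  set G := dworkPoly p f M N with hG
  -- The first summand makes the box contain all indices of `A_N`; the second bounds the supports of
  -- the twisted polynomials, as the product formula requires.
  set T : Fin (n + 1) →₀ ℕ := Finsupp.equivFunOnFinite.symm fun _ =>
    (f.totalDegree + 1) * (p ^ 2 * N) + G.totalDegree with hT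
  have hTS : ∀ u : SmallPt p N δ, u.1.1 ∈ Finset.Iic T := fun u =>
    Finset.mem_Iic.mpr fun i => (smallPt_le hδ hδ₂ u i).trans (Nat.le_add_right _ _)
  set Gt : ℕ → MvPolynomial (Fin (n + 1)) (DRingMod p F N) :=
    fun i => MvPolynomial.map (twist p F N (i + 1)) G with hGt
  have hsupp : ∀ i, ∀ r ∈ (Gt i).support, r ≤ (p - 1) • T := by
    intro i r hr v
    have h1 : r ∈ G.support := MvPolynomial.support_map_subset _ _ hr
    have h2 : r v ≤ G.totalDegree := by
      refine le_trans ?_ (MvPolynomial.le_totalDegree h1)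
      rw [Finsupp.sum_fintype _ _ (fun _ => rfl)]
      exact Finset.single_le_sum (f := fun i => r i) (fun _ _ => Nat.zero_le _)
        (Finset.mem_univ v)
    have h3 : G.totalDegree ≤ T v := Nat.le_add_left _ _
    have h4 : 1 * T v ≤ (p - 1) * T v :=
      Nat.mul_le_mul_right _ (Nat.sub_pos_of_lt hp.out.one_lt)
    rw [Finsupp.smul_apply, smul_eq_mul]
    omega
  have hpow : ∀ c : F, c ^ p ^ m = c := fun c => by
    have h := pow_card_eq p ha
    have h2 : ∀ k, c ^ p ^ (a * k) = c := fun k => by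
      induction k with
      | zero => simp
      | succ k ih => rw [mul_add, mul_one, pow_add, pow_mul, ih, h]
    exact h2 k
  have hp0 : p ≠ 0 := hp.out.ne_zero
  -- the trace in terms of the coefficients of the product
  have htr := trace_dworkProd_pow p hδ hδ₁ ha hak hMF hTS
  rw [prod_coeffMat hp0 m Gt hsupp, trace_coeffMat (by omega)] at htr
  -- the sum over Teichmüller points
  set P := expandProd p m Gt with hP
  have hPsupp : ∀ r ∈ (MvPolynomial.map (extMod p F E N) P).support, r ≤ (p ^ m - 1) • T :=
    fun r hr => le_of_mem_support_expandProd hp0 m Gt hsupp r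
      (MvPolynomial.support_map_subset _ _ hr)
  have hsum := sum_eval_eq (teichUnits p E N) hQ (fun r => sum_teichUnits_pow p E hE N r)
    (MvPolynomial.map (extMod p F E N) P) hPsupp
  simp only [hP, hGt, hG, eval_expandProd_twist p E f M N hpow] at hsum
  -- the character sum
  set ψ : E → DRingMod p E N := fun y => Ideal.Quotient.mk _ (thetaChar p E M m y) with hψ
  have h0 : ψ 0 = 1 := by rw [hψ]; simp only [thetaChar_zero p hM2, map_one]
  have hadd : ∀ x y, ψ (x + y) = ψ x * ψ y := fun x y => by
    rw [hψ]
    simp only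
    rw [← map_mul, eq_comm, ← sub_eq_zero, ← map_sub, Ideal.Quotient.eq_zero_iff_mem,
      Ideal.mem_span_singleton]
    exact (pow_dvd_pow _ (Nat.le_succ N)).trans (thetaChar_add p hE hME hM2 x y)
  have hψsum : ∑ x, ψ x = 0 := by
    rw [hψ, ← map_sum, Ideal.Quotient.eq_zero_iff_mem, Ideal.mem_span_singleton]
    exact sum_thetaChar p hE hME hM2
  have hchs := sum_prod_character E ψ h0 hadd hψsum f
  have hcardE : Fintype.card E = p ^ m := by rw [← Nat.card_eq_fintype_card, hE]
  rw [hcardE] at hchs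
  rw [hchs, Fintype.card_fin] at hsum
  -- The identity has been obtained over `R_E/(p^N)`, where the points live; both sides come from
  -- `R/(p^N)`.
  apply extMod_injective p F E N
  simp only [MvPolynomial.coeff_map] at hsum
  rw [← map_sum] at hsum
  rw [← pow_mul, ← hm, ← htr]
  simp only [map_mul, map_sub, map_pow, map_natCast, map_one]
  push_cast at hsum
  exact hsum.symm

end Main

end DworkTrace
end

theorem mainTheorem6 (p : ℕ) [Fact p.Prime] (a : ℕ)
    (F : Type*) [Field F] [Finite F] [CharP F p] (hF : Nat.card F = p ^ a)
    (n : ℕ) (f : MvPolynomial (Fin n) F)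
    (δ : Set (Fin n → ℝ)) (hδ : DworkTrace.IsLatticePolytope δ)
    (hδ₁ : DworkTrace.newtonPolytope f ⊆ δ) (hδ₂ : δ ⊆ DworkTrace.bigSimplex n f.totalDegree)
    (N : ℕ) (hN : 0 < N) :
    Finite (DworkTrace.SmallPt p N δ) ∧
    (∀ [Fintype (DworkTrace.SmallPt p N δ)] (k : ℕ), 0 < k →
      ∀ (E : Type*) [Field E] [Finite E] [Algebra F E], Nat.card E = (p ^ a) ^ k →
        (((p : DworkTrace.DRingMod p F N) ^ a) ^ k - 1) ^ (n + 1) *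
            Matrix.trace (DworkTrace.dworkProd p f δ N a ^ k) =
          ((p : DworkTrace.DRingMod p F N) ^ a) ^ k * (DworkTrace.torusCount f E : ℕ) -
            (((p : DworkTrace.DRingMod p F N) ^ a) ^ k - 1) ^ n) ∧
    Nat.card (DworkTrace.SmallPt p N δ) =
      DworkTrace.latticeCount
        (((⌈(p : ℝ) ^ 2 * (N : ℝ) / ((p : ℝ) - 1) ^ 2⌉ - 1 : ℤ) : ℝ) • DworkTrace.bigDelta δ) := by
  have hconv : Convex ℝ δ := by
    obtain ⟨S, rfl⟩ := hδ
    exact convex_convexHull ℝ _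
  exact ⟨DworkTrace.finite_smallPt hconv hδ₂, fun k hk E _ _ _ hE =>
    DworkTrace.trace_formula p hF f hconv hδ₁ hδ₂ N hk E hE,
    DworkTrace.card_smallPt hconv hδ₂ hN⟩
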